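/- Let $C$ be a compact connected Riemann surface of genus $g>0$, $p_\infty\in C$, and let $\{\alpha_i,\beta_i\}_{i=1}^g$ be a canonical basis of $H_1(C,\mathbb Z)$. Let $dv_1,\dots,dv_g$ be the holomorphic one-forms with $\int_{\alpha_j}dv_i=\delta_{ij}$, let $\Omega=(\int_{\beta_j}dv_i)$, let $I$ be the Abel map with base point $p_\infty$ (with values in $\mathbb C^g/(\mathbb Z^g+\Omega\mathbb Z^g)$), extended additively to divisors, and let $\theta(v|\Omega)=\sum_{n\in\mathbb Z^g}\exp(\pi i\,{}^tn\Omega n+2\pi i\,{}^tnv)$. Let $\Delta$ be the Riemann divisor: a divisor of degree $g-1$ such that $2\Delta$ is a canonical divisor and $\{I(p_1+\cdots+p_{g-1}-\Delta)\mid p_1,\dots,p_{g-1}\in C\}$ is the zero set of $\theta(\cdot|\Omega)$ in $\mathbb C^g/(\mathbb Z^g+\Omega\mathbb Z^g)$ (it is determined up to linear equivalence). For $e\in\mathbb C^g$ let $L_e$ be the flat line bundle whose character is $\chi(\alpha_j)=1$, $\chi(\beta_j)=e^{2\pi i e_j}$, and put $L_{\Delta,e}=L_\Delta\otimes L_e$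 with $L_\Delta=\mathcal O(\Delta)$. Let $H^0(C,L_{\Delta,e}(*p_\infty))$ be the space of meromorphic sections of $L_{\Delta,e}$ that are holomorphic on $C\setminus\{p_\infty\}$; it is a module over the ring $R$ of meromorphic functions on $C$ that are holomorphic on $C\setminus\{p_\infty\}$. Let $z$ be a local coordinate with simply connected domain containing $p_\infty$ and $z(p_\infty)=0$. Over this domain, sections of $L_{\Delta,e}$ are written as $f(z)\sqrt{dz}$ by means of $L_\Delta^{\otimes2}\cong\Omega^1_C$ and the trivialization of the flat bundle $L_e$ (this fixes $f$ up to a nonzero constant independent of the section). Explicitly: fix a meromorphic one-form $\eta$ with divisor $2\Delta$ and a meromorphic square root $\sigma$ of $\eta/dz$ on the domain of $z$; a section is a multivalued meromorphic function $u$ on $C$ that is multiplied by $\chi(c)$ under continuation along a loop $c$ and whose divisor is $\ge-\Delta$ on $C\setminus\{p_\infty\}$, and $f=u\,\sigma$ on the domain of $z$, for the branch of $u$ continued from $p_\infty$ inside that domain. Let $M,N\ge1$, let $P_1,\dots,P_N,Q_1,\dots,Q_M$ be distinct points of the domain of $z$, different from $p_\infty$, put $p_i=z(P_i)$, $q_j=z(Q_j)$,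 and let $(a_{j,i})$ be a complex $M\times N$ matrix. Let $$b_{N+j,i}=a_{j,i}\prod_{m\ne i}\frac{p_i^{-1}-p_m^{-1}}{q_j^{-1}-p_m^{-1}},\qquad b'_{N+j,i}=b_{N+j,i}\,p_i^{-1}q_j\qquad(1\le j\le M,\ 1\le i\le N),$$ $$W_e=\Bigl\{f\in H^0(C,L_{\Delta,e}(*p_\infty))\ \Big|\ f(p_i)=-\sum_{j=1}^M b'_{N+j,i}\,f(q_j),\ 1\le i\le N\Bigr\},$$ where $f(p_i)$, $f(q_j)$ are the values of the coordinate expression $f(z)$ at $z=p_i$, $z=q_j$. Then the stabilizer $R_e=\{f\in R\mid fW_e\subset W_e\}$ of $W_e$ in $R$ is $$R_e=\{f\in R\mid f(P_i)=f(Q_j)\ \text{for all } i,j \text{ with } b_{N+j,i}\neq0\}.$$ -/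

import Mathlib

open scoped Manifold ContDiff Topology

noncomputable section

namespace KPCurve

variable {C : Type*} [TopologicalSpace C]

/-! ### First homology, intersection numbers, canonical bases -/

/-- The first integral homology group of a path connected space, as the abelianized fundamental
group, written additively. -/
abbrev H1 (C : Type*) [TopologicalSpace C] (x₀ : C) : Type _ :=
  Additive (Abelianization (FundamentalGroup C x₀))

/-- The homology class of (the homotopy class of) a loop at the base point. -/
def homologyClass {x₀ : C} (c : Path.Homotopic.Quotient x₀ x₀) : H1 C x₀ :=
  Additive.ofMul (Abelianization.of (FundamentalGroup.fromPath c))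

/-- The loop `c`, based at an arbitrary point, represents the homology class `h`. -/
def Represents {x₀ x : C} (c : Path x x) (h : H1 C x₀) : Prop :=
  ∃ γ : Path x₀ x, homologyClass (Path.Homotopic.Quotient.mk ((γ.trans c).trans γ.symm)) = h

/-- The parameter values of the crossings of two loops. -/
def crossings {x y : C} (c : Path x x) (d : Path y y) : Set (ℝ × ℝ) :=
  {p | p.1 ∈ Set.Icc (0 : ℝ) 1 ∧ p.2 ∈ Set.Icc (0 : ℝ) 1 ∧ c.extend p.1 = d.extend p.2}

/-- For loops crossing at parameters `p`, the oriented area `Im (conj c' * d')` spanned by their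
velocities in a holomorphic chart at the crossing point. It is nonzero exactly when both velocities
exist and are linearly independent over `ℝ`, and its sign does not depend on the chart. -/
def crossingArea [ChartedSpace ℂ C] {x y : C} (c : Path x x) (d : Path y y) (p : ℝ × ℝ) : ℝ :=
  ((starRingEnd ℂ) (deriv (fun s : ℝ => chartAt ℂ (c.extend p.1) (c.extend s)) p.1) *
    deriv (fun s : ℝ => chartAt ℂ (c.extend p.1) (d.extend s)) p.2).im

/-- The homology classes `h` and `k` have intersection number `n`: they are represented by loops
that cross finitely often, transversally and away from the base points of the loops, and `n` is the
sum of the signs of the crossings. -/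
def HasIntersectionNumber [ChartedSpace ℂ C] {x₀ : C} (h k : H1 C x₀) (n : ℤ) : Prop :=
  ∃ (x y : C) (c : Path x x) (d : Path y y) (hfin : (crossings c d).Finite),
    Represents c h ∧ Represents d k ∧
    (∀ p ∈ crossings c d, p.1 ∈ Set.Ioo (0 : ℝ) 1 ∧ p.2 ∈ Set.Ioo (0 : ℝ) 1 ∧
      crossingArea c d p ≠ 0) ∧
    n = ∑ p ∈ hfin.toFinset, ((SignType.sign (crossingArea c d p) : SignType) : ℤ)

/-- A basis `α_1, …, α_g, β_1, …, β_g` of the first homology (`α_i` is indexed by `Sum.inl i` and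
`β_i` by `Sum.inr i`) is canonical: `α_i·α_j = β_i·β_j = 0` and `α_i·β_j = δ_{ij}`. -/
def IsCanonicalBasis [ChartedSpace ℂ C] {x₀ : C} {g : ℕ}
    (b : Module.Basis (Fin g ⊕ Fin g) ℤ (H1 C x₀)) : Prop :=
  ∀ i j : Fin g,
    HasIntersectionNumber (b (Sum.inl i)) (b (Sum.inl j)) 0 ∧
    HasIntersectionNumber (b (Sum.inr i)) (b (Sum.inr j)) 0 ∧
    HasIntersectionNumber (b (Sum.inl i)) (b (Sum.inr j)) (if i = j then 1 else 0)

/-! ### Differentials and their line integrals -/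

/-- A (not necessarily continuous) field of complex linear forms on the tangent spaces. -/
abbrev OneForm (C : Type*) [TopologicalSpace C] [ChartedSpace ℂ C] : Type _ :=
  (x : C) → TangentSpace 𝓘(ℂ, ℂ) x →L[ℂ] ℂ

/-- The coefficient `η_φ` of a one form in a chart `φ`, so that `η = η_φ(w) dw`, `w = φ(x)`. -/
def coeff [ChartedSpace ℂ C] (η : OneForm C) (φ : OpenPartialHomeomorph C ℂ) (w : ℂ) : ℂ :=
  η (φ.symm w) (mfderiv 𝓘(ℂ, ℂ) 𝓘(ℂ, ℂ) φ.symm w (1 : ℂ))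

/-- Holomorphic one forms. -/
def IsHolomorphicForm [ChartedSpace ℂ C] (η : OneForm C) : Prop :=
  ∀ φ ∈ IsManifold.maximalAtlas 𝓘(ℂ, ℂ) ω C, AnalyticOnNhd ℂ (coeff η φ) φ.target

/-- `η` is a meromorphic one form (in normal form: the coefficients are analytic wherever they have
no pole) which does not vanish identically near any point, with divisor `D`. -/
def HasDivisor [ChartedSpace ℂ C] (η : OneForm C) (D : C →₀ ℤ) : Prop :=
  ∀ φ ∈ IsManifold.maximalAtlas 𝓘(ℂ, ℂ) ω C, ∀ x ∈ φ.source,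
    MeromorphicNFAt (coeff η φ) (φ x) ∧
      meromorphicOrderAt (coeff η φ) (φ x) = ((D x : ℤ) : WithTop ℤ)

/-- The line integral of the holomorphic form `η` along the continuous path `γ` equals `I`:
`I` is the increment of a continuous primitive of `η` along `γ`. -/
def HasLineIntegral [ChartedSpace ℂ C] (η : OneForm C) {x y : C} (γ : Path x y) (I : ℂ) : Prop :=
  ∃ F : unitInterval → ℂ,
    (∀ t₀, ∃ U : Set C, IsOpen U ∧ γ t₀ ∈ U ∧ ∃ G : C → ℂ,
      (∀ x ∈ U, HasMFDerivAt 𝓘(ℂ, ℂ) 𝓘(ℂ, ℂ) G x (η x)) ∧ ∀ᶠ t in 𝓝 t₀, F t = G (γ t)) ∧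
    F 1 - F 0 = I

/-- `dv_1, …, dv_g` are holomorphic one forms normalized by `∫_{α_j} dv_i = δ_{ij}`. -/
def IsNormalizedForms [ChartedSpace ℂ C] {x₀ : C} {g : ℕ}
    (b : Module.Basis (Fin g ⊕ Fin g) ℤ (H1 C x₀)) (dv : Fin g → OneForm C) : Prop :=
  (∀ i, IsHolomorphicForm (dv i)) ∧
  ∀ i j, ∀ c : Path x₀ x₀, homologyClass (Path.Homotopic.Quotient.mk c) = b (Sum.inl j) →
    HasLineIntegral (dv i) c (if i = j then 1 else 0)

/-- `Ω_{ij} = ∫_{β_j} dv_i`. -/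
def IsPeriodMatrix [ChartedSpace ℂ C] {x₀ : C} {g : ℕ}
    (b : Module.Basis (Fin g ⊕ Fin g) ℤ (H1 C x₀)) (dv : Fin g → OneForm C)
    (Ω : Matrix (Fin g) (Fin g) ℂ) : Prop :=
  ∀ i j, ∀ c : Path x₀ x₀, homologyClass (Path.Homotopic.Quotient.mk c) = b (Sum.inr j) →
    HasLineIntegral (dv i) c (Ω i j)

/-! ### Theta function, Abel map, Riemann divisor -/

/-- Riemann's theta function `θ(v|Ω) = ∑_{n ∈ ℤ^g} exp(πi ᵗnΩn + 2πi ᵗnv)`. -/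
def theta {g : ℕ} (Ω : Matrix (Fin g) (Fin g) ℂ) (v : Fin g → ℂ) : ℂ :=
  ∑' n : Fin g → ℤ,
    Complex.exp (Real.pi * Complex.I * ∑ i, ∑ j, (n i : ℂ) * Ω i j * (n j : ℂ) +
      2 * Real.pi * Complex.I * ∑ i, (n i : ℂ) * v i)

/-- The degree of a divisor. -/
def degree (D : C →₀ ℤ) : ℤ := D.sum fun _ k => k

/-- `v ∈ ℂ^g` represents the class of `I(D)` in `ℂ^g / (ℤ^g + Ωℤ^g)`, where `I` is the Abel map with
base point `x₀`. -/
def IsAbelValue [ChartedSpace ℂ C] (x₀ : C) {g : ℕ} (dv : Fin g → OneForm C)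
    (Ω : Matrix (Fin g) (Fin g) ℂ) (D : C →₀ ℤ) (v : Fin g → ℂ) : Prop :=
  ∃ I : C → Fin g → ℂ,
    (∀ x, ∃ γ : Path x₀ x, ∀ i, HasLineIntegral (dv i) γ (I x i)) ∧
    ∃ m n : Fin g → ℤ, ∀ i,
      v i = (D.sum fun x k => (k : ℂ) * I x i) + (m i : ℂ) + ∑ j, Ω i j * (n j : ℂ)

/-- `Δ` is the Riemann divisor (it is determined up to linear equivalence): it has degree `g - 1`,
`2Δ` is a canonical divisor, and the zero set of the theta function is
`{I(p_1 + ⋯ + p_{g-1} - Δ)}`. -/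
def IsRiemannDivisor [ChartedSpace ℂ C] (x₀ : C) {g : ℕ} (dv : Fin g → OneForm C)
    (Ω : Matrix (Fin g) (Fin g) ℂ) (Δ : C →₀ ℤ) : Prop :=
  degree Δ = (g : ℤ) - 1 ∧
  (∃ η : OneForm C, HasDivisor η (2 • Δ)) ∧
  ∀ v : Fin g → ℂ, theta Ω v = 0 ↔
    ∃ D : C →₀ ℤ, 0 ≤ D ∧ degree D = (g : ℤ) - 1 ∧ IsAbelValue x₀ dv Ω (D - Δ) v

/-! ### Functions with a pole only at the marked point -/

/-- The set `R` of meromorphic functions on `C` whose only pole is at `pinf`, as functions on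
`C ∖ {pinf}`: near each `x₀` the function is `(φ - φ(x₀))^n F` with `φ` a chart, `F` holomorphic,
and `n = 0` unless `x₀ = pinf`. -/
def functionRing [ChartedSpace ℂ C] (pinf : C) : Set ({x : C // x ≠ pinf} → ℂ) :=
  {f | ∀ x₀ : C, ∃ n : ℤ, (x₀ ≠ pinf → n = 0) ∧
    ∃ U : Set C, IsOpen U ∧ x₀ ∈ U ∧ U ⊆ (chartAt ℂ x₀).source ∧
      ∃ F : C → ℂ, MDifferentiableOn 𝓘(ℂ, ℂ) 𝓘(ℂ, ℂ) F U ∧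
        ∀ x : {x : C // x ≠ pinf}, (x : C) ∈ U →
          f x = (chartAt ℂ x₀ x - chartAt ℂ x₀ x₀) ^ n * F x}

/-! ### The line bundle `L_{Δ,e}` and its sections -/

/-- The character `χ` of the fundamental group with `χ(α_j) = 1` and `χ(β_j) = exp(2πi e_j)`. -/
def character {x₀ : C} {g : ℕ} (b : Module.Basis (Fin g ⊕ Fin g) ℤ (H1 C x₀))
    (e : Fin g → ℂ) (c : Path.Homotopic.Quotient x₀ x₀) : ℂ :=
  Complex.exp (2 * Real.pi * Complex.I *
    ∑ j, ((b.repr (homologyClass c) (Sum.inr j) : ℤ) : ℂ) * e j)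

/-- The points of `C ∖ {pinf}` outside the support of `Δ`. -/
abbrev GoodPoint (pinf : C) (Δ : C →₀ ℤ) : Type _ := {x : C // x ≠ pinf ∧ Δ x = 0}

/-- Multivalued functions on `C ∖ ({pinf} ∪ supp Δ)` that are single valued on the universal cover
of `C`: functions of a point `x` and of a homotopy class of paths in `C` from `pinf` to `x`. -/
abbrev MultiFun (pinf : C) (Δ : C →₀ ℤ) : Type _ :=
  (x : GoodPoint pinf Δ) → Path.Homotopic.Quotient pinf (x : C) → ℂ

/-- The space `H⁰(C, L_{Δ,e}(*pinf))` of meromorphic sections of `L_{Δ,e} = O(Δ) ⊗ L_e` that are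
holomorphic on `C ∖ {pinf}`, where `L_e` is the flat line bundle with character `χ`: multivalued
meromorphic functions `u` on `C` which are multiplied by `χ(c)` under continuation along a loop `c`
and whose divisor is `≥ -Δ` on `C ∖ {pinf}`. The last clause says that every branch of `u` at every
`x₀` is `(φ - φ(x₀))^n F` with `φ` a chart, `F` holomorphic near `x₀`, and `n = -Δ(x₀)` unless
`x₀ = pinf`. -/
def sections [ChartedSpace ℂ C] {pinf : C} {g : ℕ}
    (b : Module.Basis (Fin g ⊕ Fin g) ℤ (H1 C pinf)) (Δ : C →₀ ℤ) (e : Fin g → ℂ) :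
    Set (MultiFun pinf Δ) :=
  {u | (∀ (c : Path.Homotopic.Quotient pinf pinf) (x : GoodPoint pinf Δ)
      (γ : Path.Homotopic.Quotient pinf (x : C)), u x (c.trans γ) = character b e c * u x γ) ∧
    ∀ (x₀ : C) (γ₀ : Path pinf x₀), ∃ n : ℤ, (x₀ ≠ pinf → n = -Δ x₀) ∧
      ∃ U : Set C, IsOpen U ∧ x₀ ∈ U ∧ U ⊆ (chartAt ℂ x₀).source ∧
        ∃ F : C → ℂ, MDifferentiableOn 𝓘(ℂ, ℂ) 𝓘(ℂ, ℂ) F U ∧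
          ∀ (x : GoodPoint pinf Δ) (δ : Path x₀ (x : C)), (∀ t, δ t ∈ U) →
            u x (Path.Homotopic.Quotient.mk (γ₀.trans δ)) =
              (chartAt ℂ x₀ x - chartAt ℂ x₀ x₀) ^ n * F x}

/-- `σ` is a meromorphic square root of `η/dz` on the domain of the coordinate `z`. If the divisor
of `η` is `2Δ`, it expresses the canonical meromorphic section `√η` of `O(Δ)`, with
`O(Δ)^{⊗2} ≅ Ω¹`, as `σ(z)√dz`. -/
def IsSqrtCoeff [ChartedSpace ℂ C] (η : OneForm C) (z : OpenPartialHomeomorph C ℂ)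
    (σ : ℂ → ℂ) : Prop :=
  MeromorphicNFOn σ z.target ∧ ∀ w ∈ z.target, σ w ^ 2 = coeff η z w

/-- The section `u` of `L_{Δ,e}` is `f(z)√dz` in the coordinate `z` (with `z(pinf) = 0` and simply
connected domain), for the branch of `u` obtained along paths from `pinf` inside the domain of `z`;
that is, `f` is the analytic extension of `u · σ` to the whole domain of `z` except `pinf`. -/
def IsCoordExpr {pinf : C} {Δ : C →₀ ℤ} (z : OpenPartialHomeomorph C ℂ) (σ : ℂ → ℂ)
    (u : MultiFun pinf Δ) (f : ℂ → ℂ) : Prop :=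
  AnalyticOnNhd ℂ f (z.target \ {0}) ∧
  ∀ (x : GoodPoint pinf Δ) (γ : Path pinf (x : C)), (∀ t, γ t ∈ z.source) →
    f (z x) = u x (Path.Homotopic.Quotient.mk γ) * σ (z x)

/-! ### The matrix `B`, the space `W_e` and its stabilizer -/

/-- The `(N+M) × N` matrix `B`; the row index `N + i` is `Sum.inr i`. -/
def matrixB {M N : ℕ} (p : Fin N → ℂ) (q : Fin M → ℂ) (a : Matrix (Fin M) (Fin N) ℂ) :
    Matrix (Fin N ⊕ Fin M) (Fin N) ℂ :=
  Matrix.fromRows 1 (Matrix.of fun i j =>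
    a i j * ∏ m ∈ Finset.univ.erase j, ((p j)⁻¹ - (p m)⁻¹) / ((q i)⁻¹ - (p m)⁻¹))

/-- The space `W_e` of all `f` in `H⁰(C, L_{Δ,e}(*pinf))` with
`f(p_i) = -∑_j b'_{N+j,i} f(q_j)` for all `i`, where `b'_{N+j,i} = b_{N+j,i} p_i⁻¹ q_j`. -/
def spaceW [ChartedSpace ℂ C] {pinf : C} {g : ℕ}
    (b : Module.Basis (Fin g ⊕ Fin g) ℤ (H1 C pinf)) (Δ : C →₀ ℤ) (e : Fin g → ℂ)
    (z : OpenPartialHomeomorph C ℂ) (σ : ℂ → ℂ) {M N : ℕ} (p : Fin N → ℂ) (q : Fin M → ℂ)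
    (B : Matrix (Fin N ⊕ Fin M) (Fin N) ℂ) : Set (MultiFun pinf Δ) :=
  {u | u ∈ sections b Δ e ∧ ∃ f : ℂ → ℂ, IsCoordExpr z σ u f ∧
    ∀ i, f (p i) = -∑ j, (B (Sum.inr j) i * ((p i)⁻¹ * q j)) * f (q j)}

/-- The product of a function and a section. -/
def mulSection {pinf : C} {Δ : C →₀ ℤ} (f : {x : C // x ≠ pinf} → ℂ) (u : MultiFun pinf Δ) :
    MultiFun pinf Δ :=
  fun x γ => f ⟨x, x.2.1⟩ * u x γ

/-- The stabilizer `{f ∈ R | f W ⊆ W}`. -/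
def stabilizer [ChartedSpace ℂ C] {pinf : C} {Δ : C →₀ ℤ} (W : Set (MultiFun pinf Δ)) :
    Set ({x : C // x ≠ pinf} → ℂ) :=
  {f | f ∈ functionRing pinf ∧ ∀ u ∈ W, mulSection f u ∈ W}

end KPCurve

end

noncomputable section

namespace KPCurve

open MeasureTheory Complex Metric

/-! ### The Wirtinger derivative -/

/-- The Wirtinger derivative `∂F/∂z̄`. -/
def dbar (F : ℂ → ℂ) (z : ℂ) : ℂ := (1 / 2) * (fderiv ℝ F z 1 + I * fderiv ℝ F z I)

theorem dbar_congr {F G : ℂ → ℂ} {z : ℂ} (h : F =ᶠ[𝓝 z] G) : dbar F z = dbar G z := by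
  simp only [dbar, h.fderiv_eq]

theorem dbar_eq_zero {F : ℂ → ℂ} {z : ℂ} (h : DifferentiableAt ℂ F z) : dbar F z = 0 := by
  have h1 := (differentiableAt_complex_iff_differentiableAt_real.1 h).2
  simp only [dbar, h1, smul_eq_mul]
  linear_combination (1 / 2) * fderiv ℝ F z 1 * I_mul_I

theorem differentiableAt_of_dbar_eq_zero {F : ℂ → ℂ} {z : ℂ} (h : DifferentiableAt ℝ F z)
    (h0 : dbar F z = 0) : DifferentiableAt ℂ F z := by
  refine differentiableAt_complex_iff_differentiableAt_real.2 ⟨h, ?_⟩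
  simp only [dbar] at h0
  rw [smul_eq_mul]
  linear_combination (-2 * I) * h0 + fderiv ℝ F z I * I_mul_I

theorem dbar_sub {F G : ℂ → ℂ} {z : ℂ} (hF : DifferentiableAt ℝ F z)
    (hG : DifferentiableAt ℝ G z) : dbar (fun w => F w - G w) z = dbar F z - dbar G z := by
  simp only [dbar, fderiv_fun_sub hF hG, _root_.sub_apply]
  ring

theorem dbar_sum {ι : Type*} (s : Finset ι) {F : ι → ℂ → ℂ} {z : ℂ}
    (hF : ∀ i ∈ s, DifferentiableAt ℝ (F i) z) :
    dbar (fun w => ∑ i ∈ s, F i w) z = ∑ i ∈ s, dbar (F i) z := by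
  simp only [dbar, fderiv_fun_sum hF, _root_.sum_apply, Finset.mul_sum,
    ← Finset.sum_add_distrib]

theorem dbar_mul {F G : ℂ → ℂ} {z : ℂ} (hF : DifferentiableAt ℝ F z)
    (hG : DifferentiableAt ℝ G z) :
    dbar (fun w => F w * G w) z = dbar F z * G z + F z * dbar G z := by
  simp only [dbar, fderiv_fun_mul hF hG, _root_.add_apply,
    _root_.smul_apply, smul_eq_mul]
  ring

/-- A real-linear endomorphism of `ℂ` splits into a complex-linear and a conjugate-linear part, and
`dbar` is the coefficient of the latter. -/
theorem fderiv_eq_conj_dbar (F : ℂ → ℂ) (z v : ℂ) :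
    fderiv ℝ F z v = (1 / 2) * (fderiv ℝ F z 1 - I * fderiv ℝ F z I) * v +
      dbar F z * (starRingEnd ℂ) v := by
  have hv : v = v.re • (1 : ℂ) + v.im • I := by
    apply Complex.ext <;> simp
  have h1 : fderiv ℝ F z v = (v.re : ℂ) * fderiv ℝ F z 1 + (v.im : ℂ) * fderiv ℝ F z I := by
    conv_lhs => rw [hv]
    rw [map_add, map_smul, map_smul, real_smul, real_smul]
  have h2 : v = (v.re : ℂ) + v.im * I := (re_add_im v).symm
  have h3 : (starRingEnd ℂ) v = (v.re : ℂ) - v.im * I := by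
    apply Complex.ext <;> simp
  rw [h1, h3, dbar]
  conv_rhs => rw [h2]
  simp only [add_re, ofReal_re, mul_re, I_re, mul_zero, ofReal_im, I_im, mul_one, sub_self,
    add_zero, add_im, mul_im, zero_add]
  linear_combination (v.im : ℂ) * fderiv ℝ F z I * I_mul_I

/-- The derivative of `g` is complex-linear, so it does not mix the two parts of the differential;
the factor `conj g'` is the transformation law of a `(0,1)`-form. -/
theorem dbar_comp {F g : ℂ → ℂ} {z : ℂ} (hF : DifferentiableAt ℝ F (g z))
    (hg : DifferentiableAt ℂ g z) :
    dbar (fun w => F (g w)) z = (starRingEnd ℂ) (deriv g z) * dbar F (g z) := by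
  have hgr : HasFDerivAt g ((fderiv ℂ g z).restrictScalars ℝ) z :=
    hg.hasFDerivAt.restrictScalars ℝ
  have h := hF.hasFDerivAt.comp z hgr
  have h1 : ∀ v, fderiv ℝ (fun w => F (g w)) z v = fderiv ℝ F (g z) (deriv g z * v) := by
    intro v
    have : fderiv ℝ (fun w => F (g w)) z = _ := h.fderiv
    rw [this]
    simp [mul_comm]
  rw [dbar, h1, h1, fderiv_eq_conj_dbar F (g z), fderiv_eq_conj_dbar F (g z) (deriv g z * I)]
  simp only [mul_one, map_mul, conj_I]
  set a := (1 / 2 : ℂ) * (fderiv ℝ F (g z) 1 - I * fderiv ℝ F (g z) I)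
  linear_combination (1 / 2) * (a * deriv g z - dbar F (g z) * (starRingEnd ℂ) (deriv g z)) * I_mul_I

theorem contDiffAt_dbar {F : ℂ → ℂ} {z : ℂ} (hF : ContDiffAt ℝ 2 F z) :
    ContDiffAt ℝ 1 (dbar F) z := by
  have h : ContDiffAt ℝ 1 (fderiv ℝ F) z := hF.fderiv_right (m := 1) (by norm_num)
  unfold dbar
  exact contDiffAt_const.mul ((h.clm_apply contDiffAt_const).add
    (contDiffAt_const.mul (h.clm_apply contDiffAt_const)))

theorem dbar_eq_zero_of_eventuallyEq_const {F : ℂ → ℂ} {z c : ℂ} (h : F =ᶠ[𝓝 z] fun _ => c) :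
    dbar F z = 0 := by
  rw [dbar_congr h]
  exact dbar_eq_zero (differentiableAt_const c)

/-! ### The Cauchy transform -/

/-- In polar coordinates the Jacobian `r` cancels the singularity `r⁻¹`. -/
theorem integrableOn_inv_ball (R : ℝ) : IntegrableOn (fun t : ℂ => t⁻¹) (ball 0 R) := by
  have h : IntegrableOn (fun t : ℂ => ‖t‖⁻¹) (ball 0 R) := by
    rw [integrableOn_fun_norm_addHaar volume (f := fun r : ℝ => r⁻¹)]
    simp only [finrank_real_complex]
    have : IntegrableOn (fun _ : ℝ => (1 : ℝ)) (Set.Ioo 0 R) := by simp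
    refine this.congr_fun ?_ measurableSet_Ioo
    intro x hx
    have : x ≠ 0 := hx.1.ne'
    simp [this]
  refine (integrable_norm_iff ?_).1 ?_
  · exact measurable_inv.aestronglyMeasurable
  · simpa [IntegrableOn] using h

theorem locallyIntegrable_inv : LocallyIntegrable (fun t : ℂ => t⁻¹) := by
  intro x
  refine ⟨ball 0 (‖x‖ + 1), isOpen_ball.mem_nhds (by simp), integrableOn_inv_ball _⟩

/-- Splits the integrand of the Cauchy–Pompeiu formula into a radial and an angular derivative, each
of which integrates exactly. -/
theorem dbar_polar {F : ℂ → ℂ} (z : ℂ) {u : ℂ} (hu : u * (starRingEnd ℂ) u = 1) :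
    dbar F z * u⁻¹ = (1 / 2) * fderiv ℝ F z u + (I / 2) * fderiv ℝ F z (I * u) := by
  have : u⁻¹ = (starRingEnd ℂ) u := inv_eq_of_mul_eq_one_right hu
  rw [this, fderiv_eq_conj_dbar F z u, fderiv_eq_conj_dbar F z (I * u)]
  simp only [map_mul, conj_I]
  set a := (1 / 2 : ℂ) * (fderiv ℝ F z 1 - I * fderiv ℝ F z I)
  linear_combination ((1 / 2) * dbar F z * (starRingEnd ℂ) u - (1 / 2) * a * u) * I_mul_I

/-- Cauchy–Pompeiu formula for functions with compact support. -/
theorem integral_inv_mul_dbar {F : ℂ → ℂ} (hF : ContDiff ℝ 1 F) (hc : HasCompactSupport F) :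
    ∫ t : ℂ, t⁻¹ * dbar F t = -Real.pi * F 0 := by
  obtain ⟨R, hR⟩ := hc.isCompact.isBounded.subset_ball 0
  set E : ℝ → ℂ := fun θ => Real.cos θ + Real.sin θ * I with hE
  have hEE : ∀ θ, E θ * (starRingEnd ℂ) (E θ) = 1 := by
    intro θ
    have := Real.sin_sq_add_cos_sq θ
    rw [mul_conj, hE]
    norm_cast
    rw [normSq_add_mul_I]
    linarith
  have hEn : ∀ θ, ‖E θ‖ = 1 := by
    intro θ
    have h := hEE θ
    rw [mul_conj, normSq_eq_norm_sq] at h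
    have h2 : ‖E θ‖ ^ 2 = 1 := by exact_mod_cast h
    nlinarith [norm_nonneg (E θ)]
  have hEc : Continuous E := by fun_prop
  have hdF : Continuous (fderiv ℝ F) := hF.continuous_fderiv one_ne_zero
  have hdF0 : ∀ z, R ≤ ‖z‖ → fderiv ℝ F z = 0 := by
    intro z hz
    have : z ∉ tsupport F := fun h => by
      have := hR h
      rw [mem_ball_zero_iff] at this
      linarith
    exact image_eq_zero_of_notMem_tsupport fun h => this (tsupport_fderiv_subset ℝ h)
  set G1 : ℝ × ℝ → ℂ := fun p => (1 / 2) * fderiv ℝ F (p.1 * E p.2) (E p.2) with hG1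
  set G2 : ℝ × ℝ → ℂ := fun p => (I / 2) * fderiv ℝ F (p.1 * E p.2) (I * E p.2) with hG2
  have hmap : Continuous fun p : ℝ × ℝ => (p.1 * E p.2 : ℂ) := by fun_prop
  have hG1c : Continuous G1 := by
    have : Continuous fun p : ℝ × ℝ => fderiv ℝ F (p.1 * E p.2) (E p.2) :=
      (hdF.comp hmap).clm_apply (hEc.comp continuous_snd)
    fun_prop
  have hG2c : Continuous G2 := by
    have : Continuous fun p : ℝ × ℝ => fderiv ℝ F (p.1 * E p.2) (I * E p.2) :=
      (hdF.comp hmap).clm_apply (continuous_const.mul (hEc.comp continuous_snd))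
    fun_prop
  have hint : ∀ G : ℝ × ℝ → ℂ, Continuous G → (∀ p : ℝ × ℝ, R ≤ p.1 → 0 ≤ p.1 → G p = 0) →
      IntegrableOn G (Set.Ioi (0 : ℝ) ×ˢ Set.Ioo (-Real.pi) Real.pi) := by
    intro G hG h0
    have h1 : IntegrableOn G (Set.Icc (0 : ℝ) R ×ˢ Set.Icc (-Real.pi) Real.pi) :=
      hG.continuousOn.integrableOn_compact (isCompact_Icc.prod isCompact_Icc)
    refine h1.of_forall_sdiff_eq_zero (measurableSet_Ioi.prod measurableSet_Ioo) ?_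
    rintro p ⟨⟨hp1, hp2⟩, hp3⟩
    refine h0 p ?_ (le_of_lt hp1)
    by_contra hlt
    exact hp3 ⟨⟨le_of_lt hp1, le_of_lt (not_le.1 hlt)⟩, le_of_lt hp2.1, le_of_lt hp2.2⟩
  have hz : ∀ p : ℝ × ℝ, R ≤ p.1 → 0 ≤ p.1 → fderiv ℝ F (p.1 * E p.2) = 0 := by
    intro p h1 h2
    apply hdF0
    rw [norm_mul, hEn, mul_one, norm_real, Real.norm_of_nonneg h2]
    exact h1
  have hI1 := hint G1 hG1c fun p h1 h2 => by simp [hG1, hz p h1 h2]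
  have hI2 := hint G2 hG2c fun p h1 h2 => by simp [hG2, hz p h1 h2]
  have hdiff : Differentiable ℝ F := hF.differentiable one_ne_zero
  rw [← Complex.integral_comp_polarCoord_symm]
  have hpt : ∀ p ∈ polarCoord.target,
      p.1 • ((Complex.polarCoord.symm p)⁻¹ * dbar F (Complex.polarCoord.symm p)) =
        G1 p + G2 p := by
    intro p hp
    have hp0 : (0 : ℝ) < p.1 := hp.1
    have hp0' : (p.1 : ℂ) ≠ 0 := by exact_mod_cast hp0.ne'
    rw [Complex.polarCoord_symm_apply]
    change p.1 • (((p.1 : ℂ) * E p.2)⁻¹ * dbar F (p.1 * E p.2)) = _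
    rw [hG1, hG2]
    simp only
    rw [← dbar_polar _ (hEE p.2), real_smul, mul_inv]
    field_simp
  rw [setIntegral_congr_fun (by exact measurableSet_Ioi.prod measurableSet_Ioo) hpt]
  change ∫ p in Set.Ioi (0 : ℝ) ×ˢ Set.Ioo (-Real.pi) Real.pi, G1 p + G2 p = _
  rw [integral_add hI1 hI2]
  -- The radial part: along each ray the integral telescopes to `-F 0 / 2`, and the angle
  -- contributes `2π`.
  have hA : ∫ p in Set.Ioi (0 : ℝ) ×ˢ Set.Ioo (-Real.pi) Real.pi, G1 p = -Real.pi * F 0 := by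
    rw [Measure.volume_eq_prod, ← Measure.prod_restrict, integral_prod_symm _ (by
      rw [Measure.prod_restrict]; exact hI1)]
    have : ∀ θ : ℝ, ∫ r in Set.Ioi (0 : ℝ), G1 (r, θ) = -(1 / 2) * F 0 := by
      intro θ
      have hd : ∀ r ∈ Set.Ici (0 : ℝ), HasDerivAt (fun r : ℝ => (1 / 2) * F (r * E θ)) (G1 (r, θ)) r := by
        intro r _
        have h1 : HasDerivAt (fun r : ℝ => (r : ℂ) * E θ) (E θ) r := by
          simpa using (ofRealCLM.hasDerivAt (x := r)).mul_const (E θ)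
        exact ((hdiff _).hasFDerivAt.comp_hasDerivAt r h1).const_mul _
      have hi : IntegrableOn (fun r : ℝ => G1 (r, θ)) (Set.Ioi 0) := by
        have h1 : IntegrableOn (fun r : ℝ => G1 (r, θ)) (Set.Icc 0 R) :=
          (hG1c.comp (by fun_prop : Continuous fun r : ℝ => (r, θ))).continuousOn.integrableOn_compact
            isCompact_Icc
        refine h1.of_forall_sdiff_eq_zero measurableSet_Ioi ?_
        rintro r ⟨hr1, hr2⟩
        have : R ≤ r := by
          by_contra hlt
          exact hr2 ⟨le_of_lt hr1, le_of_lt (not_le.1 hlt)⟩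
        simp [hG1, hz (r, θ) this (le_of_lt hr1)]
      have ht : Filter.Tendsto (fun r : ℝ => (1 / 2) * F (r * E θ)) Filter.atTop (𝓝 0) := by
        refine tendsto_const_nhds.congr' ?_
        filter_upwards [Filter.eventually_ge_atTop R, Filter.eventually_ge_atTop 0] with r h1 h2
        have : F (r * E θ) = 0 := by
          apply image_eq_zero_of_notMem_tsupport
          intro h
          have := hR h
          rw [mem_ball_zero_iff, norm_mul, hEn, mul_one, norm_real, Real.norm_of_nonneg h2] at this
          linarith
        simp [this]
      rw [integral_Ioi_of_hasDerivAt_of_tendsto' hd hi ht]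
      simp
    simp_rw [this]
    simp only [integral_const, MeasurableSet.univ, measureReal_restrict_apply, Set.univ_inter,
      Real.volume_real_Ioo, real_smul]
    rw [max_eq_left (by linarith [Real.pi_pos])]
    push_cast
    ring
  -- The angular part: on each circle it is the derivative of a periodic function.
  have hB : ∫ p in Set.Ioi (0 : ℝ) ×ˢ Set.Ioo (-Real.pi) Real.pi, G2 p = 0 := by
    rw [Measure.volume_eq_prod, ← Measure.prod_restrict, integral_prod _ (by
      rw [Measure.prod_restrict]; exact hI2)]
    refine setIntegral_eq_zero_of_forall_eq_zero ?_
    intro r hr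
    have hr0 : (r : ℂ) ≠ 0 := by exact_mod_cast (show (0 : ℝ) < r from hr).ne'
    have hd : ∀ θ ∈ Set.uIcc (-Real.pi) Real.pi,
        HasDerivAt (fun θ : ℝ => (I / 2) * (r : ℂ)⁻¹ * F (r * E θ)) (G2 (r, θ)) θ := by
      intro θ _
      have h1 : HasDerivAt E (I * E θ) θ := by
        have hc := (Real.hasDerivAt_cos θ).ofReal_comp
        have hs := ((Real.hasDerivAt_sin θ).ofReal_comp).mul_const I
        convert! hc.add hs using 1
        simp only [hE]
        push_cast
        linear_combination (Complex.sin θ) * I_mul_I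
      have h3 := ((hdiff (r * E θ)).hasFDerivAt.comp_hasDerivAt θ
        (h1.const_mul (r : ℂ))).const_mul ((I / 2) * (r : ℂ)⁻¹)
      convert! h3 using 1
      simp only [hG2]
      have : ((r : ℂ) * (I * E θ)) = r • (I * E θ) := by rw [real_smul]
      rw [this, map_smul, real_smul]
      field_simp
    have h2 := intervalIntegral.integral_eq_sub_of_hasDerivAt hd
      ((hG2c.comp (by fun_prop : Continuous fun θ : ℝ => (r, θ))).intervalIntegrable _ _)
    rw [intervalIntegral.integral_of_le (by linarith [Real.pi_pos]),
      integral_Ioc_eq_integral_Ioo] at h2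
    rw [h2]
    simp [hE]
  rw [hA, hB, add_zero]

/-- The Cauchy transform `(1/π) ∫ h(w) / (ζ - w) dA(w)`. -/
def cauchyTransform (h : ℂ → ℂ) (ζ : ℂ) : ℂ := (Real.pi : ℂ)⁻¹ * ∫ w : ℂ, (ζ - w)⁻¹ * h w

open scoped Convolution in
theorem cauchyTransform_eq_convolution (h : ℂ → ℂ) :
    cauchyTransform h = fun ζ => (Real.pi : ℂ)⁻¹ *
      ((fun t : ℂ => t⁻¹) ⋆[ContinuousLinearMap.mul ℝ ℂ, volume] h) ζ := by
  funext ζ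
  rw [convolution_eq_swap]
  rfl

theorem contDiff_cauchyTransform {h : ℂ → ℂ} (hh : ContDiff ℝ 1 h) (hc : HasCompactSupport h) :
    ContDiff ℝ 1 (cauchyTransform h) := by
  rw [cauchyTransform_eq_convolution]
  exact contDiff_const.mul
    (hc.contDiff_convolution_right (n := 1) _ locallyIntegrable_inv (by exact_mod_cast hh))

/-- Differentiation of the convolution falls on `h`; what remains is the Cauchy–Pompeiu formula for
`t ↦ h (ζ - t)`, whose value at `0` is `h ζ`. -/
theorem dbar_cauchyTransform {h : ℂ → ℂ} (hh : ContDiff ℝ 1 h) (hc : HasCompactSupport h) (ζ : ℂ) :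
    dbar (cauchyTransform h) ζ = h ζ := by
  set L := ContinuousLinearMap.mul ℝ ℂ
  have hD := hc.hasFDerivAt_convolution_right L locallyIntegrable_inv hh ζ
  have hI : ConvolutionExistsAt (fun t : ℂ => t⁻¹) (fderiv ℝ h) ζ (L.precompR ℂ) volume :=
    (hc.fderiv ℝ).convolutionExists_right _ locallyIntegrable_inv
      (hh.continuous_fderiv one_ne_zero) ζ
  have hv : ∀ v : ℂ, fderiv ℝ (cauchyTransform h) ζ v =
      (Real.pi : ℂ)⁻¹ * ∫ t : ℂ, t⁻¹ * fderiv ℝ h (ζ - t) v := by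
    intro v
    rw [cauchyTransform_eq_convolution, (hD.const_mul ((Real.pi : ℂ)⁻¹)).fderiv]
    rw [_root_.smul_apply, smul_eq_mul]
    congr 1
    rw [convolution_def, ContinuousLinearMap.integral_apply hI]
    rfl
  have hint : ∀ v : ℂ, Integrable fun t : ℂ => t⁻¹ * fderiv ℝ h (ζ - t) v := by
    intro v
    exact hI.integrable.apply_continuousLinearMap v
  set F : ℂ → ℂ := fun t => h (ζ - t) with hF
  have hFc : ContDiff ℝ 1 F := hh.comp (contDiff_const.sub contDiff_id)
  have hFs : HasCompactSupport F := hc.comp_homeomorph (Homeomorph.subLeft ζ)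
  have hFd : ∀ t v, fderiv ℝ F t v = -fderiv ℝ h (ζ - t) v := by
    intro t v
    have h1 : HasFDerivAt F ((fderiv ℝ h (ζ - t)).comp (-ContinuousLinearMap.id ℝ ℂ)) t := by
      refine ((hh.differentiable one_ne_zero) (ζ - t)).hasFDerivAt.comp t ?_
      simpa using (hasFDerivAt_id (𝕜 := ℝ) t).const_sub ζ
    rw [h1.fderiv]
    simp
  have key := integral_inv_mul_dbar hFc hFs
  have : ∀ t : ℂ, t⁻¹ * dbar F t = -((1 / 2) * (t⁻¹ * fderiv ℝ h (ζ - t) 1)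
      + (I / 2) * (t⁻¹ * fderiv ℝ h (ζ - t) I)) := by
    intro t
    simp only [dbar, hFd]
    ring
  simp_rw [this] at key
  rw [integral_neg, integral_add ((hint 1).const_mul _) ((hint I).const_mul _),
    integral_const_mul, integral_const_mul] at key
  have hpi : (Real.pi : ℂ) ≠ 0 := by exact_mod_cast Real.pi_ne_zero
  rw [dbar, hv, hv]
  have hF0 : F 0 = h ζ := by simp [hF]
  rw [hF0] at key
  set J1 := ∫ t : ℂ, t⁻¹ * fderiv ℝ h (ζ - t) 1
  set J2 := ∫ t : ℂ, t⁻¹ * fderiv ℝ h (ζ - t) I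
  field_simp
  linear_combination (-2) * key

end KPCurve

namespace KPCurve

open MeasureTheory Complex Metric

/-! ### The Cauchy transform outside the closed unit disc -/

/-- The Cauchy transform of the restriction of `h` to the closed unit disc. -/
def cauchyDisc (h : ℂ → ℂ) (ζ : ℂ) : ℂ :=
  (Real.pi : ℂ)⁻¹ * ∫ w in closedBall (0 : ℂ) 1, (ζ - w)⁻¹ * h w

/-- The moments of `h` on the closed unit disc. -/
def discMoment (h : ℂ → ℂ) (m : ℕ) : ℂ :=
  (Real.pi : ℂ)⁻¹ * ∫ w in closedBall (0 : ℂ) 1, w ^ m * h w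

/-- The remainder after `n` terms of the Laurent expansion of `cauchyDisc h` at infinity. -/
def cauchyTail (n : ℕ) (h : ℂ → ℂ) (ζ : ℂ) : ℂ := (ζ ^ n)⁻¹ * cauchyDisc (fun w => w ^ n * h w) ζ

theorem cauchyTransform_eq_cauchyDisc {h : ℂ → ℂ} (hs : ∀ z, h z ≠ 0 → ‖z‖ ≤ 1) :
    cauchyTransform h = cauchyDisc h := by
  funext ζ
  rw [cauchyTransform, cauchyDisc, setIntegral_eq_integral_of_forall_compl_eq_zero]
  intro w hw
  by_contra hne
  exact hw (mem_closedBall_zero_iff.2 (hs w (right_ne_zero_of_mul hne)))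

theorem isOpen_one_lt_norm : IsOpen {ζ : ℂ | 1 < ‖ζ‖} :=
  isOpen_lt continuous_const continuous_norm

theorem norm_sub_ge {ζ w : ℂ} {r : ℝ} (hζ : r ≤ ‖ζ‖) (hw : w ∈ closedBall (0 : ℂ) 1) :
    r - 1 ≤ ‖ζ - w‖ := by
  have h1 := norm_sub_norm_le ζ w
  have h2 : ‖w‖ ≤ 1 := mem_closedBall_zero_iff.1 hw
  linarith

theorem continuousOn_cauchyKernel {h : ℂ → ℂ} (hh : Continuous h) {ζ : ℂ} (hζ : 1 < ‖ζ‖) :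
    ContinuousOn (fun w => (ζ - w)⁻¹ * h w) (closedBall 0 1) := by
  refine ContinuousOn.mul (ContinuousOn.inv₀ (by fun_prop) ?_) hh.continuousOn
  intro w hw h0
  have := norm_sub_ge le_rfl hw (ζ := ζ)
  rw [h0, norm_zero] at this
  linarith

theorem integrableOn_cauchyKernel {h : ℂ → ℂ} (hh : Continuous h) {ζ : ℂ} (hζ : 1 < ‖ζ‖) :
    IntegrableOn (fun w => (ζ - w)⁻¹ * h w) (closedBall 0 1) :=
  (continuousOn_cauchyKernel hh hζ).integrableOn_compact (isCompact_closedBall 0 1)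

theorem differentiableOn_cauchyDisc {h : ℂ → ℂ} (hh : Continuous h) :
    DifferentiableOn ℂ (cauchyDisc h) {ζ | 1 < ‖ζ‖} := by
  intro ζ₀ hζ₀
  refine DifferentiableAt.differentiableWithinAt ?_
  obtain ⟨r, hr1, hr2⟩ := exists_between (show (1 : ℝ) < ‖ζ₀‖ from hζ₀)
  obtain ⟨C, hC⟩ := (isCompact_closedBall (0 : ℂ) 1).exists_bound_of_continuousOn hh.continuousOn
  have hs : {ζ : ℂ | r < ‖ζ‖} ∈ 𝓝 ζ₀ :=
    (isOpen_lt continuous_const continuous_norm).mem_nhds hr2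
  have key := hasDerivAt_integral_of_dominated_loc_of_deriv_le (𝕜 := ℂ)
    (μ := volume.restrict (closedBall (0 : ℂ) 1)) (F := fun ζ w => (ζ - w)⁻¹ * h w)
    (F' := fun ζ w => -((ζ - w) ^ 2)⁻¹ * h w) (x₀ := ζ₀) (bound := fun _ => ((r - 1) ^ 2)⁻¹ * C)
    hs ?_ ?_ ?_ ?_ ?_ ?_
  · exact (key.2.const_mul _).differentiableAt
  · filter_upwards [hs] with ζ hζ
    exact (integrableOn_cauchyKernel hh (hr1.trans hζ)).aestronglyMeasurable
  · exact integrableOn_cauchyKernel hh hζ₀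
  · refine ContinuousOn.aestronglyMeasurable ?_ measurableSet_closedBall
    refine ContinuousOn.mul (ContinuousOn.neg (ContinuousOn.inv₀ (by fun_prop) ?_)) hh.continuousOn
    intro w hw h0
    have := norm_sub_ge hr2.le hw (ζ := ζ₀)
    rw [pow_eq_zero_iff two_ne_zero] at h0
    rw [h0, norm_zero] at this
    linarith
  · refine (ae_restrict_iff' measurableSet_closedBall).2 (Filter.Eventually.of_forall ?_)
    intro w hw ζ hζ
    have h1 := norm_sub_ge (le_of_lt hζ) hw
    rw [norm_mul, norm_neg, norm_inv, norm_pow]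
    have h0 : 0 < r - 1 := by linarith
    gcongr
    exact hC w hw
  · exact integrableOn_const (by simp)
  · refine (ae_restrict_iff' measurableSet_closedBall).2 (Filter.Eventually.of_forall ?_)
    intro w hw ζ hζ
    have h1 := norm_sub_ge (le_of_lt hζ) hw
    have hne : ζ - w ≠ 0 := by
      intro h0
      rw [h0, norm_zero] at h1
      linarith
    have h2 := ((hasDerivAt_id ζ).sub_const w).inv hne
    convert! h2.mul_const (h w) using 1
    simp [neg_div]

theorem differentiableOn_cauchyTail (n : ℕ) {h : ℂ → ℂ} (hh : Continuous h) :
    DifferentiableOn ℂ (cauchyTail n h) {ζ | 1 < ‖ζ‖} := by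
  refine DifferentiableOn.mul (DifferentiableOn.inv (by fun_prop) ?_)
    (differentiableOn_cauchyDisc (by fun_prop))
  intro ζ hζ h0
  have h1 : (1 : ℝ) < ‖ζ‖ := hζ
  rw [eq_zero_of_pow_eq_zero h0, norm_zero] at h1
  linarith

/-- The kernel is at most `2`, since `ζ` has distance at least `1/2` from the disc, and the area `π`
cancels the normalization. -/
theorem norm_cauchyDisc_le {h : ℂ → ℂ} {C : ℝ} (hC : ∀ w ∈ closedBall (0 : ℂ) 1, ‖h w‖ ≤ C)
    {ζ : ℂ} (hζ : 3 / 2 ≤ ‖ζ‖) : ‖cauchyDisc h ζ‖ ≤ 2 * C := by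
  have h1 : ‖∫ w in closedBall (0 : ℂ) 1, (ζ - w)⁻¹ * h w‖ ≤
      2 * C * volume.real (closedBall (0 : ℂ) 1) := by
    refine norm_setIntegral_le_of_norm_le_const (isCompact_closedBall (0 : ℂ) 1).measure_lt_top ?_
    intro w hw
    have h2 := norm_sub_ge hζ hw
    rw [norm_mul, norm_inv]
    have h3 : ‖ζ - w‖⁻¹ ≤ 2 := by
      rw [inv_le_comm₀ (by linarith) (by norm_num)]
      linarith
    exact mul_le_mul h3 (hC w hw) (norm_nonneg _) (by norm_num)
  have h2 : volume.real (closedBall (0 : ℂ) 1) = Real.pi := by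
    simp [Measure.real, Complex.volume_closedBall]
  rw [h2] at h1
  rw [cauchyDisc, norm_mul, norm_inv, norm_real, Real.norm_of_nonneg Real.pi_pos.le,
    inv_mul_le_iff₀ Real.pi_pos]
  linarith

theorem norm_cauchyTail_le (n : ℕ) {h : ℂ → ℂ} {C : ℝ}
    (hC : ∀ w ∈ closedBall (0 : ℂ) 1, ‖h w‖ ≤ C) {ζ : ℂ} (hζ : 3 / 2 ≤ ‖ζ‖) :
    ‖cauchyTail n h ζ‖ ≤ (2 / 3) ^ n * (2 * C) := by
  have hC0 : 0 ≤ C := (norm_nonneg _).trans (hC 0 (by simp))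
  rw [cauchyTail, norm_mul, norm_inv, norm_pow]
  refine mul_le_mul ?_ (norm_cauchyDisc_le ?_ hζ) (norm_nonneg _) (by positivity)
  · rw [← inv_pow]
    refine pow_le_pow_left₀ (by positivity) ?_ n
    rw [inv_le_comm₀ (by linarith) (by norm_num)]
    norm_num
    linarith
  · intro w hw
    have h1 : ‖w‖ ≤ 1 := mem_closedBall_zero_iff.1 hw
    rw [norm_mul, norm_pow]
    calc ‖w‖ ^ n * ‖h w‖ ≤ 1 * ‖h w‖ := by
          gcongr
          exact pow_le_one₀ (norm_nonneg _) h1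
      _ ≤ C := by rw [one_mul]; exact hC w hw

/-- Iterates `1/(ζ - w) = 1/ζ + w/(ζ(ζ - w))`. -/
theorem cauchyDisc_eq_sum_add_tail (n : ℕ) {h : ℂ → ℂ} (hh : Continuous h) {ζ : ℂ}
    (hζ : 1 < ‖ζ‖) :
    cauchyDisc h ζ = ∑ m ∈ Finset.range n, (ζ ^ (m + 1))⁻¹ * discMoment h m + cauchyTail n h ζ := by
  have hζ0 : ζ ≠ 0 := by
    rintro rfl
    rw [norm_zero] at hζ
    linarith
  induction n with
  | zero => simp [cauchyTail]
  | succ n ih =>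
    rw [ih, Finset.sum_range_succ, add_assoc]
    congr 1
    have h1 : cauchyDisc (fun w => w ^ n * h w) ζ =
        ζ⁻¹ * discMoment h n + ζ⁻¹ * cauchyDisc (fun w => w ^ (n + 1) * h w) ζ := by
      simp only [cauchyDisc, discMoment]
      have i1 : IntegrableOn (fun w : ℂ => w ^ n * h w) (closedBall 0 1) :=
        (Continuous.continuousOn (by fun_prop)).integrableOn_compact (isCompact_closedBall 0 1)
      have i2 : IntegrableOn (fun w : ℂ => (ζ - w)⁻¹ * (w ^ (n + 1) * h w)) (closedBall 0 1) :=
        integrableOn_cauchyKernel (h := fun w => w ^ (n + 1) * h w) (by fun_prop) hζ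
      have h2 : ∫ w in closedBall (0 : ℂ) 1, (ζ - w)⁻¹ * (w ^ n * h w) =
          ∫ w in closedBall (0 : ℂ) 1,
            (ζ⁻¹ * (w ^ n * h w) + ζ⁻¹ * ((ζ - w)⁻¹ * (w ^ (n + 1) * h w))) := by
        refine setIntegral_congr_fun measurableSet_closedBall ?_
        intro w hw
        have hne : ζ - w ≠ 0 := by
          intro h0
          have := norm_sub_ge le_rfl hw (ζ := ζ)
          rw [h0, norm_zero] at this
          linarith
        simp only
        field_simp
        ring
      rw [h2, integral_add (i1.const_mul _) (i2.const_mul _), integral_const_mul,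
        integral_const_mul]
      ring
    simp only [cauchyTail]
    rw [h1]
    field_simp
    ring

theorem cauchyDisc_add {h k : ℂ → ℂ} (hh : Continuous h) (hk : Continuous k) {ζ : ℂ}
    (hζ : 1 < ‖ζ‖) : cauchyDisc (fun w => h w + k w) ζ = cauchyDisc h ζ + cauchyDisc k ζ := by
  simp only [cauchyDisc, mul_add]
  rw [integral_add (integrableOn_cauchyKernel hh hζ) (integrableOn_cauchyKernel hk hζ)]
  ring

theorem cauchyDisc_smul (c : ℂ) (h : ℂ → ℂ) (ζ : ℂ) :
    cauchyDisc (fun w => c * h w) ζ = c * cauchyDisc h ζ := by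
  have : ∀ w, (ζ - w)⁻¹ * (c * h w) = c * ((ζ - w)⁻¹ * h w) := fun w => by ring
  simp only [cauchyDisc, this, integral_const_mul]
  ring

theorem cauchyTail_add (n : ℕ) {h k : ℂ → ℂ} (hh : Continuous h) (hk : Continuous k) {ζ : ℂ}
    (hζ : 1 < ‖ζ‖) : cauchyTail n (fun w => h w + k w) ζ = cauchyTail n h ζ + cauchyTail n k ζ := by
  simp only [cauchyTail, mul_add]
  rw [cauchyDisc_add (h := fun w => w ^ n * h w) (by fun_prop) (by fun_prop) hζ]
  ring

theorem cauchyTail_smul (n : ℕ) (c : ℂ) (h : ℂ → ℂ) (ζ : ℂ) :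
    cauchyTail n (fun w => c * h w) ζ = c * cauchyTail n h ζ := by
  have : ∀ w, w ^ n * (c * h w) = c * (w ^ n * h w) := fun w => by ring
  simp only [cauchyTail, this, cauchyDisc_smul]
  ring

theorem discMoment_add {h k : ℂ → ℂ} (hh : Continuous h) (hk : Continuous k) (m : ℕ) :
    discMoment (fun w => h w + k w) m = discMoment h m + discMoment k m := by
  simp only [discMoment, mul_add]
  rw [integral_add, mul_add] <;>
  exact (Continuous.continuousOn (by fun_prop)).integrableOn_compact (isCompact_closedBall 0 1)

theorem discMoment_smul (c : ℂ) (h : ℂ → ℂ) (m : ℕ) :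
    discMoment (fun w => c * h w) m = c * discMoment h m := by
  have : ∀ w, w ^ m * (c * h w) = c * (w ^ m * h w) := fun w => by ring
  simp only [discMoment, this, integral_const_mul]
  ring

/-! ### The integral equation -/

open scoped BoundedContinuousFunction

/-- A transfer system: coefficients `A j i` supported in the closed unit disc, and maps `Z j i`
that send the support of `A j i` outside the disc of radius `3/2`. -/
structure IsTransfer {I : Type*} (A Z : I → I → ℂ → ℂ) : Prop where
  contDiff : ∀ j i (Φ : ℂ → ℂ), DifferentiableOn ℂ Φ {ζ | 1 < ‖ζ‖} →
    ContDiff ℝ 1 fun z => A j i z * Φ (Z j i z)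
  norm_ge : ∀ j i z, A j i z ≠ 0 → 3 / 2 ≤ ‖Z j i z‖
  norm_le : ∀ j i z, A j i z ≠ 0 → ‖z‖ ≤ 1

namespace IsTransfer

variable {I : Type*} [Fintype I] {A Z : I → I → ℂ → ℂ}

theorem exists_bound (hA : IsTransfer A Z) : ∃ C : ℝ, 0 ≤ C ∧ ∀ j i z, ‖A j i z‖ ≤ C := by
  have h1 : ∀ j i, ∃ C : ℝ, ∀ z, ‖A j i z‖ ≤ C := by
    intro j i
    have hc : Continuous (A j i) := by
      -- Testing with the constant function `1` gives the regularity of the coefficient itself.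
      have := (hA.contDiff j i (fun _ => 1) (differentiableOn_const 1)).continuous
      simpa using this
    obtain ⟨C, hC⟩ := (isCompact_closedBall (0 : ℂ) 1).exists_bound_of_continuousOn hc.continuousOn
    refine ⟨C, fun z => ?_⟩
    by_cases hz : A j i z = 0
    · rw [hz, norm_zero]
      exact (norm_nonneg _).trans (hC 0 (by simp))
    · exact hC z (mem_closedBall_zero_iff.2 (hA.norm_le j i z hz))
  choose C hC using h1
  refine ⟨∑ j, ∑ i, |C j i|, by positivity, fun j i z => (hC j i z).trans ?_⟩
  calc C j i ≤ |C j i| := le_abs_self _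
    _ ≤ ∑ i, |C j i| := Finset.single_le_sum (f := fun i => |C j i|) (fun _ _ => abs_nonneg _)
        (Finset.mem_univ i)
    _ ≤ _ := Finset.single_le_sum (f := fun j => ∑ i, |C j i|)
        (fun _ _ => Finset.sum_nonneg fun _ _ => abs_nonneg _) (Finset.mem_univ j)

theorem norm_tail_le (hA : IsTransfer A Z) {C : ℝ} (hC : ∀ j i z, ‖A j i z‖ ≤ C) (n : ℕ)
    (h : I → ℂ →ᵇ ℂ) (j : I) (z : ℂ) :
    ‖∑ i, A j i z * cauchyTail n (h i) (Z j i z)‖ ≤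
      (Fintype.card I * C * ((2 / 3) ^ n * 2)) * ‖h‖ := by
  have hterm : ∀ i, ‖A j i z * cauchyTail n (h i) (Z j i z)‖ ≤
      C * ((2 / 3) ^ n * 2) * ‖h‖ := by
    intro i
    have hC0 : 0 ≤ C := (norm_nonneg _).trans (hC j i z)
    by_cases hz : A j i z = 0
    · rw [hz, zero_mul, norm_zero]
      positivity
    · rw [norm_mul]
      have h1 := norm_cauchyTail_le n (h := h i) (C := ‖h‖) (fun w _ =>
        ((h i).norm_coe_le_norm w).trans (norm_le_pi_norm h i)) (hA.norm_ge j i z hz)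
      calc ‖A j i z‖ * ‖cauchyTail n (h i) (Z j i z)‖ ≤ C * ((2 / 3) ^ n * (2 * ‖h‖)) :=
            mul_le_mul (hC j i z) h1 (norm_nonneg _) hC0
        _ = _ := by ring
  refine (norm_sum_le _ _).trans ((Finset.sum_le_sum fun i _ => hterm i).trans (le_of_eq ?_))
  rw [Finset.sum_const, Finset.card_univ, nsmul_eq_mul]
  ring

/-- The remainder operator. -/
def tailOp (hA : IsTransfer A Z) (C : ℝ) (hC0 : 0 ≤ C) (hC : ∀ j i z, ‖A j i z‖ ≤ C) (n : ℕ) :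
    (I → ℂ →ᵇ ℂ) →L[ℂ] (I → ℂ →ᵇ ℂ) :=
  LinearMap.mkContinuous
    { toFun := fun h j => BoundedContinuousFunction.ofNormedAddCommGroup
        (fun z => ∑ i, A j i z * cauchyTail n (h i) (Z j i z))
        (continuous_finsetSum _ fun i _ => (hA.contDiff j i _
          (differentiableOn_cauchyTail n (h i).continuous)).continuous) _
        (hA.norm_tail_le hC n h j)
      map_add' := by
        intro h k
        ext j z
        simp only [BoundedContinuousFunction.coe_ofNormedAddCommGroup, Pi.add_apply,
          BoundedContinuousFunction.coe_add, ← Finset.sum_add_distrib, ← mul_add]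
        refine Finset.sum_congr rfl fun i _ => ?_
        by_cases hz : A j i z = 0
        · rw [hz, zero_mul, zero_mul]
        · rw [← cauchyTail_add n (h i).continuous (k i).continuous
            (lt_of_lt_of_le (by norm_num) (hA.norm_ge j i z hz))]
          rfl
      map_smul' := by
        intro c h
        ext j z
        simp only [BoundedContinuousFunction.coe_ofNormedAddCommGroup, Pi.smul_apply,
          BoundedContinuousFunction.coe_smul, RingHom.id_apply, smul_eq_mul, Finset.mul_sum]
        refine Finset.sum_congr rfl fun i _ => ?_
        rw [cauchyTail_smul n c (h i)]
        ring }
    (Fintype.card I * C * ((2 / 3) ^ n * 2)) (by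
      intro h
      refine (pi_norm_le_iff_of_nonneg (by positivity)).2 fun j => ?_
      refine (BoundedContinuousFunction.norm_le (by positivity)).2 fun z => ?_
      exact hA.norm_tail_le hC n h j z)

/-- The tail is only evaluated where `‖ζ‖ ≥ 3/2`, so the operator norm is `O((2/3)^n)`. -/
theorem exists_tailOp_norm_lt (hA : IsTransfer A Z) :
    ∃ (n : ℕ) (G : (I → ℂ →ᵇ ℂ) →L[ℂ] (I → ℂ →ᵇ ℂ)), ‖G‖ < 1 ∧
      ∀ h j z, G h j z = ∑ i, A j i z * cauchyTail n (h i) (Z j i z) := by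
  obtain ⟨C, hC0, hC⟩ := hA.exists_bound
  have ht : Filter.Tendsto (fun n : ℕ => (Fintype.card I * C * ((2 / 3 : ℝ) ^ n * 2)))
      Filter.atTop (𝓝 (Fintype.card I * C * (0 * 2))) :=
    ((tendsto_pow_atTop_nhds_zero_of_lt_one (by norm_num) (by norm_num)).mul_const 2).const_mul _
  rw [zero_mul, mul_zero] at ht
  obtain ⟨n, hn⟩ := (ht.eventually (gt_mem_nhds zero_lt_one)).exists
  refine ⟨n, hA.tailOp C hC0 hC n, lt_of_le_of_lt ?_ hn, fun h j z => rfl⟩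
  exact LinearMap.mkContinuous_norm_le _ (by positivity) _

/-- The Fredholm step: the equation differs from an invertible one only by the finitely many moments
of `h`, so its obstruction space is finite-dimensional and an infinite family of right-hand sides
must have a solvable nontrivial combination. -/
theorem exists_solution (hA : IsTransfer A Z) (φ : ℕ → I → ℂ → ℂ)
    (hφ : ∀ k i, ContDiff ℝ 1 (φ k i)) (hφs : ∀ k i z, φ k i z ≠ 0 → ‖z‖ ≤ 1) :
    ∃ (c : ℕ →₀ ℂ) (h : I → ℂ → ℂ), c ≠ 0 ∧ (∀ i, ContDiff ℝ 1 (h i)) ∧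
      (∀ i z, h i z ≠ 0 → ‖z‖ ≤ 1) ∧
      ∀ j z, h j z + ∑ i, A j i z * cauchyTransform (h i) (Z j i z) =
        c.sum fun k a => a * φ k j z := by
  obtain ⟨n, G, hG, hGa⟩ := hA.exists_tailOp_norm_lt
  have hb : ∀ k i, ∃ C, ∀ z, ‖φ k i z‖ ≤ C := by
    intro k i
    obtain ⟨C, hC⟩ := (isCompact_closedBall (0 : ℂ) 1).exists_bound_of_continuousOn
      (hφ k i).continuous.continuousOn
    refine ⟨C, fun z => ?_⟩
    by_cases hz : φ k i z = 0
    · rw [hz, norm_zero]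
      exact (norm_nonneg _).trans (hC 0 (by simp))
    · exact hC z (mem_closedBall_zero_iff.2 (hφs k i z hz))
  choose C hC using hb
  set Y : ℕ → I → ℂ →ᵇ ℂ := fun k i =>
    BoundedContinuousFunction.ofNormedAddCommGroup (φ k i) (hφ k i).continuous (C k i) (hC k i)
    with hY
  -- Neumann series.
  have hu : IsUnit (1 + G) := by
    have := isUnit_one_sub_of_norm_lt_one (x := -G) (by rwa [norm_neg])
    rwa [sub_neg_eq_add] at this
  obtain ⟨V, hV⟩ := hu.exists_right_inv
  set X : ℕ → I → ℂ →ᵇ ℂ := fun k => V (Y k) with hX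
  have hXY : ∀ k, X k + G (X k) = Y k := by
    intro k
    have := congrArg (fun T : (I → ℂ →ᵇ ℂ) →L[ℂ] (I → ℂ →ᵇ ℂ) => T (Y k)) hV
    simpa using this
  set mom : (I → ℂ →ᵇ ℂ) →ₗ[ℂ] (I × Fin n → ℂ) :=
    { toFun := fun h p => discMoment (h p.1) p.2
      map_add' := fun h k => by
        funext p
        exact discMoment_add (h p.1).continuous (k p.1).continuous _
      map_smul' := fun c h => by
        funext p
        exact discMoment_smul c (h p.1) _ } with hmom
  -- The moments live in a finite-dimensional space, while the family is indexed by `ℕ`.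
  have hdep : ¬ LinearIndependent ℂ fun k => mom (X k) := by
    intro hl
    have := hl.finite
    exact not_finite ℕ
  rw [linearIndependent_iff] at hdep
  push Not at hdep
  obtain ⟨c, hc, hc0⟩ := hdep
  set x : I → ℂ →ᵇ ℂ := Finsupp.linearCombination ℂ X c with hx
  have hmx : mom x = 0 := by
    rw [hx, Finsupp.apply_linearCombination]
    exact hc
  have hxG : x + G x = Finsupp.linearCombination ℂ Y c := by
    have : x + G x = ((1 + G : (I → ℂ →ᵇ ℂ) →L[ℂ] (I → ℂ →ᵇ ℂ)) : (I → ℂ →ᵇ ℂ) →ₗ[ℂ] _) x := by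
      simp
    rw [this, hx, Finsupp.apply_linearCombination]
    congr 1
    congr 1
    funext k
    rw [← hXY k]
    simp
  have hval : ∀ j z, x j z + ∑ i, A j i z * cauchyTail n (x i) (Z j i z) =
      c.sum fun k a => a * φ k j z := by
    intro j z
    rw [← hGa x j z]
    have h1 : (x + G x) j z = x j z + G x j z := rfl
    rw [← h1, hxG, Finsupp.linearCombination_apply, Finsupp.sum, Finsupp.sum, Finset.sum_apply,
      BoundedContinuousFunction.coe_sum, Finset.sum_apply]
    rfl
  -- As the moments of `x` vanish, the tail is the whole Cauchy transform and the modified equation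
  -- becomes the original one.
  have htail : ∀ i ζ, 1 < ‖ζ‖ → cauchyTail n (x i) ζ = cauchyDisc (x i) ζ := by
    intro i ζ hζ
    rw [cauchyDisc_eq_sum_add_tail n (x i).continuous hζ, Finset.sum_eq_zero, zero_add]
    intro m hm
    have : discMoment (x i) m = 0 := congrFun hmx (i, ⟨m, Finset.mem_range.1 hm⟩)
    rw [this, mul_zero]
  -- Outside the unit disc every other term of the equation vanishes.
  have hsupp : ∀ i z, x i z ≠ 0 → ‖z‖ ≤ 1 := by
    intro i z hz
    by_contra hlt
    have h1 := hval i z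
    rw [Finset.sum_eq_zero, add_zero, Finsupp.sum, Finset.sum_eq_zero] at h1
    · exact hz h1
    · intro k _
      have : φ k i z = 0 := by
        by_contra h0
        exact hlt (hφs k i z h0)
      rw [this, mul_zero]
    · intro l _
      have : A i l z = 0 := by
        by_contra h0
        exact hlt (hA.norm_le i l z h0)
      rw [this, zero_mul]
  have hval' : ∀ j z, x j z + ∑ i, A j i z * cauchyTransform (x i) (Z j i z) =
      c.sum fun k a => a * φ k j z := by
    intro j z
    rw [← hval j z]
    congr 1
    refine Finset.sum_congr rfl fun i _ => ?_
    by_cases hz : A j i z = 0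
    · rw [hz, zero_mul, zero_mul]
    · rw [cauchyTransform_eq_cauchyDisc (hsupp i),
        htail i _ (lt_of_lt_of_le (by norm_num) (hA.norm_ge j i z hz))]
  refine ⟨c, fun i => x i, hc0, fun i => ?_, hsupp, hval'⟩
  -- Bootstrapping: `x` is so far only continuous, but the equation expresses it through Cauchy
  -- transforms at points where these are holomorphic.
  have h1 : (x i : ℂ → ℂ) = fun z => (c.sum fun k a => a * φ k i z) -
      ∑ l, A i l z * cauchyDisc (x l) (Z i l z) := by
    funext z
    rw [← hval' i z]
    simp only [cauchyTransform_eq_cauchyDisc (hsupp _)]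
    ring
  simp only [h1]
  refine ContDiff.sub ?_ ?_
  · exact ContDiff.sum fun k _ => contDiff_const.mul (hφ k i)
  · exact ContDiff.sum fun l _ =>
      hA.contDiff i l _ (differentiableOn_cauchyDisc (x l).continuous)

end IsTransfer

end KPCurve

/-! ### Cutoff functions and disc atlases -/

namespace KPCurve

open Complex Metric

theorem contDiffAt_real_of_eventually_differentiableAt {F : ℂ → ℂ} {z : ℂ} {n : WithTop ℕ∞}
    (h : ∀ᶠ w in 𝓝 z, DifferentiableAt ℂ F w) : ContDiffAt ℝ n F z :=
  ((analyticAt_iff_eventually_differentiableAt.2 h).contDiffAt).restrict_scalars ℝ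

/-- The smooth cutoff function with radii `r < R`. -/
def cutoff {r R : ℝ} (hr : 0 < r) (hR : r < R) (z : ℂ) : ℂ :=
  ((⟨r, R, hr, hR⟩ : ContDiffBump (0 : ℂ)) z : ℝ)

section cutoff

variable {r R : ℝ} (hr : 0 < r) (hR : r < R)

theorem contDiff_cutoff {n : ℕ∞} : ContDiff ℝ n (cutoff hr hR) :=
  ofRealCLM.contDiff.comp (ContDiffBump.contDiff _)

theorem cutoff_eq_one {z : ℂ} (hz : ‖z‖ ≤ r) : cutoff hr hR z = 1 := by
  rw [cutoff, ContDiffBump.one_of_mem_closedBall _ (by simpa using hz), ofReal_one]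

theorem cutoff_eq_zero {z : ℂ} (hz : R ≤ ‖z‖) : cutoff hr hR z = 0 := by
  rw [cutoff, ContDiffBump.zero_of_le_dist _ (by simpa using hz), ofReal_zero]

theorem dbar_cutoff_eq_zero {z : ℂ} (hz : ‖z‖ < r ∨ R < ‖z‖) : dbar (cutoff hr hR) z = 0 := by
  rcases hz with hz | hz
  · refine dbar_eq_zero_of_eventuallyEq_const (c := 1) ?_
    filter_upwards [(isOpen_lt continuous_norm continuous_const).mem_nhds hz] with w hw
    exact cutoff_eq_one hr hR (le_of_lt hw)
  · refine dbar_eq_zero_of_eventuallyEq_const (c := 0) ?_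
    filter_upwards [(isOpen_lt continuous_const continuous_norm).mem_nhds hz] with w hw
    exact cutoff_eq_zero hr hR (le_of_lt hw)

theorem contDiff_dbar_cutoff : ContDiff ℝ 1 (dbar (cutoff hr hR)) :=
  contDiff_iff_contDiffAt.2 fun _ => contDiffAt_dbar (contDiff_cutoff hr hR (n := 2)).contDiffAt

/-- The derivative of the cutoff lives on the annulus between the two radii, so `Φ` may be singular,
or meaningless, elsewhere. -/
theorem contDiff_dbar_cutoff_mul {Φ : ℂ → ℂ} {s : Set ℂ} (hs : IsOpen s)
    (hΦ : DifferentiableOn ℂ Φ s) (h : ∀ z, r ≤ ‖z‖ → ‖z‖ ≤ R → z ∈ s) :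
    ContDiff ℝ 1 fun z => dbar (cutoff hr hR) z * Φ z := by
  refine contDiff_iff_contDiffAt.2 fun z => ?_
  by_cases hz : r ≤ ‖z‖ ∧ ‖z‖ ≤ R
  · refine (contDiff_dbar_cutoff hr hR).contDiffAt.mul ?_
    refine contDiffAt_real_of_eventually_differentiableAt ?_
    filter_upwards [hs.mem_nhds (h z hz.1 hz.2)] with w hw
    exact (hΦ w hw).differentiableAt (hs.mem_nhds hw)
  · have hz' : ‖z‖ < r ∨ R < ‖z‖ := by
      by_contra hcon
      push Not at hcon
      exact hz ⟨hcon.1, hcon.2⟩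
    have hev : ∀ᶠ w in 𝓝 z, ‖w‖ < r ∨ R < ‖w‖ := by
      rcases hz' with hz' | hz'
      · filter_upwards [(isOpen_lt continuous_norm continuous_const).mem_nhds hz'] with w hw
        exact Or.inl hw
      · filter_upwards [(isOpen_lt continuous_const continuous_norm).mem_nhds hz'] with w hw
        exact Or.inr hw
    refine (contDiffAt_const (c := (0 : ℂ))).congr_of_eventuallyEq ?_
    filter_upwards [hev] with w hw
    rw [dbar_cutoff_eq_zero hr hR hw, zero_mul]

end cutoff

/-- A finite atlas by discs of radius `3` with holomorphic transition maps such that the discs of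
radius `1` cover the space. -/
structure DiscAtlas (C : Type*) [TopologicalSpace C] (I : Type*) where
  chart : I → OpenPartialHomeomorph C ℂ
  target_eq : ∀ i, (chart i).target = ball 0 3
  cover : ∀ x, ∃ i, x ∈ (chart i).source ∧ ‖chart i x‖ < 1
  holo : ∀ i j x, x ∈ (chart i).source → x ∈ (chart j).source →
    DifferentiableAt ℂ (fun z => chart i ((chart j).symm z)) (chart j x)

namespace DiscAtlas

variable {C : Type*} [TopologicalSpace C] {I : Type*} (D : DiscAtlas C I)

/-- A multiplicative cocycle of transition functions, as the quotients of nowhere vanishing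
functions. -/
structure IsFrame (τ : I → C → ℂ) : Prop where
  ne_zero : ∀ i x, τ i x ≠ 0
  holo : ∀ i j x, x ∈ (D.chart i).source → x ∈ (D.chart j).source →
    DifferentiableAt ℂ (fun z => τ i ((D.chart j).symm z) / τ j ((D.chart j).symm z))
      (D.chart j x)

open Classical in
/-- The function `G ∘ φ_i`, extended by zero. -/
def ext (i : I) (G : ℂ → ℂ) (x : C) : ℂ := if x ∈ (D.chart i).source then G (D.chart i x) else 0

variable {D}

theorem ext_of_mem {i : I} {x : C} (hx : x ∈ (D.chart i).source) (G : ℂ → ℂ) :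
    D.ext i G x = G (D.chart i x) := if_pos hx

theorem ext_of_notMem {i : I} {x : C} (hx : x ∉ (D.chart i).source) (G : ℂ → ℂ) :
    D.ext i G x = 0 := if_neg hx

variable (D) in
/-- The derivative of the transition map from the chart `j` to the chart `i`. -/
def jac (i j : I) (x : C) : ℂ := deriv (fun z => D.chart i ((D.chart j).symm z)) (D.chart j x)

theorem symm_chart {j : I} {x : C} (hx : x ∈ (D.chart j).source) :
    (D.chart j).symm (D.chart j x) = x := (D.chart j).left_inv hx

theorem tendsto_symm {j : I} {x : C} (hx : x ∈ (D.chart j).source) :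
    Filter.Tendsto (D.chart j).symm (𝓝 (D.chart j x)) (𝓝 x) := by
  have := (D.chart j).continuousAt_symm ((D.chart j).map_source hx)
  rwa [ContinuousAt, symm_chart hx] at this

theorem eventually_chart {j : I} {x : C} (hx : x ∈ (D.chart j).source) {p : C → Prop}
    (hp : ∀ᶠ y in 𝓝 x, p y) :
    ∀ᶠ z in 𝓝 (D.chart j x), z ∈ (D.chart j).target ∧ (D.chart j).symm z ∈ (D.chart j).source ∧
      D.chart j ((D.chart j).symm z) = z ∧ p ((D.chart j).symm z) := by
  filter_upwards [(D.chart j).open_target.mem_nhds ((D.chart j).map_source hx),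
    (tendsto_symm hx).eventually hp] with z hz hpz
  exact ⟨hz, (D.chart j).map_target hz, (D.chart j).right_inv hz, hpz⟩

theorem eventually_differentiableAt {j : I} {x : C} (hx : x ∈ (D.chart j).source) {F : C → ℂ}
    (hF : ∀ᶠ y in 𝓝 x, y ∈ (D.chart j).source →
      DifferentiableAt ℂ (fun z => F ((D.chart j).symm z)) (D.chart j y)) :
    ∀ᶠ z in 𝓝 (D.chart j x), DifferentiableAt ℂ (fun z => F ((D.chart j).symm z)) z := by
  filter_upwards [eventually_chart hx hF] with z hz
  have := hz.2.2.2 hz.2.1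
  rwa [hz.2.2.1] at this

theorem eventually_holo {i j : I} {x : C} (hi : x ∈ (D.chart i).source)
    (hj : x ∈ (D.chart j).source) : ∀ᶠ z in 𝓝 (D.chart j x),
      DifferentiableAt ℂ (fun z => D.chart i ((D.chart j).symm z)) z := by
  refine eventually_differentiableAt hj (F := D.chart i) ?_
  filter_upwards [(D.chart i).open_source.mem_nhds hi] with y hy hy'
  exact D.holo i j y hy hy'

theorem IsFrame.eventually_holo {τ : I → C → ℂ} (hτ : D.IsFrame τ) {i j : I} {x : C}
    (hi : x ∈ (D.chart i).source) (hj : x ∈ (D.chart j).source) : ∀ᶠ z in 𝓝 (D.chart j x),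
      DifferentiableAt ℂ
        (fun z => τ i ((D.chart j).symm z) / τ j ((D.chart j).symm z)) z := by
  refine eventually_differentiableAt hj (F := fun y => τ i y / τ j y) ?_
  filter_upwards [(D.chart i).open_source.mem_nhds hi] with y hy hy'
  exact hτ.holo i j y hy hy'

theorem IsFrame.eventually_holo' {τ : I → C → ℂ} (hτ : D.IsFrame τ) {i j : I} {x : C}
    (hi : x ∈ (D.chart i).source) (hj : x ∈ (D.chart j).source) : ∀ᶠ z in 𝓝 (D.chart j x),
      DifferentiableAt ℂ
        (fun z => τ j ((D.chart j).symm z) / τ i ((D.chart j).symm z)) z := by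
  filter_upwards [hτ.eventually_holo hi hj] with z hz
  have := hz.fun_inv (div_ne_zero (hτ.ne_zero _ _) (hτ.ne_zero _ _))
  simpa only [inv_div] using this

theorem jac_comp {i j l : I} {x : C} (hi : x ∈ (D.chart i).source) (hj : x ∈ (D.chart j).source)
    (hl : x ∈ (D.chart l).source) : D.jac l j x = D.jac l i x * D.jac i j x := by
  have h1 := D.holo i j x hi hj
  have h2 := D.holo l i x hl hi
  have h3 : HasDerivAt (fun z => D.chart l ((D.chart i).symm z)) (D.jac l i x)
      (D.chart i ((D.chart j).symm (D.chart j x))) := by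
    rw [symm_chart hj]
    exact h2.hasDerivAt
  have h4 := h3.comp (D.chart j x) h1.hasDerivAt
  refine HasDerivAt.deriv (h4.congr_of_eventuallyEq ?_)
  filter_upwards [eventually_chart hj ((D.chart i).open_source.mem_nhds hi)] with z hz
  simp only [Function.comp]
  rw [symm_chart hz.2.2.2]

section T2

variable [T2Space C]

/-- The closed disc of radius `2` is compact inside the chart of radius `3`, hence closed in the
Hausdorff space; so extension by zero creates no jump at the boundary of the chart. -/
theorem eventually_ext_eq_zero {i : I} {G : ℂ → ℂ} (hG : ∀ z, 2 < ‖z‖ → G z = 0) {x : C}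
    (hx : x ∉ (D.chart i).source) : ∀ᶠ y in 𝓝 x, D.ext i G y = 0 := by
  have hsub : closedBall (0 : ℂ) 2 ⊆ (D.chart i).target := by
    rw [D.target_eq]
    exact closedBall_subset_ball (by norm_num)
  have hK : IsCompact ((D.chart i).symm '' closedBall (0 : ℂ) 2) :=
    (isCompact_closedBall 0 2).image_of_continuousOn ((D.chart i).continuousOn_symm.mono hsub)
  have hxK : x ∉ (D.chart i).symm '' closedBall (0 : ℂ) 2 := by
    rintro ⟨z, hz, rfl⟩
    exact hx ((D.chart i).map_target (hsub hz))
  filter_upwards [hK.isClosed.isOpen_compl.mem_nhds hxK] with y hy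
  by_cases hyi : y ∈ (D.chart i).source
  · rw [ext_of_mem hyi]
    refine hG _ (not_le.1 fun hle => hy ⟨D.chart i y, by simpa using hle, symm_chart hyi⟩)
  · exact ext_of_notMem hyi G

theorem contDiffAt_ext {i j : I} {G : ℂ → ℂ} {n : WithTop ℕ∞} (hG : ∀ z, 2 < ‖z‖ → G z = 0) {x : C}
    (hj : x ∈ (D.chart j).source)
    (hGd : x ∈ (D.chart i).source → ContDiffAt ℝ n G (D.chart i x)) :
    ContDiffAt ℝ n (fun z => D.ext i G ((D.chart j).symm z)) (D.chart j x) := by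
  by_cases hi : x ∈ (D.chart i).source
  · have h1 : ContDiffAt ℝ n (fun z => D.chart i ((D.chart j).symm z)) (D.chart j x) :=
      contDiffAt_real_of_eventually_differentiableAt (eventually_holo hi hj)
    have h2 : ContDiffAt ℝ n G (D.chart i ((D.chart j).symm (D.chart j x))) := by
      rw [symm_chart hj]
      exact hGd hi
    refine (h2.comp (D.chart j x) h1).congr_of_eventuallyEq ?_
    filter_upwards [eventually_chart hj ((D.chart i).open_source.mem_nhds hi)] with z hz
    exact ext_of_mem hz.2.2.2 G
  · refine (contDiffAt_const (c := (0 : ℂ))).congr_of_eventuallyEq ?_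
    filter_upwards [eventually_chart hj (eventually_ext_eq_zero hG hi)] with z hz
    exact hz.2.2.2

/-- The transition factor `τ j / τ i` is holomorphic and passes through ∂̄; the change of charts
contributes the conjugate Jacobian. This is the rule for changing discs for bundle-valued
`(0,1)`-forms. -/
theorem dbar_frame_ext {τ : I → C → ℂ} (hτ : D.IsFrame τ) {i j : I} {G : ℂ → ℂ}
    (hG : ∀ z, 2 < ‖z‖ → G z = 0) {x : C} (hj : x ∈ (D.chart j).source)
    (hGd : x ∈ (D.chart i).source → DifferentiableAt ℝ G (D.chart i x)) :
    DifferentiableAt ℝ (fun z => τ j ((D.chart j).symm z) *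
      ((τ i ((D.chart j).symm z))⁻¹ * D.ext i G ((D.chart j).symm z))) (D.chart j x) ∧
    dbar (fun z => τ j ((D.chart j).symm z) *
      ((τ i ((D.chart j).symm z))⁻¹ * D.ext i G ((D.chart j).symm z))) (D.chart j x) =
      τ j x / τ i x * (starRingEnd ℂ) (D.jac i j x) * D.ext i (dbar G) x := by
  by_cases hi : x ∈ (D.chart i).source
  · have h1 := (hτ.eventually_holo' hi hj).self_of_nhds
    have h2 := D.holo i j x hi hj
    have hGx : DifferentiableAt ℝ G (D.chart i ((D.chart j).symm (D.chart j x))) := by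
      rw [symm_chart hj]
      exact hGd hi
    have h3 : DifferentiableAt ℝ (fun z => G (D.chart i ((D.chart j).symm z))) (D.chart j x) :=
      hGx.comp (D.chart j x) (h2.restrictScalars ℝ)
    have hev : (fun z => τ j ((D.chart j).symm z) *
        ((τ i ((D.chart j).symm z))⁻¹ * D.ext i G ((D.chart j).symm z))) =ᶠ[𝓝 (D.chart j x)]
        fun z => (τ j ((D.chart j).symm z) / τ i ((D.chart j).symm z)) *
          G (D.chart i ((D.chart j).symm z)) := by
      filter_upwards [eventually_chart hj ((D.chart i).open_source.mem_nhds hi)] with z hz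
      rw [ext_of_mem hz.2.2.2, div_eq_mul_inv, mul_assoc]
    refine ⟨((h1.restrictScalars ℝ).mul h3).congr_of_eventuallyEq hev, ?_⟩
    rw [dbar_congr hev, dbar_mul (h1.restrictScalars ℝ) h3, dbar_eq_zero h1,
      dbar_comp hGx h2, symm_chart hj, ext_of_mem hi]
    simp only [jac]
    ring
  · have hev : (fun z => τ j ((D.chart j).symm z) *
        ((τ i ((D.chart j).symm z))⁻¹ * D.ext i G ((D.chart j).symm z))) =ᶠ[𝓝 (D.chart j x)]
        fun _ => 0 := by
      filter_upwards [eventually_chart hj (eventually_ext_eq_zero hG hi)] with z hz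
      rw [hz.2.2.2, mul_zero, mul_zero]
    refine ⟨(differentiableAt_const _).congr_of_eventuallyEq hev, ?_⟩
    rw [dbar_eq_zero_of_eventuallyEq_const hev, ext_of_notMem hi, mul_zero]

end T2

/-! ### A partition of unity -/

/-- The function with support the disc of radius `1`. -/
abbrev bump : ℂ → ℂ := cutoff (r := 1 / 2) (R := 1) (by norm_num) (by norm_num)

/-- The cutoff function between the discs of radius `3/2` and `2`. -/
abbrev cut : ℂ → ℂ := cutoff (r := 3 / 2) (R := 2) (by norm_num) (by norm_num)

theorem bump_eq_zero {z : ℂ} (hz : 2 < ‖z‖) : bump z = 0 := cutoff_eq_zero _ _ (by linarith)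

theorem cut_eq_zero {z : ℂ} (hz : 2 < ‖z‖) : cut z = 0 := cutoff_eq_zero _ _ hz.le

theorem dbar_cut_eq_zero {z : ℂ} (hz : 2 < ‖z‖) : dbar cut z = 0 :=
  dbar_cutoff_eq_zero _ _ (Or.inr hz)

variable [Fintype I]

theorem sum_ext_bump_ne_zero (x : C) : ∑ i, D.ext i bump x ≠ 0 := by
  set b : ContDiffBump (0 : ℂ) := ⟨1 / 2, 1, by norm_num, by norm_num⟩ with hb
  have h : ∀ i, ∃ r : ℝ, 0 ≤ r ∧ D.ext i bump x = r ∧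
      (x ∈ (D.chart i).source → ‖D.chart i x‖ < 1 → 0 < r) := by
    intro i
    by_cases hi : x ∈ (D.chart i).source
    · refine ⟨b (D.chart i x), b.nonneg, ext_of_mem hi _, fun _ h => b.pos_of_mem_ball ?_⟩
      simpa using h
    · exact ⟨0, le_rfl, by rw [ext_of_notMem hi, ofReal_zero], fun h => absurd h hi⟩
  choose r hr0 hr hpos using h
  obtain ⟨i, hi1, hi2⟩ := D.cover x
  have : 0 < ∑ i, r i :=
    Finset.sum_pos' (fun i _ => hr0 i) ⟨i, Finset.mem_univ i, hpos i hi1 hi2⟩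
  simp only [hr]
  exact_mod_cast this.ne'

variable (D) in
/-- The partition of unity. -/
def part (j : I) (x : C) : ℂ := D.ext j bump x / ∑ i, D.ext i bump x

theorem sum_part (x : C) : ∑ j, D.part j x = 1 := by
  simp only [part, ← Finset.sum_div]
  exact div_self (sum_ext_bump_ne_zero x)

theorem part_of_notMem {j : I} {x : C} (hx : x ∉ (D.chart j).source) : D.part j x = 0 := by
  rw [part, ext_of_notMem hx, zero_div]

open Classical in
variable (D) in
/-- The form `G dz̄_i` in the disc `i`, expressed in the chart `j` and multiplied by the function
`j` of the partition of unity. -/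
def transfer (τ : I → C → ℂ) (j i : I) (G : ℂ → ℂ) (z : ℂ) : ℂ :=
  if z ∈ (D.chart j).target then
    D.part j ((D.chart j).symm z) * (τ j ((D.chart j).symm z) / τ i ((D.chart j).symm z)) *
      (starRingEnd ℂ) (D.jac i j ((D.chart j).symm z)) * D.ext i G ((D.chart j).symm z)
  else 0

theorem transfer_chart {τ : I → C → ℂ} {j i : I} {G : ℂ → ℂ} {x : C}
    (hj : x ∈ (D.chart j).source) : D.transfer τ j i G (D.chart j x) =
      D.part j x * (τ j x / τ i x) * (starRingEnd ℂ) (D.jac i j x) * D.ext i G x := by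
  rw [transfer, if_pos ((D.chart j).map_source hj), symm_chart hj]

theorem norm_le_of_transfer_ne_zero {τ : I → C → ℂ} {j i : I} {G : ℂ → ℂ} {z : ℂ}
    (h : D.transfer τ j i G z ≠ 0) : ‖z‖ ≤ 1 := by
  by_contra hlt
  apply h
  rw [transfer]
  split_ifs with hz
  · have : D.part j ((D.chart j).symm z) = 0 := by
      rw [part, ext_of_mem ((D.chart j).map_target hz), (D.chart j).right_inv hz,
        bump, cutoff_eq_zero _ _ (le_of_lt (not_le.1 hlt)), zero_div]
    rw [this]
    ring
  · rfl

theorem transfer_mul {τ : I → C → ℂ} (j i : I) (G Φ : ℂ → ℂ) (z : ℂ) :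
    D.transfer τ j i G z * Φ (D.chart i ((D.chart j).symm z)) =
      D.transfer τ j i (fun w => G w * Φ w) z := by
  rw [transfer, transfer]
  split_ifs with hz
  · by_cases hi : (D.chart j).symm z ∈ (D.chart i).source
    · rw [ext_of_mem hi, ext_of_mem hi]
      ring
    · rw [ext_of_notMem hi, ext_of_notMem hi]
      ring
  · rw [zero_mul]

/-- By the cocycle rules for frames and Jacobians each summand is the same form weighted by the
partition of unity, and the weights add up to `1`: spreading a form over the unit discs loses
nothing. -/
theorem sum_frame_transfer {τ : I → C → ℂ} (hτ : D.IsFrame τ) {j l : I} {x : C} (G : ℂ → ℂ)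
    (hj : x ∈ (D.chart j).source) :
    ∑ i, τ j x / τ i x * (starRingEnd ℂ) (D.jac i j x) * D.ext i (D.transfer τ i l G) x =
      τ j x / τ l x * (starRingEnd ℂ) (D.jac l j x) * D.ext l G x := by
  have h : ∀ i, τ j x / τ i x * (starRingEnd ℂ) (D.jac i j x) * D.ext i (D.transfer τ i l G) x =
      D.part i x * (τ j x / τ l x * (starRingEnd ℂ) (D.jac l j x) * D.ext l G x) := by
    intro i
    by_cases hi : x ∈ (D.chart i).source
    · rw [ext_of_mem hi, transfer_chart hi]
      by_cases hl : x ∈ (D.chart l).source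
      · rw [jac_comp hi hj hl, map_mul]
        have := hτ.ne_zero i x
        have := hτ.ne_zero l x
        field_simp
      · rw [ext_of_notMem hl]
        ring
    · rw [ext_of_notMem hi, part_of_notMem hi]
      ring
  rw [Finset.sum_congr rfl fun i _ => h i, ← Finset.sum_mul, sum_part, one_mul]

variable [T2Space C]

theorem contDiffAt_part {i j : I} {x : C} (hj : x ∈ (D.chart j).source) :
    ContDiffAt ℝ 1 (fun z => D.part i ((D.chart j).symm z)) (D.chart j x) := by
  have h : ∀ l, ContDiffAt ℝ 1 (fun z => D.ext l bump ((D.chart j).symm z)) (D.chart j x) :=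
    fun l => contDiffAt_ext (fun z hz => bump_eq_zero hz) hj fun _ =>
      (contDiff_cutoff (n := 1) _ _).contDiffAt
  have hs : ContDiffAt ℝ 1 (fun z => ∑ l, D.ext l bump ((D.chart j).symm z)) (D.chart j x) :=
    ContDiffAt.sum fun l _ => h l
  simp only [part, div_eq_mul_inv]
  exact (h i).mul (hs.inv (sum_ext_bump_ne_zero _))

theorem contDiff_transfer {τ : I → C → ℂ} (hτ : D.IsFrame τ) (j i : I) {G : ℂ → ℂ}
    (hG : ContDiff ℝ 1 G) (hG0 : ∀ z, 2 < ‖z‖ → G z = 0) :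
    ContDiff ℝ 1 (D.transfer τ j i G) := by
  refine contDiff_iff_contDiffAt.2 fun z => ?_
  by_cases hz : z ∈ (D.chart j).target
  · set x := (D.chart j).symm z with hx
    have hj : x ∈ (D.chart j).source := (D.chart j).map_target hz
    have hzx : D.chart j x = z := (D.chart j).right_inv hz
    rw [← hzx]
    by_cases hi : x ∈ (D.chart i).source
    · have h1 := contDiffAt_part (i := j) hj
      have h2 := contDiffAt_real_of_eventually_differentiableAt (n := 1)
        (hτ.eventually_holo' hi hj)
      have h3 : ContDiffAt ℝ 1 (fun w => (starRingEnd ℂ)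
          (deriv (fun z => D.chart i ((D.chart j).symm z)) w)) (D.chart j x) := by
        refine conjCLE.contDiff.contDiffAt.comp (D.chart j x) ?_
        refine contDiffAt_real_of_eventually_differentiableAt ?_
        have := analyticAt_iff_eventually_differentiableAt.2 (eventually_holo hi hj)
        exact analyticAt_iff_eventually_differentiableAt.1 this.deriv
      have h4 := contDiffAt_ext (n := 1) hG0 hj (i := i) fun _ => hG.contDiffAt
      refine (((h1.mul h2).mul h3).mul h4).congr_of_eventuallyEq ?_
      filter_upwards [eventually_chart hj ((D.chart i).open_source.mem_nhds hi)] with w hw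
      rw [transfer, if_pos hw.1, jac, hw.2.2.1]
    · refine (contDiffAt_const (c := (0 : ℂ))).congr_of_eventuallyEq ?_
      filter_upwards [eventually_chart hj (eventually_ext_eq_zero hG0 hi)] with w hw
      rw [transfer, if_pos hw.1, hw.2.2.2, mul_zero]
  · refine (contDiffAt_const (c := (0 : ℂ))).congr_of_eventuallyEq ?_
    have h3 : 2 < ‖z‖ := by
      rw [D.target_eq, mem_ball_zero_iff] at hz
      linarith
    filter_upwards [(isOpen_lt continuous_const continuous_norm).mem_nhds h3] with w hw
    by_contra hne
    have := norm_le_of_transfer_ne_zero hne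
    have hw' : (2 : ℝ) < ‖w‖ := hw
    linarith

/-! ### The ∂̄-equation for twisted functions -/

theorem isTransfer {τ : I → C → ℂ} (hτ : D.IsFrame τ) :
    IsTransfer (fun j i => D.transfer τ j i (dbar cut))
      (fun j i z => D.chart i ((D.chart j).symm z)) where
  contDiff j i Φ hΦ := by
    simp only [transfer_mul]
    refine contDiff_transfer hτ j i ?_ ?_
    · refine contDiff_dbar_cutoff_mul _ _ isOpen_one_lt_norm hΦ ?_
      intro z hz _
      exact lt_of_lt_of_le (by norm_num) hz
    · intro z hz
      rw [dbar_cut_eq_zero hz, zero_mul]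
  -- This is where the inner radius `3/2` of `cut` is used: `cut` is constant inside it.
  norm_ge j i z hz := by
    by_contra hlt
    apply hz
    rw [transfer]
    split_ifs with hzt
    · by_cases hi : (D.chart j).symm z ∈ (D.chart i).source
      · rw [ext_of_mem hi, dbar_cutoff_eq_zero _ _ (Or.inl (not_le.1 hlt)), mul_zero]
      · rw [ext_of_notMem hi, mul_zero]
    · rfl
  norm_le j i z hz := norm_le_of_transfer_ne_zero hz

/-- The ansatz is a sum of cut-off Cauchy transforms; the integral equation is chosen so that the
errors from the cutoffs cancel against the densities. -/
theorem exists_dbar_solution {τ : I → C → ℂ} (hτ : D.IsFrame τ) (φ : ℕ → I → ℂ → ℂ)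
    (hφ : ∀ k i, ContDiff ℝ 1 (φ k i)) (hφs : ∀ k i z, φ k i z ≠ 0 → ‖z‖ ≤ 1) :
    ∃ (c : ℕ →₀ ℂ) (v : C → ℂ), c ≠ 0 ∧ ∀ j, ∀ x ∈ (D.chart j).source,
      DifferentiableAt ℝ (fun z => τ j ((D.chart j).symm z) * v ((D.chart j).symm z))
        (D.chart j x) ∧
      dbar (fun z => τ j ((D.chart j).symm z) * v ((D.chart j).symm z)) (D.chart j x) =
        ∑ i, τ j x / τ i x * (starRingEnd ℂ) (D.jac i j x) *
          D.ext i (fun z => c.sum fun k a => a * φ k i z) x := by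
  obtain ⟨c, h, hc, hh, hs, heq⟩ := (isTransfer hτ).exists_solution φ hφ hφs
  have hcs : ∀ i, HasCompactSupport (h i) := fun i =>
    HasCompactSupport.intro (isCompact_closedBall (0 : ℂ) 1) fun z hz => by
      by_contra hne
      exact hz (mem_closedBall_zero_iff.2 (hs i z hne))
  have hS : ∀ i, ContDiff ℝ 1 (cauchyTransform (h i)) := fun i =>
    contDiff_cauchyTransform (hh i) (hcs i)
  set G : I → ℂ → ℂ := fun i z => cut z * cauchyTransform (h i) z with hG
  have hGc : ∀ i z, DifferentiableAt ℝ (G i) z := fun i z =>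
    ((contDiff_cutoff (n := 1) _ _).differentiable one_ne_zero z).mul
      ((hS i).differentiable one_ne_zero z)
  have hG0 : ∀ i z, 2 < ‖z‖ → G i z = 0 := fun i z hz => by rw [hG]; simp [cut_eq_zero hz]
  have hGd : ∀ i z, dbar (G i) z = dbar cut z * cauchyTransform (h i) z + h i z := by
    intro i z
    rw [hG, dbar_mul ((contDiff_cutoff (n := 1) _ _).differentiable one_ne_zero z)
      ((hS i).differentiable one_ne_zero z), dbar_cauchyTransform (hh i) (hcs i)]
    -- The density lives in the unit disc, where `cut` equals `1`.
    congr 1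
    by_cases hz : h i z = 0
    · rw [hz, mul_zero]
    · rw [cutoff_eq_one _ _ ((hs i z hz).trans (by norm_num)), one_mul]
  refine ⟨c, fun x => ∑ i, (τ i x)⁻¹ * D.ext i (G i) x, hc, fun j x hj => ?_⟩
  have hterm := fun i => dbar_frame_ext hτ (hG0 i) hj (i := i) fun _ => hGc i _
  simp only [Finset.mul_sum]
  refine ⟨DifferentiableAt.fun_sum fun i _ => (hterm i).1, ?_⟩
  rw [dbar_sum _ fun i _ => (hterm i).1]
  simp only [(hterm _).2]
  -- Substitutes the integral equation for `h i`. After summation over `i`, the last term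
  -- reassembles to the middle one by `sum_frame_transfer` and cancels it.
  have hext : ∀ i, D.ext i (dbar (G i)) x = D.ext i (fun z => c.sum fun k a => a * φ k i z) x +
      D.ext i (fun z => dbar cut z * cauchyTransform (h i) z) x -
      ∑ l, D.ext i (D.transfer τ i l fun z => dbar cut z * cauchyTransform (h l) z) x := by
    intro i
    by_cases hi : x ∈ (D.chart i).source
    · simp only [ext_of_mem hi, hGd]
      rw [← heq i]
      simp only [transfer_mul]
      ring
    · simp [ext_of_notMem hi]
  simp only [hext, mul_sub, mul_add, Finset.sum_sub_distrib, Finset.sum_add_distrib,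
    Finset.mul_sum]
  rw [Finset.sum_comm (γ := I)]
  simp only [sum_frame_transfer hτ _ hj]
  ring

/-- Given infinitely many principal parts at the centre of the disc `i₀`, some non trivial linear
combination of them is the principal part of a section that is holomorphic elsewhere. -/
theorem exists_section_with_principal_part {τ : I → C → ℂ} (hτ : D.IsFrame τ) (i₀ : I)
    (q : ℕ → ℂ → ℂ) {ε : ℝ} (hε : 0 < ε) (hq : ∀ k, DifferentiableOn ℂ (q k) (ball 0 ε \ {0})) :
    ∃ (c : ℕ →₀ ℂ) (w : C → ℂ) (H : ℂ → ℂ), c ≠ 0 ∧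
      (∀ j, ∀ x ∈ (D.chart j).source, x ≠ (D.chart i₀).symm 0 →
        DifferentiableAt ℂ (fun z => τ j ((D.chart j).symm z) * w ((D.chart j).symm z))
          (D.chart j x)) ∧
      (∀ᶠ z in 𝓝 0, DifferentiableAt ℂ H z) ∧
      ∀ᶠ z in 𝓝[≠] 0, τ i₀ ((D.chart i₀).symm z) * w ((D.chart i₀).symm z) =
        (c.sum fun k a => a * q k z) + H z := by
  classical
  set δ := min ε 1 with hδ
  have hδ0 : 0 < δ := lt_min hε one_pos
  have hδ1 : δ ≤ 1 := min_le_right _ _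
  have hδε : δ ≤ ε := min_le_left _ _
  have hr : 0 < δ / 4 := by positivity
  have hR : δ / 4 < δ / 2 := by linarith
  set ρ := cutoff hr hR with hρ
  have hopen : IsOpen (ball (0 : ℂ) ε \ {0}) := isOpen_ball.sdiff isClosed_singleton
  -- The form `∂̄(ρ q)`: smooth, because `ρ` is constant near the singularity of `q`.
  set φ : ℕ → I → ℂ → ℂ := fun k i z => if i = i₀ then dbar ρ z * q k z else 0 with hφ
  have hφc : ∀ k i, ContDiff ℝ 1 (φ k i) := by
    intro k i
    by_cases hi : i = i₀
    · simp only [hφ, if_pos hi]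
      refine contDiff_dbar_cutoff_mul hr hR hopen (hq k) ?_
      intro z hz1 hz2
      refine ⟨mem_ball_zero_iff.2 (by linarith), ?_⟩
      rintro rfl
      rw [norm_zero] at hz1
      linarith
    · simp only [hφ, if_neg hi]
      exact contDiff_const
  have hφs : ∀ k i z, φ k i z ≠ 0 → ‖z‖ ≤ 1 := by
    intro k i z hz
    by_contra hlt
    apply hz
    have : dbar ρ z = 0 := dbar_cutoff_eq_zero hr hR (Or.inr (by linarith))
    simp only [hφ, this, zero_mul, ite_self]
  obtain ⟨c, v, hc, hv⟩ := exists_dbar_solution hτ φ hφc hφs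
  set Q : ℂ → ℂ := fun z => c.sum fun k a => a * q k z with hQ
  have hQd : DifferentiableOn ℂ Q (ball 0 ε \ {0}) := by
    simp only [hQ, Finsupp.sum]
    exact DifferentiableOn.fun_sum fun k _ => (hq k).const_mul _
  set G : ℂ → ℂ := fun z => ρ z * Q z with hG
  have hG0 : ∀ z, 2 < ‖z‖ → G z = 0 := fun z hz => by
    simp only [hG, hρ, cutoff_eq_zero hr hR (show δ / 2 ≤ ‖z‖ by linarith), zero_mul]
  have hρd : Differentiable ℝ ρ := (contDiff_cutoff hr hR (n := 1)).differentiable one_ne_zero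
  have hQD : ∀ z, z ≠ 0 → ‖z‖ < ε → DifferentiableAt ℂ Q z := fun z h1 h2 =>
    (hQd z ⟨mem_ball_zero_iff.2 h2, h1⟩).differentiableAt
      (hopen.mem_nhds ⟨mem_ball_zero_iff.2 h2, h1⟩)
  have hGd : ∀ z, z ≠ 0 → DifferentiableAt ℝ G z ∧ dbar G z = dbar ρ z * Q z := by
    intro z hz
    rcases lt_or_ge ‖z‖ ε with h | h
    · have h1 := hQD z hz h
      refine ⟨(hρd z).mul (h1.restrictScalars ℝ), ?_⟩
      rw [hG, dbar_mul (hρd z) (h1.restrictScalars ℝ), dbar_eq_zero h1, mul_zero, add_zero]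
    · have hz2 : δ / 2 < ‖z‖ := by linarith
      have hev : G =ᶠ[𝓝 z] fun _ => 0 := by
        filter_upwards [(isOpen_lt continuous_const continuous_norm).mem_nhds hz2] with w hw
        simp only [hG, hρ, cutoff_eq_zero hr hR (le_of_lt hw), zero_mul]
      refine ⟨(differentiableAt_const _).congr_of_eventuallyEq hev, ?_⟩
      rw [dbar_eq_zero_of_eventuallyEq_const hev, hρ, dbar_cutoff_eq_zero hr hR (Or.inr hz2),
        zero_mul]
  have hψ : ∀ j x, ∑ i, τ j x / τ i x * (starRingEnd ℂ) (D.jac i j x) *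
      D.ext i (fun z => c.sum fun k a => a * φ k i z) x =
      τ j x / τ i₀ x * (starRingEnd ℂ) (D.jac i₀ j x) * D.ext i₀ (fun z => dbar ρ z * Q z) x := by
    intro j x
    rw [Finset.sum_eq_single i₀]
    · congr 2
      funext z
      simp only [hφ, if_true, hQ, Finsupp.sum, Finset.mul_sum]
      exact Finset.sum_congr rfl fun k _ => by ring
    · intro i _ hi
      have : (fun z => c.sum fun k a => a * φ k i z) = fun _ => (0 : ℂ) := by
        funext z
        simp [hφ, if_neg hi]
      rw [this]
      simp [ext]
    · intro h
      exact absurd (Finset.mem_univ _) h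
  simp only [hψ] at hv
  have h0t : (0 : ℂ) ∈ (D.chart i₀).target := by
    rw [D.target_eq]
    simp
  have h0s : (D.chart i₀).symm 0 ∈ (D.chart i₀).source := (D.chart i₀).map_target h0t
  have h0z : D.chart i₀ ((D.chart i₀).symm 0) = 0 := (D.chart i₀).right_inv h0t
  have hball : ∀ z : ℂ, ‖z‖ < δ / 4 → z ∈ (D.chart i₀).target := by
    intro z hz
    rw [D.target_eq, mem_ball_zero_iff]
    linarith
  -- `ρ Q` has the required principal part and `v` corrects its ∂̄. Near the centre `ρ = 1`, so the
  -- correction is holomorphic there and serves as `H`.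
  refine ⟨c, fun x => (τ i₀ x)⁻¹ * D.ext i₀ G x - v x,
    fun z => -(τ i₀ ((D.chart i₀).symm z) * v ((D.chart i₀).symm z)), hc, ?_, ?_, ?_⟩
  · intro j x hj hx
    have hne : x ∈ (D.chart i₀).source → D.chart i₀ x ≠ 0 := by
      intro hi h0
      apply hx
      rw [← h0, symm_chart hi]
    have h1 := dbar_frame_ext hτ hG0 hj (i := i₀) fun hi => (hGd _ (hne hi)).1
    have h2 := hv j x hj
    simp only [mul_sub]
    refine differentiableAt_of_dbar_eq_zero (h1.1.sub h2.1) ?_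
    rw [dbar_sub h1.1 h2.1, h1.2, h2.2, sub_eq_zero]
    congr 1
    by_cases hi : x ∈ (D.chart i₀).source
    · rw [ext_of_mem hi, ext_of_mem hi, (hGd _ (hne hi)).2]
    · rw [ext_of_notMem hi, ext_of_notMem hi]
  · filter_upwards [ball_mem_nhds (0 : ℂ) hr] with z hz
    rw [mem_ball_zero_iff] at hz
    have hzt := hball z hz
    have hzs := (D.chart i₀).map_target hzt
    have h2 := hv i₀ _ hzs
    rw [(D.chart i₀).right_inv hzt, ext_of_mem hzs, (D.chart i₀).right_inv hzt, hρ,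
      dbar_cutoff_eq_zero hr hR (Or.inl hz), zero_mul, mul_zero] at h2
    exact (differentiableAt_of_dbar_eq_zero h2.1 h2.2).neg
  · filter_upwards [nhdsWithin_le_nhds (ball_mem_nhds (0 : ℂ) hr)] with z hz
    rw [mem_ball_zero_iff] at hz
    have hzt := hball z hz
    rw [ext_of_mem ((D.chart i₀).map_target hzt), (D.chart i₀).right_inv hzt]
    simp only [hG, hρ, cutoff_eq_one hr hR (le_of_lt hz), one_mul]
    have := hτ.ne_zero i₀ ((D.chart i₀).symm z)
    field_simp
    ring

end DiscAtlas

end KPCurve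

namespace KPCurve

open Metric

/-! ### Paths in simply connected subsets -/

section Paths

variable {C : Type*} [TopologicalSpace C]

theorem mk_eq_mk_of_simplyConnected {U : Set C} (hU : SimplyConnectedSpace U) {x y : C}
    (γ δ : Path x y) (hγ : ∀ t, γ t ∈ U) (hδ : ∀ t, δ t ∈ U) :
    Path.Homotopic.Quotient.mk γ = Path.Homotopic.Quotient.mk δ := by
  have hx : x ∈ U := by simpa using hγ 0
  have hy : y ∈ U := by simpa using hγ 1
  let γ' : Path (⟨x, hx⟩ : U) ⟨y, hy⟩ :=
    { toFun := fun t => ⟨γ t, hγ t⟩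
      continuous_toFun := γ.continuous.subtype_mk _
      source' := by simp
      target' := by simp }
  let δ' : Path (⟨x, hx⟩ : U) ⟨y, hy⟩ :=
    { toFun := fun t => ⟨δ t, hδ t⟩
      continuous_toFun := δ.continuous.subtype_mk _
      source' := by simp
      target' := by simp }
  have h := (SimplyConnectedSpace.paths_homotopic γ' δ').map
    ⟨Subtype.val, continuous_subtype_val⟩
  exact Path.Homotopic.Quotient.eq.2 h

theorem exists_path_of_simplyConnected {U : Set C} (hU : SimplyConnectedSpace U) {x y : C}
    (hx : x ∈ U) (hy : y ∈ U) : ∃ γ : Path x y, ∀ t, γ t ∈ U := by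
  obtain ⟨γ⟩ := PathConnectedSpace.joined (⟨x, hx⟩ : U) ⟨y, hy⟩
  exact ⟨γ.map continuous_subtype_val, fun t => (γ t).2⟩

/-- On a simply connected set there is a family of classes of paths from a given point that is
compatible with the paths in the set. -/
theorem exists_path_classes [PathConnectedSpace C] {U : Set C} (hU : SimplyConnectedSpace U)
    (x₀ : C) : ∃ A : (x : C) → Path.Homotopic.Quotient x₀ x,
      ∀ (x y : C) (δ : Path x y), (∀ t, δ t ∈ U) →
        A y = (A x).trans (Path.Homotopic.Quotient.mk δ) := by
  classical
  obtain ⟨u⟩ : Nonempty U := inferInstance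
  have hp : ∀ x, ∃ γ : Path (u : C) x, x ∈ U → ∀ t, γ t ∈ U := by
    intro x
    by_cases hx : x ∈ U
    · obtain ⟨γ, hγ⟩ := exists_path_of_simplyConnected hU u.2 hx
      exact ⟨γ, fun _ => hγ⟩
    · exact ⟨(PathConnectedSpace.joined (u : C) x).somePath, fun h => absurd h hx⟩
  choose p hp using hp
  set β := (PathConnectedSpace.joined x₀ (u : C)).somePath
  refine ⟨fun x => Path.Homotopic.Quotient.mk (β.trans (p x)), fun x y δ hδ => ?_⟩
  have hx : x ∈ U := by simpa using hδ 0
  have hy : y ∈ U := by simpa using hδ 1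
  have h : Path.Homotopic.Quotient.mk (p y) = Path.Homotopic.Quotient.mk ((p x).trans δ) := by
    refine mk_eq_mk_of_simplyConnected hU _ _ (hp y hy) ?_
    intro t
    have : ((p x).trans δ) t ∈ Set.range ((p x).trans δ) := ⟨t, rfl⟩
    rw [Path.trans_range] at this
    rcases this with ⟨s, hs⟩ | ⟨s, hs⟩
    · rw [← hs]
      exact hp x hx s
    · rw [← hs]
      exact hδ s
  simp only []
  rw [Path.Homotopic.Quotient.mk_trans, h, Path.Homotopic.Quotient.mk_trans,
    Path.Homotopic.Quotient.mk_trans, Path.Homotopic.Quotient.trans_assoc]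

theorem eventually_joined [LocallyPathConnectedSpace C] {U : Set C} (hU : IsOpen U) {x : C}
    (hx : x ∈ U) : ∀ᶠ y in 𝓝 x, ∃ δ : Path x y, ∀ t, δ t ∈ U := by
  filter_upwards [pathComponentIn_mem_nhds (hU.mem_nhds hx)] with y hy
  exact hy

end Paths

/-! ### The character and its holonomies -/

section Character

variable {C : Type*} [TopologicalSpace C] {x₀ : C} {g : ℕ}
  (b : Module.Basis (Fin g ⊕ Fin g) ℤ (H1 C x₀)) (e : Fin g → ℂ)

theorem homologyClass_trans (c d : Path.Homotopic.Quotient x₀ x₀) :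
    homologyClass (c.trans d) = homologyClass c + homologyClass d := by
  -- Multiplication in the fundamental group runs against concatenation; commutativity of homology
  -- absorbs the reversal.
  have h : FundamentalGroup.fromPath (c.trans d) =
      FundamentalGroup.fromPath d * FundamentalGroup.fromPath c := rfl
  rw [homologyClass, h, map_mul, ofMul_mul, add_comm]
  rfl

theorem character_trans (c d : Path.Homotopic.Quotient x₀ x₀) :
    character b e (c.trans d) = character b e c * character b e d := by
  rw [character, character, character, ← Complex.exp_add, homologyClass_trans, map_add,
    ← mul_add, ← Finset.sum_add_distrib]
  congr 2
  refine Finset.sum_congr rfl fun j _ => ?_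
  rw [Finsupp.add_apply]
  push_cast
  ring

theorem character_ne_zero (c : Path.Homotopic.Quotient x₀ x₀) : character b e c ≠ 0 :=
  Complex.exp_ne_zero _

/-- The value of the character on the loop `A B⁻¹`. -/
def holonomy {x : C} (A B : Path.Homotopic.Quotient x₀ x) : ℂ := character b e (A.trans B.symm)

theorem holonomy_ne_zero {x : C} (A B : Path.Homotopic.Quotient x₀ x) : holonomy b e A B ≠ 0 :=
  character_ne_zero b e _

theorem holonomy_mul {x : C} (A B E : Path.Homotopic.Quotient x₀ x) :
    holonomy b e A B * holonomy b e B E = holonomy b e A E := by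
  rw [holonomy, holonomy, ← character_trans, Path.Homotopic.Quotient.trans_assoc,
    ← Path.Homotopic.Quotient.trans_assoc B.symm, Path.Homotopic.Quotient.symm_trans,
    Path.Homotopic.Quotient.refl_trans, holonomy]

theorem holonomy_loop {x : C} (c : Path.Homotopic.Quotient x₀ x₀)
    (A B : Path.Homotopic.Quotient x₀ x) :
    holonomy b e (c.trans A) B = character b e c * holonomy b e A B := by
  rw [holonomy, holonomy, ← character_trans, Path.Homotopic.Quotient.trans_assoc]

theorem symm_trans_eq {X : Type*} [TopologicalSpace X] {x y w : X}
    (A : Path.Homotopic.Quotient x y) (B : Path.Homotopic.Quotient y w) :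
    (A.trans B).symm = B.symm.trans A.symm := by
  induction A using Path.Homotopic.Quotient.ind with | mk γ =>
  induction B using Path.Homotopic.Quotient.ind with | mk δ =>
  rw [← Path.Homotopic.Quotient.mk_trans, ← Path.Homotopic.Quotient.mk_symm, Path.trans_symm]
  rfl

/-- The common tail `δ` cancels; hence the holonomy between two compatible families of path classes
is locally constant. -/
theorem holonomy_trans {x y : C} (A B : Path.Homotopic.Quotient x₀ x)
    (δ : Path.Homotopic.Quotient x y) :
    holonomy b e (A.trans δ) (B.trans δ) = holonomy b e A B := by
  rw [holonomy, symm_trans_eq, Path.Homotopic.Quotient.trans_assoc,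
    ← Path.Homotopic.Quotient.trans_assoc δ, Path.Homotopic.Quotient.trans_symm,
    Path.Homotopic.Quotient.refl_trans, holonomy]

end Character

/-! ### Disc atlases adapted to a finite set -/

section Charts

variable {C : Type*} [TopologicalSpace C] [ChartedSpace ℂ C] [IsManifold 𝓘(ℂ, ℂ) ω C]

/-- The map `z ↦ (z - c) / r`. -/
def affineHomeomorph (c : ℂ) {r : ℂ} (hr : r ≠ 0) : ℂ ≃ₜ ℂ where
  toFun z := (z - c) * r⁻¹
  invFun z := z * r + c
  left_inv z := by field_simp; ring
  right_inv z := by field_simp; ring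
  continuous_toFun := by fun_prop
  continuous_invFun := by fun_prop

/-- Rescales the preferred chart affinely, so that powers of the new chart and of the centered
preferred chart differ only by constants. -/
theorem exists_disc_chart (x₀ : C) {V : Set C} (hV : IsOpen V) (hx₀ : x₀ ∈ V) :
    ∃ φ : OpenPartialHomeomorph C ℂ, φ.target = ball 0 3 ∧ x₀ ∈ φ.source ∧ φ.source ⊆ V ∧
      φ.source ⊆ (chartAt ℂ x₀).source ∧
      (∃ r : ℂ, r ≠ 0 ∧ ∀ x, φ x = (chartAt ℂ x₀ x - chartAt ℂ x₀ x₀) * r⁻¹) ∧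
      (∀ x ∈ φ.source, MDifferentiableAt 𝓘(ℂ, ℂ) 𝓘(ℂ, ℂ) φ x) ∧
      ∀ z ∈ φ.target, MDifferentiableAt 𝓘(ℂ, ℂ) 𝓘(ℂ, ℂ) φ.symm z := by
  set e := chartAt ℂ x₀ with he
  have hx : x₀ ∈ e.source := mem_chart_source ℂ x₀
  have hopen : IsOpen (e.target ∩ e.symm ⁻¹' V) := e.isOpen_inter_preimage_symm hV
  have hmem : e x₀ ∈ e.target ∩ e.symm ⁻¹' V := ⟨e.map_source hx, by
    rw [Set.mem_preimage, e.left_inv hx]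
    exact hx₀⟩
  obtain ⟨ε, hε, hεs⟩ := Metric.isOpen_iff.1 hopen _ hmem
  set r : ℂ := ((ε / 3 : ℝ) : ℂ) with hr
  have hr0 : r ≠ 0 := by
    rw [hr]
    exact_mod_cast (by positivity : ε / 3 ≠ 0)
  have hrn : ‖r‖ = ε / 3 := by
    rw [hr, Complex.norm_real, Real.norm_of_nonneg (by positivity)]
  set ψ := e.transHomeomorph (affineHomeomorph (e x₀) hr0) with hψ
  have hball : ∀ z : ℂ, z ∈ ball (0 : ℂ) 3 → z * r + e x₀ ∈ e.target ∩ e.symm ⁻¹' V := by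
    intro z hz
    apply hεs
    rw [mem_ball_zero_iff] at hz
    rw [mem_ball, dist_eq_norm, add_sub_cancel_right, norm_mul, hrn]
    nlinarith
  have hψt : ball (0 : ℂ) 3 ⊆ ψ.target := fun z hz => (hball z hz).1
  -- Restricting the inverse prescribes the target rather than the source.
  set φ := (ψ.symm.restrOpen (ball 0 3) isOpen_ball).symm with hφ
  have htar : φ.target = ball 0 3 := by
    rw [hφ, OpenPartialHomeomorph.symm_target, OpenPartialHomeomorph.restrOpen_source,
      OpenPartialHomeomorph.symm_source, Set.inter_eq_right]
    exact hψt
  have hval : ∀ x, φ x = (e x - e x₀) * r⁻¹ := fun x => rfl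
  have hsymm : ∀ z, φ.symm z = e.symm (z * r + e x₀) := fun z => rfl
  have hsrc : ∀ x ∈ φ.source, x ∈ e.source ∧ x ∈ V := by
    intro x hx
    have h1 := φ.map_source hx
    rw [htar] at h1
    have h2 := hball _ h1
    have h3 : e.symm (φ x * r + e x₀) = x := by
      rw [← hsymm, φ.left_inv hx]
    refine ⟨?_, ?_⟩
    · rw [← h3]
      exact e.map_target h2.1
    · rw [← h3]
      exact h2.2
  refine ⟨φ, htar, ?_, fun x hx => (hsrc x hx).2, fun x hx => (hsrc x hx).1, ⟨r, hr0, hval⟩, ?_, ?_⟩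
  · have h0 : (0 : ℂ) ∈ φ.target := by
      rw [htar]
      simp
    have h1 := φ.map_target h0
    rwa [hsymm, zero_mul, zero_add, e.left_inv hx] at h1
  · intro x hx
    have h1 : MDifferentiableAt 𝓘(ℂ, ℂ) 𝓘(ℂ, ℂ) e x :=
      mdifferentiableAt_atlas (chart_mem_atlas ℂ x₀) (hsrc x hx).1
    have h2 : DifferentiableAt ℂ (fun w : ℂ => (w - e x₀) * r⁻¹) (e x) := by fun_prop
    exact h2.mdifferentiableAt.comp x h1
  · intro z hz
    rw [htar] at hz
    have h1 : MDifferentiableAt 𝓘(ℂ, ℂ) 𝓘(ℂ, ℂ) e.symm (z * r + e x₀) :=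
      mdifferentiableAt_atlas_symm (chart_mem_atlas ℂ x₀) (hball z hz).1
    have h2 : DifferentiableAt ℂ (fun w : ℂ => w * r + e x₀) z := by fun_prop
    exact MDifferentiableAt.comp (f := fun w : ℂ => w * r + e x₀) z h1 h2.mdifferentiableAt

/-- A disc atlas indexed by the centres of its discs, such that the points of a finite set `T` are
centres and lie in no other disc. -/
structure AdaptedAtlas (C : Type*) [TopologicalSpace C] [ChartedSpace ℂ C] (T : Finset C)
    (S : Finset C) extends DiscAtlas C S where
  subset : T ⊆ S
  center_mem : ∀ i : S, (i : C) ∈ (chart i).source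
  source_subset : ∀ i : S, (chart i).source ⊆ (chartAt ℂ (i : C)).source
  chart_eq : ∀ i : S, ∃ r : ℂ, r ≠ 0 ∧
    ∀ x, chart i x = (chartAt ℂ (i : C) x - chartAt ℂ (i : C) (i : C)) * r⁻¹
  eq_of_mem : ∀ (i : S) (t : C), t ∈ T → t ∈ (chart i).source → t = i
  mdifferentiable : ∀ i, ∀ x ∈ (chart i).source, MDifferentiableAt 𝓘(ℂ, ℂ) 𝓘(ℂ, ℂ) (chart i) x
  mdifferentiable_symm : ∀ i, ∀ z ∈ (chart i).target,
    MDifferentiableAt 𝓘(ℂ, ℂ) 𝓘(ℂ, ℂ) (chart i).symm z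

theorem exists_adaptedAtlas [T2Space C] [CompactSpace C] (T : Finset C) :
    ∃ S : Finset C, Nonempty (AdaptedAtlas C T S) := by
  classical
  -- Each disc is kept away from all points of `T` other than its own centre.
  have hV : ∀ x : C, IsOpen ((T.erase x : Set C)ᶜ) := fun x =>
    (Finset.finite_toSet _).isClosed.isOpen_compl
  have hxV : ∀ x : C, x ∈ ((T.erase x : Set C)ᶜ) := fun x => by simp
  choose φ htar hmem hsV hsub hr hmd hmds using fun x => exists_disc_chart x (hV x) (hxV x)
  have hzero : ∀ x, φ x x = 0 := by
    intro x
    obtain ⟨r, _, h⟩ := hr x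
    rw [h, sub_self, zero_mul]
  have hnhds : ∀ x, {y | y ∈ (φ x).source ∧ ‖φ x y‖ < 1} ∈ 𝓝 x := by
    intro x
    have h1 : Filter.Tendsto (fun y => ‖φ x y‖) (𝓝 x) (𝓝 0) := by
      have := ((φ x).continuousAt (hmem x)).norm
      rwa [ContinuousAt, hzero, norm_zero] at this
    exact Filter.inter_mem ((φ x).open_source.mem_nhds (hmem x)) (h1.eventually (gt_mem_nhds one_pos))
  obtain ⟨S₀, hS₀⟩ := CompactSpace.elim_nhds_subcover _ hnhds
  refine ⟨S₀ ∪ T, ⟨{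
    chart := fun i => φ i
    target_eq := fun i => htar i
    cover := ?_
    holo := ?_
    subset := Finset.subset_union_right
    center_mem := fun i => hmem i
    source_subset := fun i => hsub i
    chart_eq := fun i => hr i
    eq_of_mem := ?_
    mdifferentiable := fun i => hmd i
    mdifferentiable_symm := fun i => hmds i }⟩⟩
  · intro x
    have hx : x ∈ (⊤ : Set C) := trivial
    rw [← hS₀] at hx
    simp only [Set.mem_iUnion] at hx
    obtain ⟨y, hy, hxy⟩ := hx
    exact ⟨⟨y, Finset.mem_union_left _ hy⟩, hxy⟩
  · intro i j x hi hj
    have h1 := hmds j _ ((φ j).map_source hj)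
    have h2 : MDifferentiableAt 𝓘(ℂ, ℂ) 𝓘(ℂ, ℂ) (φ i) ((φ j).symm (φ j x)) := by
      rw [(φ j).left_inv hj]
      exact hmd i x hi
    exact (h2.comp _ h1).differentiableAt
  · intro i t ht hti
    by_contra hne
    exact hsV i hti (by simp [hne, ht])

end Charts

namespace AdaptedAtlas

variable {C : Type*} [TopologicalSpace C] [ChartedSpace ℂ C] {T S : Finset C} (D : AdaptedAtlas C T S)

theorem chart_center (i : S) : D.chart i (i : C) = 0 := by
  obtain ⟨r, _, h⟩ := D.chart_eq i
  rw [h, sub_self, zero_mul]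

theorem symm_zero (i : S) : (D.chart i).symm 0 = (i : C) := by
  rw [← D.chart_center i, (D.chart i).left_inv (D.center_mem i)]

theorem chart_eq_zero_iff {i : S} {x : C} (hx : x ∈ (D.chart i).source) :
    D.chart i x = 0 ↔ x = i := by
  constructor
  · intro h
    rw [← (D.chart i).left_inv hx, h, D.symm_zero]
  · rintro rfl
    exact D.chart_center i

theorem simplyConnected_source (i : S) : SimplyConnectedSpace (D.chart i).source := by
  have : ContractibleSpace (D.chart i).target := by
    rw [D.target_eq]
    exact contractibleSpace_ball (by norm_num)
  have := (D.chart i).toHomeomorphSourceTarget.contractibleSpace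
  infer_instance

theorem mdifferentiableAt_iff {i : S} {x : C} (hx : x ∈ (D.chart i).source) (F : C → ℂ) :
    MDifferentiableAt 𝓘(ℂ, ℂ) 𝓘(ℂ, ℂ) F x ↔
      DifferentiableAt ℂ (fun z => F ((D.chart i).symm z)) (D.chart i x) := by
  constructor
  · intro h
    have h1 := D.mdifferentiable_symm i _ ((D.chart i).map_source hx)
    have h2 : MDifferentiableAt 𝓘(ℂ, ℂ) 𝓘(ℂ, ℂ) F ((D.chart i).symm (D.chart i x)) := by
      rwa [(D.chart i).left_inv hx]
    exact (h2.comp _ h1).differentiableAt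
  · intro h
    have h1 := h.mdifferentiableAt.comp x (D.mdifferentiable i x hx)
    refine h1.congr_of_eventuallyEq ?_
    filter_upwards [(D.chart i).open_source.mem_nhds hx] with y hy
    simp only [Function.comp]
    rw [(D.chart i).left_inv hy]

end AdaptedAtlas

end KPCurve

/-! ### Holomorphic functions on the surface and local expressions of sections -/

namespace KPCurve

open Metric

section Holo

variable {C : Type*} [TopologicalSpace C] [ChartedSpace ℂ C]

/-- Complex differentiability of a function on a Riemann surface. -/
abbrev HoloAt (F : C → ℂ) (x : C) : Prop := MDifferentiableAt 𝓘(ℂ, ℂ) 𝓘(ℂ, ℂ) F x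

namespace HoloAt

variable {F G : C → ℂ} {x : C}

theorem mul' (hF : HoloAt F x) (hG : HoloAt G x) : HoloAt (fun y => F y * G y) x :=
  MDifferentiableAt.mul hF hG

theorem add' (hF : HoloAt F x) (hG : HoloAt G x) : HoloAt (fun y => F y + G y) x :=
  MDifferentiableAt.add hF hG

theorem sub' (hF : HoloAt F x) (hG : HoloAt G x) : HoloAt (fun y => F y - G y) x :=
  MDifferentiableAt.sub hF hG

theorem const (c : ℂ) : HoloAt (fun _ : C => c) x := mdifferentiableAt_const

theorem comp' {φ : ℂ → ℂ} (hφ : DifferentiableAt ℂ φ (F x)) (hF : HoloAt F x) :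
    HoloAt (fun y => φ (F y)) x :=
  hφ.comp_mdifferentiableAt hF

theorem pow' (hF : HoloAt F x) (n : ℕ) : HoloAt (fun y => F y ^ n) x :=
  comp' (φ := fun w => w ^ n) (by fun_prop) hF

theorem zpow' (hF : HoloAt F x) {n : ℤ} (h : F x ≠ 0 ∨ 0 ≤ n) : HoloAt (fun y => F y ^ n) x :=
  comp' (φ := fun w => w ^ n) (differentiableAt_zpow.2 h) hF

theorem congr' (hF : HoloAt F x) (h : ∀ᶠ y in 𝓝 x, G y = F y) : HoloAt G x :=
  MDifferentiableAt.congr_of_eventuallyEq hF h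

end HoloAt

/-- The chart at `x₀`, centered. -/
def cchart (x₀ y : C) : ℂ := chartAt ℂ x₀ y - chartAt ℂ x₀ x₀

theorem cchart_self (x₀ : C) : cchart x₀ x₀ = 0 := sub_self _

theorem cchart_ne_zero {x₀ y : C} (hy : y ∈ (chartAt ℂ x₀).source) (h : y ≠ x₀) :
    cchart x₀ y ≠ 0 := fun h0 =>
  h ((chartAt ℂ x₀).injOn hy (mem_chart_source ℂ x₀) (sub_eq_zero.1 h0))

theorem holoAt_cchart [IsManifold 𝓘(ℂ, ℂ) ω C] {x₀ y : C} (hy : y ∈ (chartAt ℂ x₀).source) :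
    HoloAt (cchart x₀) y :=
  HoloAt.sub' (mdifferentiableAt_atlas (chart_mem_atlas ℂ x₀) hy) (HoloAt.const _)

end Holo

/-! ### The function ring -/

section FunctionRing

variable {C : Type*} {pinf : C}

open Classical in
/-- Extension by zero to the marked point. -/
def zeroExtend (f : {x : C // x ≠ pinf} → ℂ) (x : C) : ℂ := if h : x ≠ pinf then f ⟨x, h⟩ else 0

theorem zeroExtend_of_ne (f : {x : C // x ≠ pinf} → ℂ) {x : C} (h : x ≠ pinf) :
    zeroExtend f x = f ⟨x, h⟩ := dif_pos h

variable [TopologicalSpace C] [ChartedSpace ℂ C]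

theorem holoAt_zeroExtend [T2Space C] {f : {x : C // x ≠ pinf} → ℂ} (hf : f ∈ functionRing pinf) {x : C}
    (hx : x ≠ pinf) : HoloAt (zeroExtend f) x := by
  obtain ⟨n, hn, U, hU, hxU, -, F, hF, hfF⟩ := hf x
  have h1 : HoloAt F x := (hF x hxU).mdifferentiableAt (hU.mem_nhds hxU)
  refine h1.congr' ?_
  filter_upwards [hU.mem_nhds hxU, isOpen_ne.mem_nhds hx] with y hy hne
  rw [zeroExtend_of_ne f hne, hfF ⟨y, hne⟩ hy, hn hx, zpow_zero, one_mul]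

theorem exists_pole_order [IsManifold 𝓘(ℂ, ℂ) ω C] {f : {x : C // x ≠ pinf} → ℂ}
    (hf : f ∈ functionRing pinf) :
    ∃ (N : ℕ) (U : Set C) (F : C → ℂ), IsOpen U ∧ pinf ∈ U ∧ U ⊆ (chartAt ℂ pinf).source ∧
      (∀ y ∈ U, HoloAt F y) ∧
      ∀ y ∈ U, y ≠ pinf → zeroExtend f y = cchart pinf y ^ (-(N : ℤ)) * F y := by
  obtain ⟨n, -, U, hU, hxU, hUs, F, hF, hfF⟩ := hf pinf
  refine ⟨n.natAbs, U, fun y => cchart pinf y ^ (n + n.natAbs).toNat * F y, hU, hxU, hUs, ?_, ?_⟩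
  · intro y hy
    exact ((holoAt_cchart (hUs hy)).pow' _).mul' ((hF y hy).mdifferentiableAt (hU.mem_nhds hy))
  · intro y hy hne
    have h0 := cchart_ne_zero (hUs hy) hne
    rw [zeroExtend_of_ne f hne, hfF ⟨y, hne⟩ hy, ← mul_assoc]
    congr 1
    rw [← zpow_natCast, Int.toNat_of_nonneg (by omega), ← zpow_add₀ h0]
    change cchart pinf y ^ n = _
    congr 1
    omega

end FunctionRing

/-! ### Local expressions of sections -/

section Sections

variable {C : Type*} [TopologicalSpace C] [ChartedSpace ℂ C] {pinf : C} {Δ : C →₀ ℤ}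

/-- Near `x₀`, the branch of `u` along `γ₀` is the `n`-th power of the centered chart at `x₀` times
the holomorphic function `F`. -/
def HasLocalExpr (u : MultiFun pinf Δ) (x₀ : C) (γ₀ : Path pinf x₀) (n : ℤ) (F : C → ℂ) : Prop :=
  ∃ U : Set C, IsOpen U ∧ x₀ ∈ U ∧ U ⊆ (chartAt ℂ x₀).source ∧ (∀ y ∈ U, HoloAt F y) ∧
    ∀ (y : GoodPoint pinf Δ) (δ : Path x₀ (y : C)), (∀ t, δ t ∈ U) →
      u y (Path.Homotopic.Quotient.mk (γ₀.trans δ)) = cchart x₀ y ^ n * F y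

theorem mem_sections_iff {g : ℕ} {b : Module.Basis (Fin g ⊕ Fin g) ℤ (H1 C pinf)} {e : Fin g → ℂ}
    {u : MultiFun pinf Δ} : u ∈ sections b Δ e ↔
      (∀ (c : Path.Homotopic.Quotient pinf pinf) (x : GoodPoint pinf Δ)
        (γ : Path.Homotopic.Quotient pinf (x : C)), u x (c.trans γ) = character b e c * u x γ) ∧
      ∀ (x₀ : C) (γ₀ : Path pinf x₀), ∃ n : ℤ, (x₀ ≠ pinf → n = -Δ x₀) ∧
        ∃ F, HasLocalExpr u x₀ γ₀ n F := by
  refine and_congr_right fun _ => forall₂_congr fun x₀ γ₀ => exists_congr fun n =>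
    and_congr_right fun _ => ?_
  constructor
  · rintro ⟨U, hU, hxU, hUs, F, hF, h⟩
    exact ⟨F, U, hU, hxU, hUs, fun y hy => (hF y hy).mdifferentiableAt (hU.mem_nhds hy), h⟩
  · rintro ⟨F, U, hU, hxU, hUs, hF, h⟩
    exact ⟨U, hU, hxU, hUs, F, fun y hy => (hF y hy).mdifferentiableWithinAt, h⟩

namespace HasLocalExpr

variable {u v : MultiFun pinf Δ} {x₀ : C} {γ₀ : Path pinf x₀} {n : ℤ} {F G : C → ℂ}

theorem add (hu : HasLocalExpr u x₀ γ₀ n F) (hv : HasLocalExpr v x₀ γ₀ n G) :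
    HasLocalExpr (u + v) x₀ γ₀ n fun y => F y + G y := by
  obtain ⟨U, hU, hxU, hUs, hF, h⟩ := hu
  obtain ⟨V, hV, hxV, -, hG, k⟩ := hv
  refine ⟨U ∩ V, hU.inter hV, ⟨hxU, hxV⟩, fun y hy => hUs hy.1,
    fun y hy => (hF y hy.1).add' (hG y hy.2), fun y δ hδ => ?_⟩
  rw [mul_add, ← h y δ fun t => (hδ t).1, ← k y δ fun t => (hδ t).2]
  rfl

theorem smul (c : ℂ) (hu : HasLocalExpr u x₀ γ₀ n F) :
    HasLocalExpr (c • u) x₀ γ₀ n fun y => c * F y := by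
  obtain ⟨U, hU, hxU, hUs, hF, h⟩ := hu
  refine ⟨U, hU, hxU, hUs, fun y hy => (HoloAt.const c).mul' (hF y hy), fun y δ hδ => ?_⟩
  have : (c • u) y (Path.Homotopic.Quotient.mk (γ₀.trans δ)) =
      c * u y (Path.Homotopic.Quotient.mk (γ₀.trans δ)) := rfl
  rw [this, h y δ hδ]
  ring

/-- Two sections may have different exponents at the marked point; lowering both to the minimum
allows them to be added. -/
theorem shift [IsManifold 𝓘(ℂ, ℂ) ω C] {γ₀ : Path pinf pinf}
    (hu : HasLocalExpr u pinf γ₀ n F) (k : ℕ) :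
    HasLocalExpr u pinf γ₀ (n - k) fun y => cchart pinf y ^ k * F y := by
  obtain ⟨U, hU, hxU, hUs, hF, h⟩ := hu
  refine ⟨U, hU, hxU, hUs, fun y hy => ((holoAt_cchart (hUs hy)).pow' k).mul' (hF y hy),
    fun y δ hδ => ?_⟩
  have hyU : (y : C) ∈ U := by simpa using hδ 1
  have h0 := cchart_ne_zero (hUs hyU) y.2.1
  rw [h y δ hδ, ← mul_assoc, ← zpow_natCast, ← zpow_add₀ h0, sub_add_cancel]

end HasLocalExpr

variable {g : ℕ} {b : Module.Basis (Fin g ⊕ Fin g) ℤ (H1 C pinf)} {e : Fin g → ℂ}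

theorem add_mem_sections [IsManifold 𝓘(ℂ, ℂ) ω C] {u v : MultiFun pinf Δ}
    (hu : u ∈ sections b Δ e) (hv : v ∈ sections b Δ e) : u + v ∈ sections b Δ e := by
  rw [mem_sections_iff] at hu hv ⊢
  refine ⟨fun c x γ => ?_, fun x₀ γ₀ => ?_⟩
  · have h : ∀ γ, (u + v) x γ = u x γ + v x γ := fun γ => rfl
    rw [h, h, hu.1, hv.1, mul_add]
  · obtain ⟨n, hn, F, hF⟩ := hu.2 x₀ γ₀
    obtain ⟨m, hm, G, hG⟩ := hv.2 x₀ γ₀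
    by_cases hx : x₀ = pinf
    · subst hx
      have h1 := hF.shift (n - min n m).toNat
      have h2 := hG.shift (m - min n m).toNat
      rw [Int.toNat_of_nonneg (by omega), sub_sub_cancel] at h1 h2
      exact ⟨min n m, fun h => absurd rfl h, _, h1.add h2⟩
    · rw [hm hx, ← hn hx] at hG
      exact ⟨n, hn, _, hF.add hG⟩

theorem smul_mem_sections {u : MultiFun pinf Δ} (c : ℂ) (hu : u ∈ sections b Δ e) :
    c • u ∈ sections b Δ e := by
  rw [mem_sections_iff] at hu ⊢
  refine ⟨fun d x γ => ?_, fun x₀ γ₀ => ?_⟩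
  · have h : ∀ γ, (c • u) x γ = c * u x γ := fun γ => rfl
    rw [h, h, hu.1, mul_left_comm]
  · obtain ⟨n, hn, F, hF⟩ := hu.2 x₀ γ₀
    exact ⟨n, hn, _, hF.smul c⟩

theorem sum_mem_sections [IsManifold 𝓘(ℂ, ℂ) ω C] {ι : Type*} {s : Finset ι}
    (hs : s.Nonempty) {u : ι → MultiFun pinf Δ} (hu : ∀ i ∈ s, u i ∈ sections b Δ e) :
    ∑ i ∈ s, u i ∈ sections b Δ e := by
  induction hs using Finset.Nonempty.cons_induction with
  | singleton i => simpa using hu i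
  | cons i s hi hs ih =>
    rw [Finset.sum_cons]
    exact add_mem_sections (hu i (by simp)) (ih fun j hj => hu j (by simp [hj]))

theorem mulSection_mem_sections [T2Space C] [IsManifold 𝓘(ℂ, ℂ) ω C]
    {f : {x : C // x ≠ pinf} → ℂ} (hf : f ∈ functionRing pinf) {u : MultiFun pinf Δ}
    (hu : u ∈ sections b Δ e) : mulSection f u ∈ sections b Δ e := by
  rw [mem_sections_iff] at hu ⊢
  have hval : ∀ (x : GoodPoint pinf Δ) γ, mulSection f u x γ = zeroExtend f x * u x γ := by
    intro x γ
    rw [zeroExtend_of_ne f x.2.1]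
    rfl
  refine ⟨fun c x γ => ?_, fun x₀ γ₀ => ?_⟩
  · rw [hval, hval, hu.1, mul_left_comm]
  · obtain ⟨n, hn, F, U, hU, hxU, hUs, hF, h⟩ := hu.2 x₀ γ₀
    by_cases hx : x₀ = pinf
    · subst hx
      obtain ⟨N, V, G, hV, hxV, -, hG, k⟩ := exists_pole_order hf
      refine ⟨n - N, fun h => absurd rfl h, fun y => G y * F y, U ∩ V, hU.inter hV, ⟨hxU, hxV⟩,
        fun y hy => hUs hy.1, fun y hy => (hG y hy.2).mul' (hF y hy.1), fun y δ hδ => ?_⟩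
      have hyU : (y : C) ∈ U ∩ V := by simpa using hδ 1
      have h0 := cchart_ne_zero (hUs hyU.1) y.2.1
      rw [hval, h y δ fun t => (hδ t).1, k y hyU.2 y.2.1, sub_eq_add_neg, zpow_add₀ h0]
      ring
    · refine ⟨n, hn, fun y => zeroExtend f y * F y, U ∩ {pinf}ᶜ,
        hU.inter isOpen_compl_singleton, ⟨hxU, hx⟩, fun y hy => hUs hy.1,
        fun y hy => (holoAt_zeroExtend hf hy.2).mul' (hF y hy.1), fun y δ hδ => ?_⟩
      rw [hval, h y δ fun t => (hδ t).1]
      ring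

end Sections

/-! ### The frame of a twisted flat bundle -/

namespace AdaptedAtlas

section Frame

variable {C : Type*} [TopologicalSpace C] [ChartedSpace ℂ C] {T S : Finset C}
  (D : AdaptedAtlas C T S)

open Classical in
/-- The `k i`-th power of the chart, away from the centre. -/
def mono (k : C →₀ ℤ) (i : S) (x : C) : ℂ :=
  if x ∈ (D.chart i).source ∧ x ≠ i then D.chart i x ^ k i else 1

theorem mono_ne_zero (k : C →₀ ℤ) (i : S) (x : C) : D.mono k i x ≠ 0 := by
  rw [mono]
  split_ifs with h
  · exact zpow_ne_zero _ fun h0 => h.2 ((D.chart_eq_zero_iff h.1).1 h0)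
  · exact one_ne_zero

theorem mono_of_mem {k : C →₀ ℤ} {i : S} {x : C} (hx : x ∈ (D.chart i).source)
    (h : x ≠ i ∨ k i = 0) : D.mono k i x = D.chart i x ^ k i := by
  rw [mono]
  split_ifs with h'
  · rfl
  · have hxi : x = i := by
      by_contra hne
      exact h' ⟨hx, hne⟩
    rcases h with h | h
    · exact absurd hxi h
    · rw [h, zpow_zero]

variable {x₀ : C} {g : ℕ} (b : Module.Basis (Fin g ⊕ Fin g) ℤ (H1 C x₀)) (e : Fin g → ℂ)
  (A : S → (x : C) → Path.Homotopic.Quotient x₀ x) (a : (x : C) → Path.Homotopic.Quotient x₀ x)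

/-- The frame of the flat bundle with the given character, twisted by a divisor. -/
def frame (k : C →₀ ℤ) (i : S) (x : C) : ℂ := holonomy b e (A i x) (a x) * D.mono k i x

variable {A}

/-- The reference paths `a` are arbitrary, so a single `frame` need not even be continuous; in a
quotient they drop out, leaving a locally constant holonomy times powers of the charts. -/
theorem isFrame [T2Space C] [LocallyPathConnectedSpace C] {k : C →₀ ℤ} (hk : k.support ⊆ T)
    (hA : ∀ (i : S) (x y : C) (δ : Path x y), (∀ t, δ t ∈ (D.chart i).source) →
      A i y = (A i x).trans (Path.Homotopic.Quotient.mk δ)) :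
    D.IsFrame (D.frame b e A a k) where
  ne_zero i x := mul_ne_zero (holonomy_ne_zero _ _ _ _) (D.mono_ne_zero k i x)
  holo i j x hi hj := by
    have hne : ∀ i x, D.frame b e A a k i x ≠ 0 := fun i x =>
      mul_ne_zero (holonomy_ne_zero _ _ _ _) (D.mono_ne_zero k i x)
    by_cases hij : i = j
    · subst hij
      simp only [div_self (hne _ _)]
      exact differentiableAt_const _
    -- The powers are singular only at centres in the support of `k`, and such a centre lies in no
    -- other disc.
    have hcent : ∀ l m : S, l ≠ m → x ∈ (D.chart m).source → x ≠ l ∨ k l = 0 := by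
      intro l m hlm hm
      by_contra hcon
      push Not at hcon
      have hT : (l : C) ∈ T := hk (Finsupp.mem_support_iff.2 hcon.2)
      rw [← hcon.1] at hT
      exact hlm (Subtype.ext (hcon.1.symm.trans (D.eq_of_mem m x hT hm)))
    have hmono : ∀ l m : S, l ≠ m → x ∈ (D.chart l).source → x ∈ (D.chart m).source →
        (∀ᶠ y in 𝓝 x, D.mono k l y = D.chart l y ^ k l) ∧ (D.chart l x ≠ 0 ∨ k l = 0) := by
      intro l m hlm hl hm
      rcases hcent l m hlm hm with h | h
      · refine ⟨?_, Or.inl fun h0 => h ((D.chart_eq_zero_iff hl).1 h0)⟩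
        filter_upwards [(D.chart l).open_source.mem_nhds hl,
          isOpen_ne.mem_nhds h] with y hy hyl
        exact D.mono_of_mem hy (Or.inl hyl)
      · refine ⟨?_, Or.inr h⟩
        filter_upwards [(D.chart l).open_source.mem_nhds hl] with y hy
        exact D.mono_of_mem hy (Or.inr h)
    have hi' := hmono i j hij hi hj
    have hj' := hmono j i (Ne.symm hij) hj hi
    have hd : ∀ l : S, x ∈ (D.chart l).source → (D.chart l x ≠ 0 ∨ k l = 0) → ∀ n : ℤ,
        (k l = 0 → n = 0) →
        DifferentiableAt ℂ (fun z => D.chart l ((D.chart j).symm z) ^ n) (D.chart j x) := by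
      intro l hl h n hn
      refine (D.holo l j x hl hj).zpow ?_
      rw [(D.chart j).left_inv hj]
      rcases h with h | h
      · exact Or.inl h
      · exact Or.inr (hn h).ge
    refine (((hd i hi hi'.2 (k i) id).mul (hd j hj hj'.2 (-k j) (by simp))).const_mul
      (holonomy b e (A i x) (A j x))).congr_of_eventuallyEq ?_
    filter_upwards [DiscAtlas.eventually_chart hj (hi'.1.and (hj'.1.and
      (eventually_joined ((D.chart i).open_source.inter (D.chart j).open_source) ⟨hi, hj⟩)))]
      with z hz
    set y := (D.chart j).symm z
    obtain ⟨-, -, -, h1, h2, δ, hδ⟩ := hz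
    have h3 := holonomy_mul b e (A i y) (A j y) (a y)
    have h4 : holonomy b e (A i y) (A j y) = holonomy b e (A i x) (A j x) := by
      rw [hA i x y δ fun t => (hδ t).1, hA j x y δ fun t => (hδ t).2, holonomy_trans]
    have h5 := holonomy_ne_zero b e (A j y) (a y)
    change D.frame b e A a k i y / D.frame b e A a k j y = holonomy b e (A i x) (A j x) *
      (D.chart i y ^ k i * D.chart j y ^ (-k j))
    rw [frame, frame, ← h3, h4, h1, h2, zpow_neg]
    field_simp

end Frame

end AdaptedAtlas

end KPCurve

/-! ### Multivalued sections built from a frame -/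

namespace KPCurve

open Metric

namespace AdaptedAtlas

variable {C : Type*} [TopologicalSpace C] [ChartedSpace ℂ C] {T S : Finset C}
  {D : AdaptedAtlas C T S} {pinf : C} {g : ℕ} {b : Module.Basis (Fin g ⊕ Fin g) ℤ (H1 C pinf)}
  {e : Fin g → ℂ} {A : S → (x : C) → Path.Homotopic.Quotient pinf x}
  {a : (x : C) → Path.Homotopic.Quotient pinf x} {k Δ : C →₀ ℤ} {w : C → ℂ}

variable (b e a k w) in
/-- The multivalued function with values `w` along the reference paths `a`, set to zero on the
support of `k`. -/
def multiSection (Δ : C →₀ ℤ) : MultiFun pinf Δ :=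
  fun x γ => holonomy b e γ (a x) * if k x = 0 then w x else 0

/-- Inserting the path class `A i y` between the actual path and the reference path turns `w` into
the local expression `frame * w`; the remaining holonomy is constant on the disc. -/
theorem multiSection_eq (hk : k.support ⊆ T)
    (hA : ∀ (i : S) (x y : C) (δ : Path x y), (∀ t, δ t ∈ (D.chart i).source) →
      A i y = (A i x).trans (Path.Homotopic.Quotient.mk δ))
    (i : S) {x : C} (γ : Path pinf x) (y : GoodPoint pinf Δ) (δ : Path x (y : C))
    (hδ : ∀ t, δ t ∈ (D.chart i).source) :
    multiSection b e a k w Δ y (Path.Homotopic.Quotient.mk (γ.trans δ)) =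
      holonomy b e (Path.Homotopic.Quotient.mk γ) (A i x) * D.chart i y ^ (-k i) *
        (D.frame b e A a k i y * w y) := by
  have hy : (y : C) ∈ (D.chart i).source := by simpa using hδ 1
  have h1 : holonomy b e (Path.Homotopic.Quotient.mk (γ.trans δ)) (a y) =
      holonomy b e (Path.Homotopic.Quotient.mk γ) (A i x) * holonomy b e (A i y) (a y) := by
    rw [← holonomy_mul b e _ (A i y) (a y), hA i x y δ hδ, Path.Homotopic.Quotient.mk_trans,
      holonomy_trans]
  rw [multiSection, h1, frame]
  by_cases hky : k y = 0
  · have h2 : (y : C) ≠ i ∨ k i = 0 := by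
      by_cases h : (y : C) = i
      · exact Or.inr (h ▸ hky)
      · exact Or.inl h
    rw [if_pos hky, D.mono_of_mem hy h2, zpow_neg]
    have h3 : D.chart i y ^ k i ≠ 0 := by
      rcases h2 with h | h
      · exact zpow_ne_zero _ fun h0 => h ((D.chart_eq_zero_iff hy).1 h0)
      · rw [h, zpow_zero]
        exact one_ne_zero
    field_simp
  -- At the centre both sides vanish: `multiSection` is set to zero there, and `0 ^ n = 0` for every
  -- nonzero integer `n`.
  · have h2 : (y : C) = i := D.eq_of_mem i y (hk (Finsupp.mem_support_iff.2 hky)) hy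
    have h3 : k i ≠ 0 := h2 ▸ hky
    rw [if_neg hky, (D.chart_eq_zero_iff hy).2 h2, zero_zpow _ (neg_ne_zero.2 h3)]
    ring

variable [T2Space C] [IsManifold 𝓘(ℂ, ℂ) ω C] {n : C → ℕ}

/-- The exponent `-k` splits as `-Δ + n`; the surplus `n` appears as a zero of the local expression.
-/
theorem hasLocalExpr_center (hk : k.support ⊆ T)
    (hA : ∀ (i : S) (x y : C) (δ : Path x y), (∀ t, δ t ∈ (D.chart i).source) →
      A i y = (A i x).trans (Path.Homotopic.Quotient.mk δ))
    (hn : ∀ x, k x = Δ x - n x)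
    (hw : ∀ i, ∀ x ∈ (D.chart i).source, x ≠ pinf →
      HoloAt (fun y => D.frame b e A a k i y * w y) x)
    (i : S) (hi : (i : C) ≠ pinf) (γ : Path pinf (i : C)) :
    ∃ c : ℂ, c ≠ 0 ∧ HasLocalExpr (multiSection b e a k w Δ) i γ (-Δ i)
      fun y => c * cchart (i : C) y ^ n i * (D.frame b e A a k i y * w y) := by
  obtain ⟨r, hr, hrx⟩ := D.chart_eq i
  refine ⟨holonomy b e (Path.Homotopic.Quotient.mk γ) (A i i) * r⁻¹ ^ (-k i),
    mul_ne_zero (holonomy_ne_zero _ _ _ _) (zpow_ne_zero _ (inv_ne_zero hr)),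
    (D.chart i).source ∩ {pinf}ᶜ, (D.chart i).open_source.inter isOpen_compl_singleton,
    ⟨D.center_mem i, hi⟩, fun y hy => D.source_subset i hy.1, fun y hy => ?_, fun y δ hδ => ?_⟩
  · exact ((HoloAt.const _).mul' ((holoAt_cchart (D.source_subset i hy.1)).pow' _)).mul'
      (hw i y hy.1 hy.2)
  · have hyi : (y : C) ∈ (D.chart i).source ∩ {pinf}ᶜ := by simpa using hδ 1
    rw [multiSection_eq hk hA i γ y δ fun t => (hδ t).1, hrx]
    change _ * (cchart (i : C) y * r⁻¹) ^ (-k i) * _ = _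
    have h1 : cchart (i : C) y ^ (-k i) = cchart (i : C) y ^ (-Δ i) * cchart (i : C) y ^ n i := by
      have h2 : -k i = -Δ i + n i := by
        rw [hn]
        ring
      by_cases h : (y : C) = i
      · have h3 : Δ (i : C) = 0 := h ▸ y.2.2
        rw [h2, h3, neg_zero, zero_add, zpow_zero, one_mul, zpow_natCast]
      · rw [h2, zpow_add₀ (cchart_ne_zero (D.source_subset i hyi.1) h), zpow_natCast]
    rw [mul_zpow, h1]
    ring

theorem multiSection_mem_sections (hk : k.support ⊆ T)
    (hA : ∀ (i : S) (x y : C) (δ : Path x y), (∀ t, δ t ∈ (D.chart i).source) →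
      A i y = (A i x).trans (Path.Homotopic.Quotient.mk δ))
    (hn : ∀ x, k x = Δ x - n x) (hΔ : Δ.support ⊆ T) (hp : pinf ∈ T)
    (hw : ∀ i, ∀ x ∈ (D.chart i).source, x ≠ pinf →
      HoloAt (fun y => D.frame b e A a k i y * w y) x)
    (hwp : ∀ i : S, (i : C) = pinf → ∃ (m : ℤ) (U : Set C) (F : C → ℂ), IsOpen U ∧ pinf ∈ U ∧
      (∀ y ∈ U, HoloAt F y) ∧
      ∀ y ∈ U, y ≠ pinf → D.frame b e A a k i y * w y = cchart pinf y ^ m * F y) :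
    multiSection b e a k w Δ ∈ sections b Δ e := by
  rw [mem_sections_iff]
  refine ⟨fun c x γ => ?_, fun x₀ γ₀ => ?_⟩
  · rw [multiSection, holonomy_loop, mul_assoc]
    rfl
  · obtain ⟨i, hi, -⟩ := D.cover x₀
    by_cases hxi : x₀ = i
    · subst hxi
      by_cases hip : (i : C) = pinf
      · obtain ⟨m, U, F, hU, hpU, hF, hFw⟩ := hwp i hip
        obtain ⟨r, hr, hrx⟩ := D.chart_eq i
        refine ⟨-k i + m, fun h => absurd hip h, fun y =>
          holonomy b e (Path.Homotopic.Quotient.mk γ₀) (A i i) * r⁻¹ ^ (-k i) * F y,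
          U ∩ (D.chart i).source, hU.inter (D.chart i).open_source, ⟨?_, D.center_mem i⟩,
          fun y hy => D.source_subset i hy.2,
          fun y hy => (HoloAt.const _).mul' (hF y hy.1), fun y δ hδ => ?_⟩
        · rw [hip]
          exact hpU
        · have hyi : (y : C) ∈ U ∩ (D.chart i).source := by simpa using hδ 1
          have h0 : cchart (i : C) y ≠ 0 := cchart_ne_zero (D.source_subset i hyi.2) (by
            rw [hip]
            exact y.2.1)
          rw [multiSection_eq hk hA i γ₀ y δ fun t => (hδ t).2, hFw y hyi.1 y.2.1, hrx]
          change _ * (cchart (i : C) y * r⁻¹) ^ (-k i) * _ = _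
          have hc : cchart pinf (y : C) = cchart (i : C) y := by rw [hip]
          rw [mul_zpow, zpow_add₀ h0, hc]
          ring
      · obtain ⟨c, -, h⟩ := hasLocalExpr_center hk hA hn hw i hip γ₀
        exact ⟨_, fun _ => rfl, _, h⟩
    -- A point of `T` lies only in its own disc, so off the centres neither `Δ` nor the marked point
    -- interferes.
    · have hxT : x₀ ∉ T := fun h => hxi (D.eq_of_mem i x₀ h hi)
      have hx0 : Δ x₀ = 0 := by
        by_contra h
        exact hxT (hΔ (Finsupp.mem_support_iff.2 h))
      have hxp : x₀ ≠ pinf := fun h => hxT (h ▸ hp)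
      refine ⟨0, fun _ => by rw [hx0, neg_zero], fun y =>
        holonomy b e (Path.Homotopic.Quotient.mk γ₀) (A i x₀) * D.chart i y ^ (-k i) *
        (D.frame b e A a k i y * w y),
        ((D.chart i).source ∩ ({(i : C)}ᶜ ∩ {pinf}ᶜ)) ∩ (chartAt ℂ x₀).source,
        ((D.chart i).open_source.inter (isOpen_compl_singleton.inter isOpen_compl_singleton)).inter
          (chartAt ℂ x₀).open_source,
        ⟨⟨hi, hxi, hxp⟩, mem_chart_source ℂ x₀⟩, fun y hy => hy.2, fun y hy => ?_,
        fun y δ hδ => ?_⟩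
      · exact ((HoloAt.const _).mul' (HoloAt.zpow' (D.mdifferentiable i y hy.1.1)
          (Or.inl fun h => hy.1.2.1 ((D.chart_eq_zero_iff hy.1.1).1 h)))).mul'
          (hw i y hy.1.1 hy.1.2.2)
      · rw [multiSection_eq hk hA i γ₀ y δ fun t => (hδ t).1.1, zpow_zero, one_mul]

end AdaptedAtlas

/-! ### Interpolation by sections -/

section Interpolation

theorem exists_twist {C : Type*} (Δ : C →₀ ℤ) (S' : Finset C) : ∃ (k : C →₀ ℤ) (n : C → ℕ),
    (∀ x, k x = Δ x - n x) ∧ (∀ x ∈ S', n x = 1) ∧ ∀ x ∉ S', n x = 0 := by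
  classical
  refine ⟨Δ - ∑ s ∈ S', Finsupp.single s 1, fun x => if x ∈ S' then 1 else 0, fun x => ?_,
    fun x hx => if_pos hx, fun x hx => if_neg hx⟩
  rw [Finsupp.sub_apply, Finsupp.finsetSum_apply]
  simp [Finsupp.single_apply]

variable {C : Type*} [TopologicalSpace C] [ChartedSpace ℂ C] [T2Space C] [CompactSpace C]
  [ConnectedSpace C] [IsManifold 𝓘(ℂ, ℂ) ω C] {pinf : C}

/-- There is a section with a prescribed nonzero branch at `s` and zeros at the points of `S'`,
provided that there is a function with poles only at the marked point that is not constant near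
`s`. -/
theorem exists_interpolating_section {g : ℕ} (b : Module.Basis (Fin g ⊕ Fin g) ℤ (H1 C pinf))
    (Δ : C →₀ ℤ) (e : Fin g → ℂ) {f : {x : C // x ≠ pinf} → ℂ} (hf : f ∈ functionRing pinf)
    {s : C} (hs : s ≠ pinf) (S' : Finset C) (hsS : s ∉ S') (hpS : pinf ∉ S')
    (hfs : ¬ ∀ᶠ x in 𝓝 s, zeroExtend f x = zeroExtend f s) :
    ∃ u ∈ sections b Δ e,
      (∀ γ : Path pinf s, ∃ F, HasLocalExpr u s γ (-Δ s) F ∧ F s ≠ 0) ∧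
      ∀ s' ∈ S', ∀ γ : Path pinf s', ∃ F, HasLocalExpr u s' γ (-Δ s') F ∧ F s' = 0 := by
  classical
  have : LocallyPathConnectedSpace C := ChartedSpace.locallyPathConnectedSpace ℂ C
  have : PathConnectedSpace C := pathConnectedSpace_iff_connectedSpace.2 inferInstance
  obtain ⟨k, n, hn, hn1, hn0⟩ := exists_twist Δ S'
  set T : Finset C := Δ.support ∪ (S' ∪ {s, pinf}) with hT
  have hΔT : Δ.support ⊆ T := Finset.subset_union_left
  have hS'T : S' ⊆ T := fun x hx => by simp [hT, hx]
  have hsT : s ∈ T := by simp [hT]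
  have hpT : pinf ∈ T := by simp [hT]
  have hkT : k.support ⊆ T := by
    intro x hx
    by_contra hxT
    have h1 : Δ x = 0 := by
      by_contra h
      exact hxT (hΔT (Finsupp.mem_support_iff.2 h))
    have h2 : n x = 0 := hn0 x fun h => hxT (hS'T h)
    exact Finsupp.mem_support_iff.1 hx (by rw [hn, h1, h2]; rfl)
  obtain ⟨S, ⟨D⟩⟩ := exists_adaptedAtlas T
  choose A hA using fun i : S => exists_path_classes (D.simplyConnected_source i) pinf
  set a : (x : C) → Path.Homotopic.Quotient pinf x := fun x =>
    Path.Homotopic.Quotient.mk (PathConnectedSpace.joined pinf x).somePath with ha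
  have hτ := D.isFrame b e a hkT hA
  set τ := D.frame b e A a k with hτd
  set i₀ : S := ⟨s, D.subset hsT⟩ with hi₀
  set f' : C → ℂ := zeroExtend f with hf'
  set c₀ : ℂ := f' s with hc₀
  have hball : ∀ z : ℂ, ‖z‖ < 3 → z ∈ (D.chart i₀).target := by
    intro z hz
    rw [D.target_eq, mem_ball_zero_iff]
    exact hz
  have hpi₀ : pinf ∉ (D.chart i₀).source := fun h => hs (D.eq_of_mem i₀ pinf hpT h).symm
  set f₀ : ℂ → ℂ := fun z => f' ((D.chart i₀).symm z) - c₀ with hf₀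
  have hf₀d : ∀ z : ℂ, ‖z‖ < 3 → DifferentiableAt ℂ f₀ z := by
    intro z hz
    have h1 := (D.chart i₀).map_target (hball z hz)
    have h2 := (D.mdifferentiableAt_iff h1 f').1 (holoAt_zeroExtend hf fun h => hpi₀ (h ▸ h1))
    rw [(D.chart i₀).right_inv (hball z hz)] at h2
    exact h2.sub_const c₀
  have hf₀a : AnalyticAt ℂ f₀ 0 := by
    refine Complex.analyticAt_iff_eventually_differentiableAt.2 ?_
    filter_upwards [ball_mem_nhds (0 : ℂ) (show (0 : ℝ) < 3 by norm_num)] with z hz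
    exact hf₀d z (mem_ball_zero_iff.1 hz)
  have hf₀0 : f₀ 0 = 0 := by
    change f' ((D.chart i₀).symm 0) - c₀ = 0
    rw [D.symm_zero i₀]
    exact sub_self _
  have hne : ∀ᶠ z in 𝓝[≠] 0, f₀ z ≠ 0 := by
    rcases hf₀a.eventually_eq_zero_or_eventually_ne_zero with h | h
    · exfalso
      apply hfs
      have ht : Filter.Tendsto (D.chart i₀) (𝓝 s) (𝓝 0) := by
        have := (D.chart i₀).continuousAt (D.center_mem i₀)
        rwa [ContinuousAt, D.chart_center] at this
      filter_upwards [ht.eventually h, (D.chart i₀).open_source.mem_nhds (D.center_mem i₀)]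
        with x hx hxs
      simp only [hf₀, (D.chart i₀).left_inv hxs] at hx
      exact sub_eq_zero.1 hx
    · exact h
  obtain ⟨ε, hε, hεne⟩ := Metric.mem_nhdsWithin_iff.1 hne
  -- Powers of the global function `f - c₀`, rather than of a coordinate, so that the pole can later
  -- be removed by a global multiplication.
  set q : ℕ → ℂ → ℂ := fun m z => (f₀ z ^ (m + 1))⁻¹ with hq
  obtain ⟨c, w, H, hc, hw, hH, hwH⟩ := DiscAtlas.exists_section_with_principal_part
    (D := D.toDiscAtlas) hτ i₀ q (ε := min ε 3) (lt_min hε (by norm_num)) (by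
      intro m z hz
      have h1 := mem_ball_zero_iff.1 hz.1
      have h2 : f₀ z ≠ 0 := hεne ⟨mem_ball_zero_iff.2 (h1.trans_le (min_le_left _ _)), hz.2⟩
      exact (((hf₀d z (h1.trans_le (min_le_right _ _))).pow _).inv
        (pow_ne_zero _ h2)).differentiableWithinAt)
  have hcs : c.support.Nonempty := Finsupp.support_nonempty_iff.2 hc
  set m := c.support.max' hcs with hm
  have hcm : c m ≠ 0 := Finsupp.mem_support_iff.1 (Finset.max'_mem _ _)
  have hle : ∀ l ∈ c.support, l ≤ m := fun l hl => Finset.le_max' _ _ hl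
  -- The product of `f₀ ^ (m + 1)` with the local expression. At the zero of `f₀` only the term of
  -- the top index `m` survives.
  set P : ℂ → ℂ := fun z => (∑ l ∈ c.support, c l * f₀ z ^ (m - l)) + f₀ z ^ (m + 1) * H z with hP
  have hP0 : P 0 = c m := by
    simp only [hP, hf₀0]
    rw [zero_pow (Nat.succ_ne_zero m), zero_mul, add_zero, Finset.sum_eq_single m]
    · simp
    · intro l hl hlm
      have := hle l hl
      rw [zero_pow (by omega), mul_zero]
    · intro h
      rw [Finsupp.notMem_support_iff.1 h, zero_mul]
  have hPd : DifferentiableAt ℂ P 0 := by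
    have h1 := hf₀d 0 (by simp)
    exact (DifferentiableAt.fun_sum fun l _ => (h1.pow _).const_mul _).add
      ((h1.pow _).mul hH.self_of_nhds)
  -- The singularity at `s` is removable; the value put there is the limit prescribed by `P 0 = c
  -- m`.
  set w' : C → ℂ := Function.update (fun x => (f' x - c₀) ^ (m + 1) * w x) s (c m / τ i₀ s)
    with hw'
  have hw's : w' s = c m / τ i₀ s := Function.update_self _ _ _
  have hw'n : ∀ x, x ≠ s → w' x = (f' x - c₀) ^ (m + 1) * w x := fun x hx =>
    Function.update_of_ne hx _ _
  have hwh : ∀ j, ∀ x ∈ (D.chart j).source, x ≠ s → HoloAt (fun y => τ j y * w y) x := by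
    intro j x hx hxs
    refine (D.mdifferentiableAt_iff hx _).2 (hw j x hx ?_)
    rwa [D.symm_zero i₀]
  have hw'h : ∀ j, ∀ x ∈ (D.chart j).source, x ≠ pinf → HoloAt (fun y => τ j y * w' y) x := by
    intro j x hx hxp
    by_cases hxs : x = s
    · subst hxs
      have hj : j = i₀ := Subtype.ext (D.eq_of_mem j x hsT hx).symm
      subst hj
      refine (D.mdifferentiableAt_iff hx _).2 ?_
      have hx0 : D.chart i₀ x = 0 := D.chart_center i₀
      rw [hx0]
      refine hPd.congr_of_eventuallyEq ?_
      rw [Filter.EventuallyEq, ← nhdsNE_sup_pure, Filter.eventually_sup]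
      constructor
      · filter_upwards [hwH, hne, nhdsWithin_le_nhds (ball_mem_nhds (0 : ℂ)
          (show (0 : ℝ) < 3 by norm_num)), self_mem_nhdsWithin] with z hz hz0 hz3 hzne
        have hzt := hball z (mem_ball_zero_iff.1 hz3)
        have hsz : (D.chart i₀).symm z ≠ x := by
          intro h
          apply hzne
          rw [Set.mem_singleton_iff, ← (D.chart i₀).right_inv hzt, h, hx0]
        rw [hw'n _ hsz, mul_left_comm, hz]
        simp only [hP, hq, Finsupp.sum, mul_add, Finset.mul_sum]
        congr 1
        refine Finset.sum_congr rfl fun l hl => ?_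
        have : f₀ z ^ (m + 1) = f₀ z ^ (m - l) * f₀ z ^ (l + 1) := by
          rw [← pow_add]
          congr 1
          have := hle l hl
          omega
        change f₀ z ^ (m + 1) * _ = _
        rw [this]
        field_simp
      · rw [Filter.eventually_pure, D.symm_zero i₀, hP0]
        change τ i₀ x * w' x = _
        rw [hw's]
        have := hτ.ne_zero i₀ x
        field_simp
    · have h1 := hwh j x hx hxs
      have h2 := ((holoAt_zeroExtend hf hxp).sub' (HoloAt.const c₀)).pow' (m + 1)
      refine (h2.mul' h1).congr' ?_
      filter_upwards [isOpen_ne.mem_nhds hxs] with y hy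
      rw [hw'n y hy]
      change _ = (f' y - c₀) ^ (m + 1) * _
      ring
  refine ⟨AdaptedAtlas.multiSection b e a k w' Δ,
    AdaptedAtlas.multiSection_mem_sections hkT hA hn hΔT hpT hw'h ?_, ?_, ?_⟩
  -- At the marked point `τ w` is holomorphic, and the factor `(f - c₀) ^ (m + 1)` has a pole of
  -- order at most `N (m + 1)`.
  · intro i hip
    obtain ⟨N, U, F, hU, hpU, hUs, hF, hFf⟩ := exists_pole_order hf
    refine ⟨-((N * (m + 1) : ℕ) : ℤ), (U ∩ (D.chart i).source) ∩ {s}ᶜ,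
      fun y => (F y - c₀ * cchart pinf y ^ N) ^ (m + 1) * (τ i y * w y),
      (hU.inter (D.chart i).open_source).inter isOpen_compl_singleton,
      ⟨⟨hpU, hip ▸ D.center_mem i⟩, hs.symm⟩, fun y hy => ?_, fun y hy hyp => ?_⟩
    · exact (((hF y hy.1.1).sub' ((HoloAt.const c₀).mul'
        ((holoAt_cchart (hUs hy.1.1)).pow' N))).pow' _).mul' (hwh i y hy.1.2 hy.2)
    · have h0 := cchart_ne_zero (hUs hy.1.1) hyp
      rw [hw'n y hy.2, hf', hFf y hy.1.1 hyp, zpow_neg, zpow_neg, zpow_natCast, zpow_natCast,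
        pow_mul]
      have h1 : (cchart pinf y ^ N)⁻¹ * F y - c₀ =
          (cchart pinf y ^ N)⁻¹ * (F y - c₀ * cchart pinf y ^ N) := by
        field_simp
      rw [h1, mul_pow, inv_pow]
      ring
  · intro γ
    obtain ⟨c', hc', h⟩ := AdaptedAtlas.hasLocalExpr_center hkT hA hn hw'h i₀ hs γ
    refine ⟨_, h, ?_⟩
    have h1 : n (i₀ : C) = 0 := hn0 s hsS
    change c' * cchart s s ^ n (i₀ : C) * (τ i₀ s * w' s) ≠ 0
    rw [h1, pow_zero, mul_one, hw's, mul_div_cancel₀ _ (hτ.ne_zero i₀ s)]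
    exact mul_ne_zero hc' hcm
  · intro s' hs' γ
    have hs'p : s' ≠ pinf := fun h => hpS (h ▸ hs')
    obtain ⟨c', hc', h⟩ := AdaptedAtlas.hasLocalExpr_center hkT hA hn hw'h
      ⟨s', D.subset (hS'T hs')⟩ hs'p γ
    refine ⟨_, h, ?_⟩
    simp only [hn1 s' hs', cchart_self]
    ring

end Interpolation

end KPCurve

/-! ### Punctured neighbourhoods -/

namespace KPCurve

section PuncturedNhds

theorem isOpen_setOf_eventually_nhdsNE {X : Type*} [TopologicalSpace X] [T1Space X] (p : X → Prop) :
    IsOpen {x | ∀ᶠ y in 𝓝[≠] x, p y} := by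
  refine isOpen_iff_mem_nhds.2 fun x hx => ?_
  have h1 : ∀ᶠ y in 𝓝[≠] x, ∀ᶠ y' in 𝓝[≠] y, p y' := by
    have h2 := eventually_eventually_nhdsWithin.2 hx
    filter_upwards [h2, self_mem_nhdsWithin] with y hy hyx
    rw [isOpen_compl_singleton.nhdsWithin_eq hyx] at hy
    exact hy.filter_mono nhdsWithin_le_nhds
  change ∀ᶠ y in 𝓝 x, ∀ᶠ y' in 𝓝[≠] y, p y'
  rw [← nhdsNE_sup_pure, Filter.eventually_sup]
  exact ⟨h1, hx⟩

theorem eventually_nhdsNE_notMem {X : Type*} [TopologicalSpace X] [T1Space X] {s : Set X}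
    (hs : s.Finite) (x : X) : ∀ᶠ y in 𝓝[≠] x, y ∉ s := by
  rw [eventually_nhdsWithin_iff]
  filter_upwards [(hs.subset (Set.sdiff_subset (t := {x}))).isClosed.isOpen_compl.mem_nhds
    (show x ∈ (s \ {x})ᶜ from fun h => h.2 rfl)] with y hy hyx h
  exact hy ⟨h, hyx⟩

end PuncturedNhds

/-! ### The identity theorem -/

section Identity

variable {C : Type*} [TopologicalSpace C] [ChartedSpace ℂ C]

theorem nhdsNE_neBot (x : C) : (𝓝[≠] x).NeBot := by
  refine ⟨fun h => ?_⟩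
  have h1 : IsOpen {x} := isOpen_singleton_iff_punctured_nhds x |>.2 h
  have h2 := (chartAt ℂ x).isOpen_image_of_subset_source h1
    (Set.singleton_subset_iff.2 (mem_chart_source ℂ x))
  rw [Set.image_singleton] at h2
  exact not_isOpen_singleton _ h2

variable [IsManifold 𝓘(ℂ, ℂ) ω C]

theorem eventually_eq_zero_or_eventually_ne_zero {H : C → ℂ} {x : C}
    (hH : ∀ᶠ y in 𝓝 x, HoloAt H y) :
    (∀ᶠ y in 𝓝 x, H y = 0) ∨ ∀ᶠ y in 𝓝[≠] x, H y ≠ 0 := by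
  have hx := mem_chart_source ℂ x
  set φ := chartAt ℂ x
  have hc : Filter.Tendsto φ.symm (𝓝 (φ x)) (𝓝 x) := φ.tendsto_symm hx
  have ha : AnalyticAt ℂ (fun w => H (φ.symm w)) (φ x) := by
    refine Complex.analyticAt_iff_eventually_differentiableAt.2 ?_
    filter_upwards [hc.eventually hH, φ.open_target.mem_nhds (φ.map_source hx)] with w hw hwt
    exact mdifferentiableAt_iff_differentiableAt.1
      (hw.comp w (mdifferentiableAt_atlas_symm (chart_mem_atlas ℂ x) hwt))
  have hφ : Filter.Tendsto φ (𝓝 x) (𝓝 (φ x)) := φ.continuousAt hx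
  rcases ha.eventually_eq_zero_or_eventually_ne_zero with h | h
  · left
    filter_upwards [hφ.eventually h, φ.open_source.mem_nhds hx] with y hy hys
    rwa [φ.left_inv hys] at hy
  · right
    rw [eventually_nhdsWithin_iff] at h ⊢
    filter_upwards [hφ.eventually h, φ.open_source.mem_nhds hx] with y hy hys hne
    rw [φ.left_inv hys] at hy
    exact hy fun h => hne (φ.injOn hys hx h)

variable [T2Space C] {pinf : C} {f : {x : C // x ≠ pinf} → ℂ}

/-- Isolated zeros of `f - c`; at the marked point these are the zeros of `F - c t^N`, where `f =
t^{-N} F` with `t` the centered chart. -/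
theorem eventually_eq_or_eventually_ne (hf : f ∈ functionRing pinf) (c : ℂ) (x : C) :
    (∀ᶠ y in 𝓝[≠] x, zeroExtend f y = c) ∨ ∀ᶠ y in 𝓝[≠] x, zeroExtend f y ≠ c := by
  by_cases hx : x = pinf
  · subst hx
    obtain ⟨N, U, F, hU, hxU, hUs, hF, h⟩ := exists_pole_order hf
    have h1 : ∀ y ∈ U, y ≠ x → (zeroExtend f y = c ↔ F y - c * cchart x y ^ N = 0) := by
      intro y hy hyx
      have h0 := pow_ne_zero N (cchart_ne_zero (hUs hy) hyx)
      rw [h y hy hyx, zpow_neg, zpow_natCast, inv_mul_eq_div, div_eq_iff h0, sub_eq_zero]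
    have h2 : ∀ᶠ y in 𝓝[≠] x, zeroExtend f y = c ↔ F y - c * cchart x y ^ N = 0 := by
      filter_upwards [nhdsWithin_le_nhds (hU.mem_nhds hxU), self_mem_nhdsWithin] with y hy hyx
      exact h1 y hy hyx
    have h3 : ∀ᶠ y in 𝓝 x, HoloAt (fun y => F y - c * cchart x y ^ N) y := by
      filter_upwards [hU.mem_nhds hxU] with y hy
      exact (hF y hy).sub' ((HoloAt.const c).mul' ((holoAt_cchart (hUs hy)).pow' N))
    rcases eventually_eq_zero_or_eventually_ne_zero h3 with h4 | h4
    · left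
      filter_upwards [h2, h4.filter_mono nhdsWithin_le_nhds] with y hy hy0 using hy.2 hy0
    · right
      filter_upwards [h2, h4] with y hy hy0 using fun h => hy0 (hy.1 h)
  · have h3 : ∀ᶠ y in 𝓝 x, HoloAt (fun y => zeroExtend f y - c) y := by
      filter_upwards [isOpen_ne.mem_nhds hx] with y hy
      exact (holoAt_zeroExtend hf hy).sub' (HoloAt.const c)
    rcases eventually_eq_zero_or_eventually_ne_zero h3 with h4 | h4
    · left
      filter_upwards [h4.filter_mono nhdsWithin_le_nhds] with y hy using sub_eq_zero.1 hy
    · right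
      filter_upwards [h4] with y hy using fun h => hy (sub_eq_zero.2 h)

/-- The set of points with `f = c` on a punctured neighbourhood is clopen in all of `C`. Punctured
neighbourhoods treat the marked point like any other, so connectedness of its complement is not
needed. -/
theorem eq_of_eventually_eq [ConnectedSpace C] (hf : f ∈ functionRing pinf) {c : ℂ} {s : C}
    (h : ∀ᶠ y in 𝓝 s, zeroExtend f y = c) {x : C} (hx : x ≠ pinf) : zeroExtend f x = c := by
  have h1 : IsClopen {x | ∀ᶠ y in 𝓝[≠] x, zeroExtend f y = c} := by
    refine ⟨⟨?_⟩, isOpen_setOf_eventually_nhdsNE _⟩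
    convert isOpen_setOf_eventually_nhdsNE fun y : C => zeroExtend f y ≠ c using 1
    ext x
    refine ⟨fun h => (eventually_eq_or_eventually_ne hf c x).resolve_left h,
      fun (h : ∀ᶠ y in 𝓝[≠] x, zeroExtend f y ≠ c)
        (h' : ∀ᶠ y in 𝓝[≠] x, zeroExtend f y = c) => ?_⟩
    have := nhdsNE_neBot x
    obtain ⟨y, hy, hy'⟩ := (h.and h').exists
    exact hy hy'
  have h2 := h1.eq_univ ⟨s, h.filter_mono nhdsWithin_le_nhds⟩
  have h3 : ∀ᶠ y in 𝓝[≠] x, zeroExtend f y = c := h2.ge (Set.mem_univ x)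
  have := nhdsNE_neBot x
  have h4 : Filter.Tendsto (zeroExtend f) (𝓝[≠] x) (𝓝 (zeroExtend f x)) :=
    (holoAt_zeroExtend hf hx).continuousAt.tendsto.mono_left nhdsWithin_le_nhds
  exact tendsto_nhds_unique_of_eventuallyEq h4 tendsto_const_nhds h3

end Identity

/-! ### Coordinate expressions of sections -/

section CoordExpr

variable {C : Type*} [TopologicalSpace C] {pinf : C} {Δ : C →₀ ℤ}
  {z : OpenPartialHomeomorph C ℂ} {σ : ℂ → ℂ}

theorem eventually_goodPoint {x₀ : C} (hx₀ : x₀ ∈ z.source) :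
    ∀ᶠ w in 𝓝[≠] (z x₀), w ∈ z.target ∧ z.symm w ≠ pinf ∧ Δ (z.symm w) = 0 := by
  have h1 : (z '' ({pinf} ∪ Δ.support)).Finite :=
    ((Set.finite_singleton pinf).union (Finset.finite_toSet _)).image z
  filter_upwards [eventually_nhdsNE_notMem h1 (z x₀),
    nhdsWithin_le_nhds (z.open_target.mem_nhds (z.map_source hx₀))] with w hw hwt
  refine ⟨hwt, fun h => hw ⟨z.symm w, Or.inl h, z.right_inv hwt⟩, ?_⟩
  by_contra h
  exact hw ⟨z.symm w, Or.inr (by simpa using h), z.right_inv hwt⟩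

variable [ChartedSpace ℂ C]

variable (Δ z σ) in
/-- The function `σ` has divisor `Δ` on the domain of `z`: multiplied by the power of the centered
chart at `x₀` with exponent `-Δ x₀`, it becomes analytic and nonzero. -/
def HasFactors : Prop :=
  ∀ x₀ ∈ z.source, ∃ l : ℂ → ℂ, AnalyticAt ℂ l (z x₀) ∧ l (z x₀) ≠ 0 ∧
    ∀ᶠ w in 𝓝 (z x₀), (w ≠ z x₀ ∨ Δ x₀ = 0) → cchart x₀ (z.symm w) ^ (-Δ x₀) * σ w = l w

theorem holoAt_comp_symm [IsManifold 𝓘(ℂ, ℂ) ω C] (hz : z ∈ IsManifold.maximalAtlas 𝓘(ℂ, ℂ) ω C)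
    {F : C → ℂ} {w : ℂ} (hw : w ∈ z.target) (hF : HoloAt F (z.symm w)) :
    DifferentiableAt ℂ (fun w => F (z.symm w)) w :=
  mdifferentiableAt_iff_differentiableAt.1 (hF.comp w (mdifferentiableAt_symm_of_mem_maximalAtlas
    (IsManifold.maximalAtlas_subset_of_le (by simp) hz) hw))

theorem analyticAt_comp_symm [IsManifold 𝓘(ℂ, ℂ) ω C]
    (hz : z ∈ IsManifold.maximalAtlas 𝓘(ℂ, ℂ) ω C) {F : C → ℂ} {U : Set C} (hU : IsOpen U)
    (hF : ∀ y ∈ U, HoloAt F y) {w : ℂ} (hw : w ∈ z.target) (hwU : z.symm w ∈ U) :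
    AnalyticAt ℂ (fun w => F (z.symm w)) w := by
  refine Complex.analyticAt_iff_eventually_differentiableAt.2 ?_
  filter_upwards [z.open_target.mem_nhds hw, (z.continuousAt_symm hw).preimage_mem_nhds
    (hU.mem_nhds hwU)] with w' hw' hwU'
  exact holoAt_comp_symm hz hw' (hF _ hwU')

/-- As `σ²` is the coefficient of a form with divisor `2Δ`, the order of `σ` is `Δ`; the centered
chart has a simple zero in the coordinate, so the two powers cancel. -/
theorem hasFactors [IsManifold 𝓘(ℂ, ℂ) ω C] (hz : z ∈ IsManifold.maximalAtlas 𝓘(ℂ, ℂ) ω C)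
    {η : OneForm C} (hη : HasDivisor η (2 • Δ)) (hσ : IsSqrtCoeff η z σ) : HasFactors Δ z σ := by
  intro x₀ hx₀
  have hw₀ := z.map_source hx₀
  set w₀ := z x₀ with hw₀d
  have hsymm : z.symm w₀ = x₀ := z.left_inv hx₀
  -- the centered chart in the coordinate has a simple zero
  set φ := chartAt ℂ x₀ with hφ
  have hφs : x₀ ∈ φ.source := mem_chart_source ℂ x₀
  set h : ℂ → ℂ := fun w => cchart x₀ (z.symm w) with hh
  have hha : AnalyticAt ℂ h w₀ := analyticAt_comp_symm hz φ.open_source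
    (fun y hy => holoAt_cchart hy) hw₀ (by rwa [hsymm])
  have hh0 : h w₀ = 0 := by
    rw [hh]
    simp only [hsymm, cchart_self]
  have hk : AnalyticAt ℂ (dslope h w₀) w₀ := by
    obtain ⟨p, hp⟩ := hha
    exact hp.has_fpower_series_dslope_fslope.analyticAt
  have hk0 : dslope h w₀ w₀ ≠ 0 := by
    rw [dslope_same]
    -- Composed with the transition map back to the chart, `h` becomes `v - φ x₀`, whose derivative
    -- is `1`; by the chain rule the derivative of `h` cannot vanish.
    intro hd
    have hφx := φ.map_source hφs
    have h1 : DifferentiableAt ℂ (fun v => z (φ.symm v)) (φ x₀) :=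
      mdifferentiableAt_iff_differentiableAt.1 (MDifferentiableAt.comp (φ x₀)
        (by
          rw [φ.left_inv hφs]
          exact mdifferentiableAt_of_mem_maximalAtlas
            (IsManifold.maximalAtlas_subset_of_le (by simp) hz) hx₀)
        (mdifferentiableAt_atlas_symm (chart_mem_atlas ℂ x₀) hφx))
    have h2 : (fun v => h (z (φ.symm v))) =ᶠ[𝓝 (φ x₀)] fun v => v - φ x₀ := by
      filter_upwards [φ.open_target.mem_nhds hφx, (φ.continuousAt_symm hφx).preimage_mem_nhds
        (z.open_source.mem_nhds (by rwa [φ.left_inv hφs]))] with v hv hvz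
      simp only [hh]
      rw [z.left_inv hvz, cchart, φ.right_inv hv]
    have h3 : HasDerivAt h 0 (z (φ.symm (φ x₀))) := by
      rw [φ.left_inv hφs, ← hd]
      exact hha.differentiableAt.hasDerivAt
    have h4 := h3.comp (φ x₀) h1.hasDerivAt
    have h5 : HasDerivAt (fun v => v - φ x₀) 1 (φ x₀) := (hasDerivAt_id _).sub_const _
    have h6 := (h5.congr_of_eventuallyEq h2).unique h4
    simp at h6
  -- the order of the square root
  obtain ⟨-, hord⟩ := hη z hz x₀ hx₀
  have hsq : coeff η z =ᶠ[𝓝[≠] w₀] σ ^ 2 := by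
    filter_upwards [nhdsWithin_le_nhds (z.open_target.mem_nhds hw₀)] with w hw
    exact (hσ.2 w hw).symm
  have hσm : MeromorphicNFAt σ w₀ := hσ.1 hw₀
  rw [meromorphicOrderAt_congr hsq, meromorphicOrderAt_pow hσm.meromorphicAt] at hord
  rcases hσm with h0 | ⟨n, g, hg, hg0, hgσ⟩
  · exfalso
    have : meromorphicOrderAt σ w₀ = ⊤ :=
      meromorphicOrderAt_eq_top_iff.2 (h0.filter_mono nhdsWithin_le_nhds)
    rw [this] at hord
    exact WithTop.coe_ne_top (hord.symm.trans (WithTop.mul_top (by decide)))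
  · have hn : meromorphicOrderAt σ w₀ = n :=
      (meromorphicOrderAt_eq_int_iff (hσ.1 hw₀).meromorphicAt).2
        ⟨g, hg, hg0, hgσ.filter_mono nhdsWithin_le_nhds⟩
    rw [hn] at hord
    have hnΔ : n = Δ x₀ := by
      have : (2 : ℤ) * n = 2 * Δ x₀ := by
        have h' : (((2 : ℤ) * n : ℤ) : WithTop ℤ) = ((2 * Δ x₀ : ℤ) : WithTop ℤ) := by
          rw [WithTop.coe_mul]
          simpa using hord
        exact_mod_cast h'
      omega
    subst hnΔ
    refine ⟨fun w => dslope h w₀ w ^ (-Δ x₀) * g w, (hk.zpow hk0).mul hg,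
      mul_ne_zero (zpow_ne_zero _ hk0) hg0, ?_⟩
    filter_upwards [hgσ] with w hw hor
    have hσw : σ w = (w - w₀) ^ Δ x₀ * g w := by simpa using hw
    rw [hσw]
    change h w ^ (-Δ x₀) * _ = _
    have h7 : h w = (w - w₀) * dslope h w₀ w := by
      have := sub_smul_dslope h w₀ w
      rw [hh0, sub_zero] at this
      exact this.symm
    rcases hor with hne | h0
    · rw [h7, mul_zpow, zpow_neg]
      have : (w - w₀) ^ Δ x₀ ≠ 0 := zpow_ne_zero _ (sub_ne_zero.2 hne)
      field_simp
    · rw [h0]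
      simp

end CoordExpr

end KPCurve

namespace KPCurve

/-! ### Existence, uniqueness and values of coordinate expressions -/

section Values

variable {C : Type*} [TopologicalSpace C] {pinf : C} {Δ : C →₀ ℤ}
  {z : OpenPartialHomeomorph C ℂ} {σ : ℂ → ℂ}

/-- Near `w₀`, the branch of `u · σ` along paths inside the domain of `z` is given by `G`. -/
def IsGerm (z : OpenPartialHomeomorph C ℂ) (σ : ℂ → ℂ) (u : MultiFun pinf Δ) (w₀ : ℂ)
    (G : ℂ → ℂ) : Prop :=
  ∀ᶠ w in 𝓝 w₀, ∀ (x : GoodPoint pinf Δ) (γ : Path pinf (x : C)), (∀ t, γ t ∈ z.source) →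
    z x = w → u x (Path.Homotopic.Quotient.mk γ) * σ w = G w

theorem eventually_eq_of_isGerm (hz_mem : pinf ∈ z.source) (hz_sc : SimplyConnectedSpace z.source)
    {u : MultiFun pinf Δ} {x₀ : C} (hx₀ : x₀ ∈ z.source) {G f : ℂ → ℂ}
    (hG : IsGerm z σ u (z x₀) G)
    (hf : ∀ (x : GoodPoint pinf Δ) (γ : Path pinf (x : C)), (∀ t, γ t ∈ z.source) →
      f (z x) = u x (Path.Homotopic.Quotient.mk γ) * σ (z x)) :
    ∀ᶠ w in 𝓝[≠] (z x₀), f w = G w := by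
  filter_upwards [eventually_goodPoint (pinf := pinf) (Δ := Δ) hx₀,
    hG.filter_mono nhdsWithin_le_nhds] with w ⟨hwt, hw⟩ hwG
  obtain ⟨γ, hγ⟩ := exists_path_of_simplyConnected hz_sc hz_mem (z.map_target hwt)
  have h1 := hf ⟨z.symm w, hw⟩ γ hγ
  have h2 := hwG ⟨z.symm w, hw⟩ γ hγ (z.right_inv hwt)
  rw [z.right_inv hwt] at h1
  rw [h1, h2]

theorem eq_zero_iff_of_mem (hz_mem : pinf ∈ z.source) (hz_zero : z pinf = 0) {x : C}
    (hx : x ∈ z.source) : z x = 0 ↔ x = pinf :=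
  ⟨fun h => z.injOn hx hz_mem (h.trans hz_zero.symm), fun h => h ▸ hz_zero⟩

theorem coord_mem (hz_mem : pinf ∈ z.source) (hz_zero : z pinf = 0) {x : C}
    (hx : x ∈ z.source) (hxp : x ≠ pinf) : z x ∈ z.target \ {0} :=
  ⟨z.map_source hx, fun h => hxp ((eq_zero_iff_of_mem hz_mem hz_zero hx).1 h)⟩

namespace IsCoordExpr

variable {u v : MultiFun pinf Δ} {f f' : ℂ → ℂ}

/-- Good points fill a punctured neighbourhood, so continuity determines the value even on the
support of `Δ`, where the section itself is not evaluated. -/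
theorem value_eq (hz_mem : pinf ∈ z.source) (hz_zero : z pinf = 0)
    (hz_sc : SimplyConnectedSpace z.source) (hf : IsCoordExpr z σ u f) {x₀ : C}
    (hx₀ : x₀ ∈ z.source) (hxp : x₀ ≠ pinf) {G : ℂ → ℂ} (hGa : AnalyticAt ℂ G (z x₀))
    (hG : IsGerm z σ u (z x₀) G) : f (z x₀) = G (z x₀) := by
  have h1 := eventually_eq_of_isGerm hz_mem hz_sc hx₀ hG hf.2
  have h2 := (hf.1 _ (coord_mem hz_mem hz_zero hx₀ hxp)).continuousAt
  exact ((h2.eventuallyEq_nhds_iff_eventuallyEq_nhdsNE hGa.continuousAt).1 h1).self_of_nhds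

theorem isGerm (hf : IsCoordExpr z σ u f) (w₀ : ℂ) : IsGerm z σ u w₀ f :=
  Filter.Eventually.of_forall fun w x γ hγ hxw => by rw [← hxw, hf.2 x γ hγ]

theorem unique (hz_mem : pinf ∈ z.source) (hz_zero : z pinf = 0)
    (hz_sc : SimplyConnectedSpace z.source) (hf : IsCoordExpr z σ u f)
    (hf' : IsCoordExpr z σ u f') {x₀ : C} (hx₀ : x₀ ∈ z.source) (hxp : x₀ ≠ pinf) :
    f (z x₀) = f' (z x₀) :=
  hf.value_eq hz_mem hz_zero hz_sc hx₀ hxp (hf'.1 _ (coord_mem hz_mem hz_zero hx₀ hxp))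
    (hf'.isGerm _)

theorem add (hf : IsCoordExpr z σ u f) (hf' : IsCoordExpr z σ v f') :
    IsCoordExpr z σ (u + v) fun w => f w + f' w := by
  refine ⟨fun w hw => (hf.1 w hw).add (hf'.1 w hw), fun x γ hγ => ?_⟩
  change f (z x) + f' (z x) = (u x _ + v x _) * _
  rw [hf.2 x γ hγ, hf'.2 x γ hγ, add_mul]

theorem smul (c : ℂ) (hf : IsCoordExpr z σ u f) : IsCoordExpr z σ (c • u) fun w => c * f w := by
  refine ⟨fun w hw => analyticAt_const.mul (hf.1 w hw), fun x γ hγ => ?_⟩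
  change c * f (z x) = (c * u x _) * _
  rw [hf.2 x γ hγ, mul_assoc]

theorem sum {ι : Type*} {s : Finset ι} (hs : s.Nonempty) {u : ι → MultiFun pinf Δ}
    {f : ι → ℂ → ℂ} (hf : ∀ i ∈ s, IsCoordExpr z σ (u i) (f i)) :
    IsCoordExpr z σ (∑ i ∈ s, u i) fun w => ∑ i ∈ s, f i w := by
  induction hs using Finset.Nonempty.cons_induction with
  | singleton i => simpa using hf i
  | cons i s hi hs ih =>
    simp only [Finset.sum_cons]
    exact (hf i (by simp)).add (ih fun j hj => hf j (by simp [hj]))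

theorem mulSection [ChartedSpace ℂ C] [T2Space C] [IsManifold 𝓘(ℂ, ℂ) ω C]
    (hz : z ∈ IsManifold.maximalAtlas 𝓘(ℂ, ℂ) ω C) (hz_zero : z pinf = 0)
    {h : {x : C // x ≠ pinf} → ℂ} (hh : h ∈ functionRing pinf) (hf : IsCoordExpr z σ u f) :
    IsCoordExpr z σ (mulSection h u) fun w => zeroExtend h (z.symm w) * f w := by
  refine ⟨fun w hw => ?_, fun x γ hγ => ?_⟩
  · refine (analyticAt_comp_symm hz isOpen_ne (fun y hy => holoAt_zeroExtend hh hy) hw.1 ?_).mul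
      (hf.1 w hw)
    intro h0
    apply hw.2
    rw [Set.mem_singleton_iff, ← z.right_inv hw.1, h0, hz_zero]
  · have hx : (x : C) ∈ z.source := by simpa using hγ 1
    change zeroExtend h (z.symm (z x)) * f (z x) = _
    rw [z.left_inv hx, zeroExtend_of_ne h x.2.1, hf.2 x γ hγ, ← mul_assoc]
    rfl

end IsCoordExpr

variable [ChartedSpace ℂ C] [IsManifold 𝓘(ℂ, ℂ) ω C]

/-- The germ is the unit from `HasFactors` times `F`, so it vanishes exactly when `F` does. -/
theorem exists_germ (hz : z ∈ IsManifold.maximalAtlas 𝓘(ℂ, ℂ) ω C)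
    (hz_sc : SimplyConnectedSpace z.source) (hl : HasFactors Δ z σ) {u : MultiFun pinf Δ} {x₀ : C}
    (hx₀ : x₀ ∈ z.source) {γ₀ : Path pinf x₀} (hγ₀ : ∀ t, γ₀ t ∈ z.source) {F : C → ℂ}
    (hF : HasLocalExpr u x₀ γ₀ (-Δ x₀) F) :
    ∃ G, AnalyticAt ℂ G (z x₀) ∧ (G (z x₀) = 0 ↔ F x₀ = 0) ∧ IsGerm z σ u (z x₀) G := by
  have : LocallyPathConnectedSpace C := ChartedSpace.locallyPathConnectedSpace ℂ C
  obtain ⟨U, hU, hxU, -, hFU, huF⟩ := hF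
  obtain ⟨l, hla, hl0, hlσ⟩ := hl x₀ hx₀
  have hw₀ := z.map_source hx₀
  have hs := z.left_inv hx₀
  refine ⟨fun w => l w * F (z.symm w), hla.mul (analyticAt_comp_symm hz hU hFU hw₀ (by rwa [hs])),
    by simp [hl0, hs], ?_⟩
  filter_upwards [hlσ, (z.tendsto_symm hx₀).eventually
    (eventually_joined (hU.inter z.open_source) ⟨hxU, hx₀⟩)] with w hw hδ x γ hγ hxw
  have hx : (x : C) ∈ z.source := by simpa using hγ 1
  have hwx : z.symm w = x := by rw [← hxw, z.left_inv hx]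
  rw [hwx] at hδ hw ⊢
  obtain ⟨δ, hδ⟩ := hδ
  have h1 : Path.Homotopic.Quotient.mk γ = Path.Homotopic.Quotient.mk (γ₀.trans δ) := by
    refine mk_eq_mk_of_simplyConnected hz_sc _ _ hγ fun t => ?_
    have ht : (γ₀.trans δ) t ∈ Set.range (γ₀.trans δ) := ⟨t, rfl⟩
    rw [Path.trans_range] at ht
    rcases ht with ⟨s, hs⟩ | ⟨s, hs⟩
    · exact hs ▸ hγ₀ s
    · exact hs ▸ (hδ s).2
  rw [h1, huF x δ fun t => (hδ t).1, ← hw, mul_right_comm]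
  by_cases hx' : (x : C) = x₀
  · exact Or.inr (hx' ▸ x.2.2)
  · exact Or.inl fun h => hx' (z.injOn hx hx₀ (hxw.trans h))

theorem exists_isCoordExpr (hz : z ∈ IsManifold.maximalAtlas 𝓘(ℂ, ℂ) ω C)
    (hz_mem : pinf ∈ z.source) (hz_zero : z pinf = 0) (hz_sc : SimplyConnectedSpace z.source)
    (hl : HasFactors Δ z σ) {g : ℕ} {b : Module.Basis (Fin g ⊕ Fin g) ℤ (H1 C pinf)}
    {e : Fin g → ℂ} {u : MultiFun pinf Δ} (hu : u ∈ sections b Δ e) :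
    ∃ f, IsCoordExpr z σ u f := by
  classical
  have hgerm : ∀ x₀ ∈ z.source, x₀ ≠ pinf →
      ∃ G, AnalyticAt ℂ G (z x₀) ∧ IsGerm z σ u (z x₀) G := by
    intro x₀ hx₀ hxp
    obtain ⟨γ₀, hγ₀⟩ := exists_path_of_simplyConnected hz_sc hz_mem hx₀
    obtain ⟨n, hn, F, hF⟩ := (mem_sections_iff.1 hu).2 x₀ γ₀
    rw [hn hxp] at hF
    obtain ⟨G, hGa, -, hG⟩ := exists_germ hz hz_sc hl hx₀ hγ₀ hF
    exact ⟨G, hGa, hG⟩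
  -- Well defined because all paths inside the simply connected domain with the same endpoint are
  -- homotopic.
  obtain ⟨v, hv⟩ : ∃ v : ℂ → ℂ, ∀ (x : GoodPoint pinf Δ) (γ : Path pinf (x : C)),
      (∀ t, γ t ∈ z.source) → v (z x) = u x (Path.Homotopic.Quotient.mk γ) * σ (z x) := by
    have h : ∀ w : ℂ, ∃ c : ℂ, ∀ (x : GoodPoint pinf Δ) (γ : Path pinf (x : C)),
        (∀ t, γ t ∈ z.source) → z x = w → c = u x (Path.Homotopic.Quotient.mk γ) * σ w := by
      intro w
      by_cases h : ∃ (x : GoodPoint pinf Δ) (γ : Path pinf (x : C)),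
          (∀ t, γ t ∈ z.source) ∧ z x = w
      · obtain ⟨x, γ, hγ, hx⟩ := h
        refine ⟨u x (Path.Homotopic.Quotient.mk γ) * σ w, fun x' γ' hγ' hx' => ?_⟩
        have hxx : x = x' := Subtype.ext (z.injOn (by simpa using hγ 1) (by simpa using hγ' 1)
          (hx.trans hx'.symm))
        subst hxx
        rw [mk_eq_mk_of_simplyConnected hz_sc γ γ' hγ hγ']
      · exact ⟨0, fun x γ hγ hx => absurd ⟨x, γ, hγ, hx⟩ h⟩
    choose v hv using h
    exact ⟨v, fun x γ hγ => hv _ x γ hγ rfl⟩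
  have hvG : ∀ x₀ ∈ z.source, ∀ G : ℂ → ℂ, AnalyticAt ℂ G (z x₀) → IsGerm z σ u (z x₀) G →
      ∀ᶠ w in 𝓝 (z x₀), Filter.limUnder (𝓝[≠] w) v = G w := by
    intro x₀ hx₀ G hGa hG
    have h1 := eventually_eq_of_isGerm hz_mem hz_sc hx₀ hG hv
    have h2 : ∀ᶠ w in 𝓝 (z x₀), ∀ᶠ w' in 𝓝[≠] w, v w' = G w' :=
      (isOpen_setOf_eventually_nhdsNE _).mem_nhds h1
    filter_upwards [h2, hGa.eventually_continuousAt] with w hw hwG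
    exact ((hwG.tendsto.mono_left nhdsWithin_le_nhds).congr'
      (hw.mono fun _ h => h.symm)).limUnder_eq
  -- Taking punctured limits repairs the arbitrary values of `v` on the support of `Δ`.
  refine ⟨fun w => Filter.limUnder (𝓝[≠] w) v, fun w hw => ?_, fun x γ hγ => ?_⟩
  · have hws := z.map_target hw.1
    have hwp : z.symm w ≠ pinf := fun h => hw.2 (by
      rw [Set.mem_singleton_iff, ← z.right_inv hw.1, h, hz_zero])
    obtain ⟨G, hGa, hG⟩ := hgerm _ hws hwp
    have h := hvG _ hws G hGa hG
    rw [z.right_inv hw.1] at h hGa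
    exact hGa.congr (h.mono fun _ h => h.symm)
  · have hx : (x : C) ∈ z.source := by simpa using hγ 1
    obtain ⟨G, hGa, hG⟩ := hgerm x hx x.2.1
    have h1 : Filter.limUnder (𝓝[≠] (z x)) v = G (z x) := (hvG _ hx G hGa hG).self_of_nhds
    exact h1.trans (hG.self_of_nhds x γ hγ rfl).symm

end Values

/-! ### Separating values by sections -/

section Separation

variable {C : Type*} [TopologicalSpace C] [T2Space C] [CompactSpace C] [ConnectedSpace C]
  [ChartedSpace ℂ C] [IsManifold 𝓘(ℂ, ℂ) ω C] {pinf : C} {g : ℕ}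
  {b : Module.Basis (Fin g ⊕ Fin g) ℤ (H1 C pinf)} {Δ : C →₀ ℤ} {e : Fin g → ℂ}
  {z : OpenPartialHomeomorph C ℂ} {σ : ℂ → ℂ}

/-- If there is a nonconstant function with poles only at the marked point, the coordinate
expressions of sections take arbitrary values at finitely many points. -/
theorem exists_section_eq_single (hz : z ∈ IsManifold.maximalAtlas 𝓘(ℂ, ℂ) ω C)
    (hz_mem : pinf ∈ z.source) (hz_zero : z pinf = 0) (hz_sc : SimplyConnectedSpace z.source)
    (hl : HasFactors Δ z σ) {f : {x : C // x ≠ pinf} → ℂ} (hf : f ∈ functionRing pinf)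
    (hfc : ∃ x y, f x ≠ f y) {ι : Type*} [Finite ι] [DecidableEq ι] {X : ι → {x : C // x ≠ pinf}}
    (hX : Function.Injective X) (hXz : ∀ i, (X i : C) ∈ z.source) (i : ι) :
    ∃ u ∈ sections b Δ e, ∃ G, IsCoordExpr z σ u G ∧
      ∀ j, G (z (X j)) = if j = i then 1 else 0 := by
  classical
  have := Fintype.ofFinite ι
  have hXC : Function.Injective fun j => (X j : C) := Subtype.val_injective.comp hX
  obtain ⟨u, hu, h1, h0⟩ := exists_interpolating_section b Δ e hf (X i).2
    ((Finset.univ.erase i).image fun j => (X j : C))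
    (fun h => by
      obtain ⟨j, hj, hji⟩ := Finset.mem_image.1 h
      exact (Finset.mem_erase.1 hj).1 (hXC hji))
    (fun h => by
      obtain ⟨j, -, hj⟩ := Finset.mem_image.1 h
      exact (X j).2 hj)
    (fun h => by
      obtain ⟨x, y, hxy⟩ := hfc
      have hx := eq_of_eventually_eq hf h x.2
      have hy := eq_of_eventually_eq hf h y.2
      rw [zeroExtend_of_ne f x.2] at hx
      rw [zeroExtend_of_ne f y.2] at hy
      exact hxy (hx.trans hy.symm))
  obtain ⟨G, hG⟩ := exists_isCoordExpr hz hz_mem hz_zero hz_sc hl hu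
  -- Stated with a proposition `F` so that `False` handles the point `X i` and `True` the points
  -- where the section vanishes.
  have hval : ∀ j F, (∀ γ : Path pinf (X j : C), ∃ F', HasLocalExpr u (X j) γ (-Δ (X j)) F' ∧
      (F' (X j) = 0 ↔ F)) → (G (z (X j)) = 0 ↔ F) := by
    intro j F h
    obtain ⟨γ, hγ⟩ := exists_path_of_simplyConnected hz_sc hz_mem (hXz j)
    obtain ⟨F', hF', hF⟩ := h γ
    obtain ⟨H, hHa, hH0, hH⟩ := exists_germ hz hz_sc hl (hXz j) hγ hF'
    rw [hG.value_eq hz_mem hz_zero hz_sc (hXz j) (X j).2 hHa hH, hH0, hF]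
  have hi : G (z (X i)) ≠ 0 := by
    have := hval i False fun γ => by
      obtain ⟨F', hF', hF⟩ := h1 γ
      exact ⟨F', hF', iff_of_false hF id⟩
    exact this.1
  refine ⟨(G (z (X i)))⁻¹ • u, smul_mem_sections _ hu, _, hG.smul _, fun j => ?_⟩
  split_ifs with hji
  · rw [hji, inv_mul_cancel₀ hi]
  · have hj := (hval j True fun γ => by
      obtain ⟨F', hF', hF⟩ := h0 (X j)
        (Finset.mem_image_of_mem _ (Finset.mem_erase.2 ⟨hji, Finset.mem_univ j⟩)) γ
      exact ⟨F', hF', iff_of_true hF trivial⟩).2 trivial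
    rw [hj, mul_zero]

theorem exists_section_eq (hz : z ∈ IsManifold.maximalAtlas 𝓘(ℂ, ℂ) ω C)
    (hz_mem : pinf ∈ z.source) (hz_zero : z pinf = 0) (hz_sc : SimplyConnectedSpace z.source)
    (hl : HasFactors Δ z σ) {f : {x : C // x ≠ pinf} → ℂ} (hf : f ∈ functionRing pinf)
    (hfc : ∃ x y, f x ≠ f y) {ι : Type*} [Fintype ι] [Nonempty ι] {X : ι → {x : C // x ≠ pinf}}
    (hX : Function.Injective X) (hXz : ∀ i, (X i : C) ∈ z.source) (t : ι → ℂ) :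
    ∃ u ∈ sections b Δ e, ∃ G, IsCoordExpr z σ u G ∧ ∀ j, G (z (X j)) = t j := by
  classical
  choose u hu G hG hGX using
    exists_section_eq_single (b := b) (e := e) hz hz_mem hz_zero hz_sc hl hf hfc hX hXz
  refine ⟨∑ i, t i • u i, sum_mem_sections Finset.univ_nonempty fun i _ =>
    smul_mem_sections _ (hu i), _, IsCoordExpr.sum Finset.univ_nonempty fun i _ =>
    (hG i).smul (t i), fun j => ?_⟩
  simp [hGX]

end Separation

end KPCurve

end

/-! ### The stabilizer -/

theorem mainTheorem5 {C : Type*} [TopologicalSpace C] [T2Space C] [CompactSpace C]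
    [ConnectedSpace C] [ChartedSpace ℂ C] [IsManifold 𝓘(ℂ, ℂ) ω C]
    (pinf : C) (g : ℕ) (hg : 0 < g)
    (b : Module.Basis (Fin g ⊕ Fin g) ℤ (KPCurve.H1 C pinf)) (hb : KPCurve.IsCanonicalBasis b)
    (dv : Fin g → KPCurve.OneForm C) (hdv : KPCurve.IsNormalizedForms b dv)
    (Ω : Matrix (Fin g) (Fin g) ℂ) (hΩ : KPCurve.IsPeriodMatrix b dv Ω)
    (Δ : C →₀ ℤ) (hΔ : KPCurve.IsRiemannDivisor pinf dv Ω Δ)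
    (z : OpenPartialHomeomorph C ℂ) (hz : z ∈ IsManifold.maximalAtlas 𝓘(ℂ, ℂ) ω C)
    (hz_mem : pinf ∈ z.source) (hz_zero : z pinf = 0) (hz_sc : SimplyConnectedSpace z.source)
    (η : KPCurve.OneForm C) (hη : KPCurve.HasDivisor η (2 • Δ))
    (σ : ℂ → ℂ) (hσ : KPCurve.IsSqrtCoeff η z σ)
    (e : Fin g → ℂ)
    (M N : ℕ) (hM : 0 < M) (hN : 0 < N)
    (P : Fin N → {x : C // x ≠ pinf}) (Q : Fin M → {x : C // x ≠ pinf})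
    (hP : ∀ i, (P i : C) ∈ z.source) (hQ : ∀ j, (Q j : C) ∈ z.source)
    (hPQ : Function.Injective (Sum.elim P Q))
    (a : Matrix (Fin M) (Fin N) ℂ) (B : Matrix (Fin N ⊕ Fin M) (Fin N) ℂ)
    (hB : B = KPCurve.matrixB (fun i => z (P i)) (fun j => z (Q j)) a) :
    KPCurve.stabilizer
        (KPCurve.spaceW b Δ e z σ (fun i => z (P i)) (fun j => z (Q j)) B) =
      {f | f ∈ KPCurve.functionRing pinf ∧
        ∀ (i : Fin N) (j : Fin M), B (Sum.inr j) i ≠ 0 → f (P i) = f (Q j)} := by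
  have hl : KPCurve.HasFactors Δ z σ := KPCurve.hasFactors hz hη hσ
  ext f
  constructor
  · rintro ⟨hf, hW⟩
    refine ⟨hf, fun i j hBij => ?_⟩
    by_contra hne
    have hne0 : ∀ x : {x : C // x ≠ pinf}, (x : C) ∈ z.source → z x ≠ 0 := fun x hx h =>
      (KPCurve.coord_mem hz_mem hz_zero hx x.2).2 h
    have : Nonempty (Fin N ⊕ Fin M) := ⟨Sum.inl i⟩
    have hXz : ∀ k, ((Sum.elim P Q k : {x : C // x ≠ pinf}) : C) ∈ z.source := fun k => by
      cases k
      · exact hP _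
      · exact hQ _
    -- The values at the `Q`'s are the `j`-th unit vector; those at the `P`'s are then dictated by
    -- the conditions of `W_e`. The hypothesis `hne` provides the nonconstant function.
    obtain ⟨u, hu, G, hG, hGt⟩ := KPCurve.exists_section_eq (b := b) (e := e) hz hz_mem hz_zero
      hz_sc hl hf ⟨_, _, hne⟩ hPQ hXz
      (Sum.elim (fun k => -(B (Sum.inr j) k * ((z (P k))⁻¹ * z (Q j)))) (Pi.single j 1))
    have hGP : ∀ k, G (z (P k)) = -(B (Sum.inr j) k * ((z (P k))⁻¹ * z (Q j))) := fun k =>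
      hGt (Sum.inl k)
    have hGQ : ∀ k, G (z (Q k)) = (Pi.single j 1 : Fin M → ℂ) k := fun k => hGt (Sum.inr k)
    have huW : u ∈ KPCurve.spaceW b Δ e z σ (fun i => z (P i)) (fun j => z (Q j)) B := by
      refine ⟨hu, G, hG, fun k => ?_⟩
      simp only [hGP, hGQ]
      rw [Finset.sum_eq_single j (fun l _ hl => by rw [Pi.single_eq_of_ne hl, mul_zero]) (by simp),
        Pi.single_eq_same, mul_one]
    obtain ⟨-, G', hG', hG'W⟩ := hW u huW
    -- The expression `G'` witnessing membership of `f u` need not be `f G` as given, but the two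
    -- agree off the marked point.
    have hval : ∀ x : {x : C // x ≠ pinf}, (x : C) ∈ z.source →
        G' (z x) = f x * G (z x) := fun x hx => by
      rw [hG'.unique hz_mem hz_zero hz_sc (hG.mulSection hz hz_zero hf) hx x.2, z.left_inv hx,
        KPCurve.zeroExtend_of_ne f x.2]
    have h := hG'W i
    simp only [hval _ (hP _), hval _ (hQ _), hGP, hGQ] at h
    rw [Finset.sum_eq_single j
      (fun l _ hl => by rw [Pi.single_eq_of_ne hl, mul_zero, mul_zero]) (by simp),
      Pi.single_eq_same, mul_one, mul_neg, neg_inj, mul_comm] at h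
    exact hne (mul_left_cancel₀ (mul_ne_zero hBij
      (mul_ne_zero (inv_ne_zero (hne0 _ (hP i))) (hne0 _ (hQ j)))) h)
  · rintro ⟨hf, hfB⟩
    refine ⟨hf, fun u hu => ?_⟩
    obtain ⟨hu, G, hG, hGW⟩ := hu
    refine ⟨KPCurve.mulSection_mem_sections hf hu, _, hG.mulSection hz hz_zero hf, fun i => ?_⟩
    simp only [z.left_inv (hP _), z.left_inv (hQ _), KPCurve.zeroExtend_of_ne f (P _).2,
      KPCurve.zeroExtend_of_ne f (Q _).2]
    rw [hGW i, mul_neg, Finset.mul_sum]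
    congr 1
    refine Finset.sum_congr rfl fun j _ => ?_
    -- A vanishing coefficient imposes nothing on `f`; otherwise `f (P i)` may be replaced by `f (Q
    -- j)` in this summand.
    by_cases h : B (Sum.inr j) i = 0
    · rw [h]
      ring
    · rw [← hfB i j h]
      ring
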